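/- Let $\Psi$ be the set of all increasing (i.e. non-decreasing), continuous, concave functions $\psi:[0,1]\to\mathbb{R}$ with $\psi(0)=0$ that are not identically zero. For $\psi\in\Psi$ let $\Lambda(\psi)$ be the Lorentz space of (classes of a.e. equal) Lebesgue measurable functions $x:[0,1]\to\mathbb{R}$ with $$\|x\|_{\Lambda(\psi)}=\int_0^1 x^*(t)\,d\psi(t)<\infty,\qquad x^*(t)=\inf\{s\ge 0:\ m(\{u\in[0,1]:|x(u)|>s\})\le t\},$$ where $m$ is Lebesgue measure. For $p\ge 1$, a bounded sequence $(x_n)$ in $\Lambda(\psi)$ is called a $p$-BS-sequence if for every subsequence $(y_k)$ of $(x_n)$ $$\sup_{m\ge 1} m^{-1/p}\Big\|\sum_{k=1}^m y_k\Big\|_{\Lambda(\psi)}<\infty .$$ Let $\Gamma_{\rm i}(\Lambda(\psi))$ be the set of all real $p\ge 1$ such that every weakly null sequence in $\Lambda(\psi)$ consisting of independent random variables on $([0,1],m)$ has a subsequence that is a $p$-BS-sequence. Then, for every $\psi\in\Psi$, $\Gamma_{\rm i}(\Lambda(\psi))\neq\{1\}$ if and only if there exist integers $k\ge 2$ and $l\ge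 2$ such that $$\limsup_{u\to 0+}\frac{\psi(ku)}{\psi(u)}<k\qquad\text{and}\qquad \limsup_{u\to 0+}\frac{\psi(u^l)}{\psi(u)}<1 .$$ -/

import Mathlib

open MeasureTheory Filter Topology ProbabilityTheory Set
open scoped ENNReal

noncomputable section

namespace LorentzBS

/-! ### Rearrangements on `[0,1]` -/

/-- The distribution function `s ↦ m {u ∈ [0,1] : |x u| > s}`, with `m` Lebesgue measure. -/
def distrib (x : unitInterval → ℝ) (s : ℝ) : ℝ :=
  (volume : Measure unitInterval).real {u | s < |x u|}

/-- The non-increasing right-continuous rearrangement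
`x*(t) = inf {s ≥ 0 : m {|x| > s} ≤ t}`, for `t > 0`. -/
def rearr (x : unitInterval → ℝ) (t : ℝ) : ℝ :=
  sInf {s : ℝ | 0 ≤ s ∧ distrib x s ≤ t}

/-! ### The class `Ψ` and the Lorentz space -/

/-- The class `Ψ` of increasing (in the weak sense), continuous, concave functions on `[0,1]`
which vanish at `0` and are not identically zero.
Only the values on `[0,1]` are relevant. -/
structure Psi where
  toFun : ℝ → ℝ
  monotoneOn : MonotoneOn toFun (Icc 0 1)
  continuousOn : ContinuousOn toFun (Icc 0 1)
  concaveOn : ConcaveOn ℝ (Icc 0 1) toFun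
  map_zero : toFun 0 = 0
  ne_zero : ∃ t ∈ Icc (0 : ℝ) 1, toFun t ≠ 0

instance : CoeFun Psi fun _ => ℝ → ℝ := ⟨Psi.toFun⟩

lemma clamp_mem (t : ℝ) : max 0 (min t 1) ∈ Icc (0 : ℝ) 1 :=
  ⟨le_max_left _ _, max_le zero_le_one (min_le_right _ _)⟩

/-- `ψ` extended to `ℝ` by constants to the left of `0` and to the right of `1`,
as a Stieltjes function. -/
def Psi.stieltjes (ψ : Psi) : StieltjesFunction ℝ where
  toFun t := ψ (max 0 (min t 1))
  mono' a b h := ψ.monotoneOn (clamp_mem a) (clamp_mem b)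
    (max_le_max le_rfl (min_le_min h le_rfl))
  right_continuous' x := by
    have : Continuous fun t : ℝ => ψ (max 0 (min t 1)) :=
      ψ.continuousOn.comp_continuous (by fun_prop) clamp_mem
    exact this.continuousWithinAt

/-- The Lebesgue–Stieltjes measure `dψ` on `[0,1]` (it has no atoms, as `ψ` is continuous). -/
def Psi.dmeas (ψ : Psi) : Measure ℝ := ψ.stieltjes.measure.restrict (Ioc 0 1)

/-- The Lorentz norm `∫₀¹ x*(t) dψ(t)`, with values in `[0,∞]`. -/
def lorentzENorm (ψ : Psi) (x : unitInterval → ℝ) : ℝ≥0∞ :=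
  ∫⁻ t, ENNReal.ofReal (rearr x t) ∂ψ.dmeas

/-! ### Facts needed to see that the Lorentz space is a vector space -/

lemma distrib_anti (x : unitInterval → ℝ) : Antitone (distrib x) := fun _ _ h =>
  measureReal_mono (fun _ hu => lt_of_le_of_lt h hu)

lemma distrib_nonneg (x : unitInterval → ℝ) (s : ℝ) : 0 ≤ distrib x s := measureReal_nonneg

lemma distrib_le_one (x : unitInterval → ℝ) (s : ℝ) : distrib x s ≤ 1 := measureReal_le_one

lemma exists_distrib_le {x : unitInterval → ℝ} (hx : AEMeasurable x volume) {t : ℝ}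
    (ht : 0 < t) : ∃ s : ℝ, 0 ≤ s ∧ distrib x s ≤ t := by
  have h := tendsto_measure_iInter_atTop (μ := (volume : Measure unitInterval))
    (s := fun n : ℕ => {u | (n : ℝ) < |x u|})
    (fun n => nullMeasurableSet_lt aemeasurable_const hx.abs)
    (fun m n hmn u (hu : (n : ℝ) < |x u|) => show (m : ℝ) < |x u| from
      lt_of_le_of_lt (Nat.cast_le.2 hmn) hu)
    ⟨0, measure_ne_top _ _⟩
  have he : (⋂ n : ℕ, {u | (n : ℝ) < |x u|}) = ∅ := by
    ext u
    simp only [mem_iInter, mem_ofPred_eq, mem_empty_iff_false, iff_false, not_forall, not_lt]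
    exact exists_nat_ge _
  rw [he, measure_empty] at h
  obtain ⟨n, hn⟩ := (h.eventually (gt_mem_nhds (ENNReal.ofReal_pos.2 ht))).exists
  exact ⟨n, Nat.cast_nonneg n, ENNReal.toReal_le_of_le_ofReal ht.le hn.le⟩

lemma exists_lt_distrib {x : unitInterval → ℝ} {s t : ℝ} (h : t < distrib x s) :
    ∃ s' > s, t < distrib x s' := by
  rcases lt_or_ge t 0 with ht | ht
  · exact ⟨s + 1, by linarith, ht.trans_le (distrib_nonneg _ _)⟩
  have hl := tendsto_measure_iUnion_atTop (μ := (volume : Measure unitInterval))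
    (s := fun n : ℕ => {u | s + 1 / ((n : ℝ) + 1) < |x u|})
    (fun m n hmn u hu => lt_of_le_of_lt
      (add_le_add_right (one_div_le_one_div_of_le (by positivity) (by gcongr)) s) hu)
  have he : (⋃ n : ℕ, {u | s + 1 / ((n : ℝ) + 1) < |x u|}) = {u | s < |x u|} := by
    ext u
    simp only [mem_iUnion, mem_ofPred_eq]
    constructor
    · rintro ⟨n, hn⟩
      have : (0 : ℝ) < 1 / ((n : ℝ) + 1) := by positivity
      linarith
    · intro hu
      obtain ⟨n, hn⟩ := exists_nat_one_div_lt (sub_pos.2 hu)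
      exact ⟨n, by linarith⟩
  rw [he] at hl
  have h' : ENNReal.ofReal t < volume {u | s < |x u|} :=
    (ENNReal.ofReal_lt_iff_lt_toReal ht (measure_ne_top _ _)).2 h
  obtain ⟨n, hn⟩ := (hl.eventually (lt_mem_nhds h')).exists
  refine ⟨s + 1 / ((n : ℝ) + 1), ?_, ?_⟩
  · have : (0 : ℝ) < 1 / ((n : ℝ) + 1) := by positivity
    linarith
  · exact (ENNReal.ofReal_lt_iff_lt_toReal ht (measure_ne_top _ _)).1 hn

lemma rearr_nonneg (x : unitInterval → ℝ) (t : ℝ) : 0 ≤ rearr x t :=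
  Real.sInf_nonneg fun _ h => h.1

lemma lt_rearr_iff {x : unitInterval → ℝ} (hx : AEMeasurable x volume) {s t : ℝ}
    (hs : 0 ≤ s) (ht : 0 < t) : s < rearr x t ↔ t < distrib x s := by
  constructor
  · intro h
    by_contra! hc
    exact absurd (csInf_le ⟨0, fun _ h => h.1⟩ (show s ∈ {s : ℝ | 0 ≤ s ∧ distrib x s ≤ t} from
      ⟨hs, hc⟩)) (not_le.2 h)
  · intro h
    obtain ⟨s', hs', h'⟩ := exists_lt_distrib h
    refine hs'.trans_le (le_csInf (exists_distrib_le hx ht) ?_)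
    rintro r ⟨-, hr⟩
    by_contra! hc
    exact absurd ((h'.trans_le (distrib_anti x hc.le)).trans_le hr) (lt_irrefl _)

lemma rearr_anti {x : unitInterval → ℝ} (hx : AEMeasurable x volume) :
    AntitoneOn (rearr x) (Ioc 0 1) := by
  intro a ha b _ hab
  refine csInf_le_csInf ⟨0, fun _ h => h.1⟩ (exists_distrib_le hx ha.1) ?_
  exact fun s hs => ⟨hs.1, hs.2.trans hab⟩

lemma Psi.stieltjes_apply (ψ : Psi) {t : ℝ} (ht : t ∈ Icc (0 : ℝ) 1) : ψ.stieltjes t = ψ t := by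
  change ψ (max 0 (min t 1)) = ψ t
  rw [min_eq_left ht.2, max_eq_right ht.1]

lemma Psi.stieltjes_continuous (ψ : Psi) : Continuous ψ.stieltjes :=
  ψ.continuousOn.comp_continuous (by fun_prop) clamp_mem

lemma Psi.dmeas_Ioo (ψ : Psi) {a : ℝ} (ha : a ∈ Icc (0 : ℝ) 1) :
    ψ.stieltjes.measure (Ioo 0 a) = ENNReal.ofReal (ψ a) := by
  rw [StieltjesFunction.measure_Ioo,
    leftLim_eq_of_tendsto
      ((ψ.stieltjes_continuous.tendsto a).mono_left nhdsWithin_le_nhds),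
    ψ.stieltjes_apply ha, ψ.stieltjes_apply (by simp), ψ.map_zero, sub_zero]

/-- `∫₀¹ x* dψ = ∫₀^∞ ψ (m {|x| > s}) ds`. -/
lemma lorentzENorm_eq (ψ : Psi) {x : unitInterval → ℝ} (hx : AEMeasurable x volume) :
    lorentzENorm ψ x = ∫⁻ s in Ioi (0 : ℝ), ENNReal.ofReal (ψ (distrib x s)) := by
  have hm : AEMeasurable (rearr x) ψ.dmeas :=
    aemeasurable_restrict_of_antitoneOn measurableSet_Ioc (rearr_anti hx)
  rw [lorentzENorm, lintegral_eq_lintegral_meas_lt _ (ae_of_all _ (rearr_nonneg x)) hm]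
  refine setLIntegral_congr_fun measurableSet_Ioi fun s hs => ?_
  have hd : distrib x s ∈ Icc (0 : ℝ) 1 := ⟨distrib_nonneg x s, distrib_le_one x s⟩
  have : {t | s < rearr x t} ∩ Ioc 0 1 = Ioo 0 (distrib x s) := by
    ext t
    simp only [mem_inter_iff, mem_ofPred_eq, mem_Ioc, mem_Ioo]
    constructor
    · rintro ⟨h, h0, -⟩
      exact ⟨h0, (lt_rearr_iff hx (le_of_lt hs) h0).1 h⟩
    · rintro ⟨h0, h⟩
      exact ⟨(lt_rearr_iff hx (le_of_lt hs) h0).2 h, h0, h.le.trans hd.2⟩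
  rw [Psi.dmeas, Measure.restrict_apply' measurableSet_Ioc, this, ψ.dmeas_Ioo hd]

lemma Psi.nonneg (ψ : Psi) {t : ℝ} (ht : t ∈ Icc (0 : ℝ) 1) : 0 ≤ ψ t := by
  rw [← ψ.map_zero]; exact ψ.monotoneOn (by simp) ht ht.1

/-- Concave functions vanishing at `0` are subadditive. -/
lemma Psi.le_add (ψ : Psi) {a b c : ℝ} (ha : a ∈ Icc (0 : ℝ) 1) (hb : b ∈ Icc (0 : ℝ) 1)
    (hc : c ∈ Icc (0 : ℝ) 1) (h : c ≤ a + b) : ψ c ≤ ψ a + ψ b := by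
  rcases le_total c a with h1 | h1
  · exact (ψ.monotoneOn hc ha h1).trans (le_add_of_nonneg_right (ψ.nonneg hb))
  rcases eq_or_lt_of_le hc.1 with h0 | h0
  · rw [← h0, ψ.map_zero]; exact add_nonneg (ψ.nonneg ha) (ψ.nonneg hb)
  have key : ∀ r ∈ Icc (0 : ℝ) c, r / c * ψ c ≤ ψ r := by
    intro r hr
    have := ψ.concaveOn.2 (show (0 : ℝ) ∈ Icc (0 : ℝ) 1 by simp) hc
      (sub_nonneg.2 ((div_le_one h0).2 hr.2)) (div_nonneg hr.1 h0.le) (by ring)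
    simp only [smul_eq_mul, mul_zero, zero_add, ψ.map_zero] at this
    rwa [div_mul_cancel₀ _ h0.ne'] at this
  have e1 := key a ⟨ha.1, h1⟩
  have e2 := key (c - a) ⟨sub_nonneg.2 h1, by linarith [ha.1]⟩
  have e3 : ψ (c - a) ≤ ψ b :=
    ψ.monotoneOn ⟨sub_nonneg.2 h1, by linarith [ha.1, hc.2]⟩ hb (by linarith)
  have e4 : a / c * ψ c + (c - a) / c * ψ c = ψ c := by field_simp; ring
  linarith

lemma rearr_smul_le {x : unitInterval → ℝ} (hx : AEMeasurable x volume) (c : ℝ) {t : ℝ}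
    (ht : 0 < t) : rearr (fun u => c * x u) t ≤ |c| * rearr x t := by
  by_contra! h
  have h1 := (lt_rearr_iff (hx.const_mul c)
    (mul_nonneg (abs_nonneg c) (rearr_nonneg x t)) ht).1 h
  have h2 : distrib (fun u => c * x u) (|c| * rearr x t) ≤ distrib x (rearr x t) := by
    refine measureReal_mono fun u hu => ?_
    simp only [mem_ofPred_eq, abs_mul] at hu ⊢
    exact lt_of_mul_lt_mul_left hu (abs_nonneg c)
  exact lt_irrefl _ ((lt_rearr_iff hx (rearr_nonneg x t) ht).2 (h1.trans_le h2))

lemma lorentzENorm_congr (ψ : Psi) {x y : unitInterval → ℝ} (h : x =ᵐ[volume] y) :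
    lorentzENorm ψ x = lorentzENorm ψ y := by
  have : distrib x = distrib y := by
    funext s
    refine measureReal_congr ?_
    filter_upwards [h] with u hu
    exact congrArg (fun r => s < |r|) hu
  simp only [lorentzENorm, rearr, this]

lemma lorentzENorm_smul_le (ψ : Psi) {x : unitInterval → ℝ} (hx : AEMeasurable x volume) (c : ℝ) :
    lorentzENorm ψ (fun u => c * x u) ≤ ENNReal.ofReal |c| * lorentzENorm ψ x := by
  rw [lorentzENorm, lorentzENorm, ← lintegral_const_mul' _ _ ENNReal.ofReal_ne_top]
  refine setLIntegral_mono' measurableSet_Ioc fun t ht => ?_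
  rw [← ENNReal.ofReal_mul (abs_nonneg c)]
  exact ENNReal.ofReal_le_ofReal (rearr_smul_le hx c ht.1)

lemma lorentzENorm_half_add_le (ψ : Psi) {x y : unitInterval → ℝ} (hx : AEMeasurable x volume)
    (hy : AEMeasurable y volume) :
    lorentzENorm ψ (fun u => (1 / 2) * (x u + y u)) ≤ lorentzENorm ψ x + lorentzENorm ψ y := by
  have hxy : AEMeasurable (fun u => (1 / 2) * (x u + y u)) volume := (hx.add hy).const_mul _
  rw [lorentzENorm_eq ψ hxy, lorentzENorm_eq ψ hx, lorentzENorm_eq ψ hy]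
  have hmeas : Measurable fun s => ENNReal.ofReal (ψ (distrib x s)) := by
    refine Antitone.measurable fun a b h => ENNReal.ofReal_le_ofReal ?_
    exact ψ.monotoneOn ⟨distrib_nonneg x b, distrib_le_one x b⟩
      ⟨distrib_nonneg x a, distrib_le_one x a⟩ (distrib_anti x h)
  rw [← lintegral_add_left hmeas]
  refine setLIntegral_mono' measurableSet_Ioi fun s _ => ?_
  have m : ∀ z : unitInterval → ℝ, distrib z s ∈ Icc (0 : ℝ) 1 := fun z =>
    ⟨distrib_nonneg z s, distrib_le_one z s⟩
  rw [← ENNReal.ofReal_add (ψ.nonneg (m x)) (ψ.nonneg (m y))]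
  refine ENNReal.ofReal_le_ofReal (ψ.le_add (m x) (m y) (m _) ?_)
  refine le_trans (measureReal_mono ?_) (measureReal_union_le _ _)
  intro u hu
  simp only [mem_ofPred_eq, mem_union] at hu ⊢
  by_contra! hc
  have h1 : |(1 / 2) * (x u + y u)| = (1 / 2) * |x u + y u| := by
    rw [abs_mul, abs_of_pos (by norm_num : (0 : ℝ) < 1 / 2)]
  have h2 := abs_add_le (x u) (y u)
  linarith [hc.1, hc.2]

/-- The Lorentz space `Λ(ψ)`: classes (modulo equality a.e.) of measurable real functions `x` on
`[0,1]` with `∫₀¹ x* dψ < ∞`. -/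
def Lorentz (ψ : Psi) : Submodule ℝ (unitInterval →ₘ[volume] ℝ) where
  carrier := {x | lorentzENorm ψ x < ∞}
  zero_mem' := by
    have h : lorentzENorm ψ (fun _ => (0 : ℝ) * 0) ≤ _ :=
      lorentzENorm_smul_le ψ (x := fun _ => 0) aemeasurable_const 0
    simp only [abs_zero, ENNReal.ofReal_zero, zero_mul] at h
    rw [mem_ofPred_eq, lorentzENorm_congr ψ AEEqFun.coeFn_zero]
    exact h.trans_lt ENNReal.zero_lt_top
  add_mem' {x y} hx hy := by
    have h := lorentzENorm_half_add_le ψ x.aemeasurable y.aemeasurable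
    have h' := lorentzENorm_smul_le ψ ((x.aemeasurable.add y.aemeasurable).const_mul (1 / 2)) 2
    have e : lorentzENorm ψ ((x + y : unitInterval →ₘ[volume] ℝ) : unitInterval → ℝ) =
        lorentzENorm ψ (fun u => 2 * ((1 / 2) * (x + y : unitInterval → ℝ) u)) := by
      refine lorentzENorm_congr ψ ?_
      filter_upwards [AEEqFun.coeFn_add x y] with u hu
      rw [hu]; ring
    rw [mem_ofPred_eq, e]
    exact (h'.trans (mul_le_mul_right h _)).trans_lt
      (ENNReal.mul_lt_top ENNReal.ofReal_lt_top (ENNReal.add_lt_top.2 ⟨hx, hy⟩))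
  smul_mem' c x hx := by
    rw [mem_ofPred_eq, lorentzENorm_congr ψ (AEEqFun.coeFn_smul c x)]
    exact (lorentzENorm_smul_le ψ x.aemeasurable c).trans_lt
      (ENNReal.mul_lt_top ENNReal.ofReal_lt_top hx)

/-- The norm of `Λ(ψ)`, as a real number. -/
def lorentzNorm (ψ : Psi) (x : Lorentz ψ) : ℝ :=
  (lorentzENorm ψ (x : unitInterval →ₘ[volume] ℝ)).toReal

/-! ### Banach–Saks index set for independent random variables -/

/-- Weak convergence to zero: `φ (x n) → 0` for every bounded linear functional `φ` on `Λ(ψ)`. -/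
def WeaklyNull (ψ : Psi) (x : ℕ → Lorentz ψ) : Prop :=
  ∀ φ : Lorentz ψ →ₗ[ℝ] ℝ, (∃ C : ℝ, ∀ y, |φ y| ≤ C * lorentzNorm ψ y) →
    Tendsto (fun n => φ (x n)) atTop (𝓝 0)

/-- `x` is a `p`-BS-sequence: it is bounded and for each of its subsequences `y` one has
`sup_{m ≥ 1} m^{-1/p} ‖y_1 + ⋯ + y_m‖ < ∞`. -/
def IsBSSeq (ψ : Psi) (p : ℝ) (x : ℕ → Lorentz ψ) : Prop :=
  (∃ C : ℝ, ∀ n, lorentzNorm ψ (x n) ≤ C) ∧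
  ∀ σ : ℕ → ℕ, StrictMono σ → ∃ C : ℝ, ∀ m : ℕ, 1 ≤ m →
    (m : ℝ) ^ (-(1 / p)) * lorentzNorm ψ (∑ k ∈ Finset.range m, x (σ k)) ≤ C

/-- `Γ_i(Λ(ψ))`: all `p ≥ 1` such that every weakly null sequence of independent random variables
in `Λ(ψ)` contains a subsequence which is a `p`-BS-sequence. -/
def GammaInd (ψ : Psi) : Set ℝ :=
  {p | 1 ≤ p ∧ ∀ x : ℕ → Lorentz ψ, WeaklyNull ψ x →
    iIndepFun (fun n => ((x n : unitInterval →ₘ[volume] ℝ) : unitInterval → ℝ))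
      (volume : Measure unitInterval) →
    ∃ τ : ℕ → ℕ, StrictMono τ ∧ IsBSSeq ψ p (x ∘ τ)}

end LorentzBS

end

namespace LorentzBS

/-! ### Elementary properties of functions in `Ψ` -/

/-! A sum of `m` independent centred variables can have norm of order `m` for two reasons. Either
the summands behave as if disjoint and ψ is almost additive, ψ(mu) ≈ mψ(u), or all of them are large
together, an event of probability u^m, and ψ hardly notices the power, ψ(u^m) ≈ ψ(u). The two limsup
conditions exclude exactly these cases.

Sufficiency. Iterating the conditions gives ψ(t) ≤ A(t/u)^α ψ(u) with α < 1
(`Psi.exists_upper_index`) and ψ(u^r) ≤ A r^(-δ) ψ(u) for u ≤ 1/2 (`Psi.exists_log_index`). With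
Chernoff bounds they show that `m` independent variables bounded by 1, with supports of measure at
most v, have a centred sum of norm at most C m^β ψ(v) for one β < 1 (`exists_lorentzENorm_sum_le`).
A general variable is cut into dyadic layers, the i-th of which costs about 2^i ψ(m{|x| > 2^i}).
These costs must be summable uniformly along a subsequence. A gliding hump argument, in which
independence kills the off-diagonal terms, shows that a weakly null independent sequence has
uniformly small dyadic tails (`WeaklyNull.uniform_tail`). Compactness then gives a subsequence with
a common summable majorant (`exists_subseq_iSup_summable`), and summing over the layers puts 1/β > 1
in the index set.

Necessity. If a condition fails for every integer, then for each k there are arbitrarily small bad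
scales u. Let g = ∑ 2^(-j) ψ(u_j)⁻¹ 1_[0,u_j], with u_j bad for a huge k_j. Centred independent
copies of g are weakly null, since the Cesàro means of all their subsequences tend to 0 in norm
(`weaklyNull_of_iid`). Yet k_j of them have a sum of norm at least k_j 2^(-j)/8
(`lorentzENorm_sum_ge`), which defeats every p > 1.

All norm estimates rest on ‖x‖ = ∫ ψ(m{|x| > s}) ds and on duality with weights h ≥ 0 satisfying ∫_B
h ≤ ψ(m(B)). -/

lemma Psi.mono (ψ : Psi) {a b : ℝ} (ha : 0 ≤ a) (hb : b ≤ 1) (h : a ≤ b) : ψ a ≤ ψ b :=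
  ψ.monotoneOn ⟨ha, h.trans hb⟩ ⟨ha.trans h, hb⟩ h

/-- Concavity together with ψ(0) = 0 makes ψ(t)/t non-increasing; here this is read off at c⁻¹b,
which lies between 0 and b. -/
lemma Psi.le_mul (ψ : Psi) {a b c : ℝ} (ha : a ∈ Icc (0 : ℝ) 1) (hb : b ∈ Icc (0 : ℝ) 1)
    (hc : 1 ≤ c) (h : b ≤ c * a) : ψ b ≤ c * ψ a := by
  have hc0 : 0 < c := by linarith
  have h1 := ψ.concaveOn.2 (show (0 : ℝ) ∈ Icc (0 : ℝ) 1 by simp) hb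
      (sub_nonneg.2 (inv_le_one_of_one_le₀ hc)) (inv_nonneg.2 hc0.le) (by ring)
  simp only [smul_eq_mul, mul_zero, zero_add, ψ.map_zero] at h1
  have h2 : c⁻¹ * b ≤ a := by
    rw [inv_mul_le_iff₀ hc0]; exact h
  have h3 := h1.trans (ψ.mono (mul_nonneg (inv_nonneg.2 hc0.le) hb.1) ha.2 h2)
  rwa [inv_mul_le_iff₀ hc0] at h3

lemma Psi.pos (ψ : Psi) {t : ℝ} (h0 : 0 < t) (h1 : t ≤ 1) : 0 < ψ t := by
  obtain ⟨r, hr, hne⟩ := ψ.ne_zero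
  have hr' : 0 < ψ r := lt_of_le_of_ne (ψ.nonneg hr) hne.symm
  have h := ψ.le_mul (c := max 1 (r / t)) ⟨h0.le, h1⟩ hr (le_max_left _ _) (by
    have := mul_le_mul_of_nonneg_right (le_max_right 1 (r / t)) h0.le
    rwa [div_mul_cancel₀ _ h0.ne'] at this)
  by_contra! hc
  have := mul_nonpos_of_nonneg_of_nonpos (le_trans zero_le_one (le_max_left 1 (r / t))) hc
  linarith

lemma Psi.mul_le (ψ : Psi) {t : ℝ} (ht : t ∈ Icc (0 : ℝ) 1) : t * ψ 1 ≤ ψ t := by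
  rcases eq_or_lt_of_le ht.1 with h0 | h0
  · rw [← h0, ψ.map_zero, zero_mul]
  have h := ψ.le_mul (c := t⁻¹) ht (show (1 : ℝ) ∈ Icc (0 : ℝ) 1 by simp)
    ((one_le_inv₀ h0).2 ht.2) (by rw [inv_mul_cancel₀ h0.ne'])
  rwa [← div_eq_inv_mul, le_div_iff₀ h0, mul_comm] at h

lemma distrib_mem (x : unitInterval → ℝ) (s : ℝ) : distrib x s ∈ Icc (0 : ℝ) 1 :=
  ⟨distrib_nonneg x s, distrib_le_one x s⟩

lemma measureReal_mem (B : Set unitInterval) :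
    (volume : Measure unitInterval).real B ∈ Icc (0 : ℝ) 1 := ⟨measureReal_nonneg, measureReal_le_one⟩

/-- Increments of `ψ` over a part of an interval, compared with a shift of that part to the
left. -/
lemma Psi.chord_le (ψ : Psi) {p q T b : ℝ} (hq : q ≤ 1) (hT : 0 ≤ T) (hTp : T ≤ p)
    (hb0 : 0 ≤ b) (hb : b ≤ q - p) :
    (ψ q - ψ p) / (q - p) * b ≤ ψ (T + b) - ψ T := by
  rcases eq_or_lt_of_le hb0 with h0 | h0
  · simp [← h0]
  have hpq : 0 < q - p := h0.trans_le hb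
  have key := ψ.concaveOn
  have hm : ∀ z, 0 ≤ z → z ≤ 1 → z ∈ Icc (0 : ℝ) 1 := fun z h1 h2 => ⟨h1, h2⟩
  -- slope over `[p, q]` is at most slope over `[p, p + b]`, at most slope over `[T, T + b]`
  have s1 : (ψ q - ψ p) / (q - p) ≤ (ψ (p + b) - ψ p) / b := by
    have h := key.2 (hm p (hT.trans hTp) (by linarith)) (hm q (by linarith) hq)
      (sub_nonneg.2 ((div_le_one hpq).2 hb)) (div_nonneg hb0 hpq.le) (by ring)
    simp only [smul_eq_mul] at h
    have e : (1 - b / (q - p)) * p + b / (q - p) * q = p + b := by field_simp; ring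
    rw [e] at h
    rw [le_div_iff₀ h0]
    have : (1 - b / (q - p)) * ψ p + b / (q - p) * ψ q = ψ p + (ψ q - ψ p) / (q - p) * b := by
      field_simp; ring
    linarith
  have s2 : ψ (p + b) - ψ p ≤ ψ (T + b) - ψ T := by
    rcases eq_or_lt_of_le hTp with hh | hh
    · rw [hh]
    -- Both T + b and p lie in [T, p + b], with complementary convex weights, so the two concavity
    -- inequalities add up to ψ(T) + ψ(p + b) ≤ ψ(T + b) + ψ(p).
    set l := p + b - T with hl
    have hl0 : 0 < l := by linarith
    have hbl : b ≤ l := by linarith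
    have h1 := key.2 (hm T hT (by linarith)) (hm (p + b) (by linarith) (by linarith))
      (sub_nonneg.2 ((div_le_one hl0).2 hbl)) (div_nonneg hb0 hl0.le) (by ring)
    have h2 := key.2 (hm T hT (by linarith)) (hm (p + b) (by linarith) (by linarith))
      (div_nonneg hb0 hl0.le) (sub_nonneg.2 ((div_le_one hl0).2 hbl)) (by ring)
    simp only [smul_eq_mul] at h1 h2
    have e1 : (1 - b / l) * T + b / l * (p + b) = T + b := by
      field_simp; rw [hl]; ring
    have e2 : b / l * T + (1 - b / l) * (p + b) = p := by
      field_simp; rw [hl]; ring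
    rw [e1] at h1
    rw [e2] at h2
    linarith
  calc (ψ q - ψ p) / (q - p) * b ≤ (ψ (p + b) - ψ p) / b * b :=
        mul_le_mul_of_nonneg_right s1 hb0
    _ = ψ (p + b) - ψ p := div_mul_cancel₀ _ h0.ne'
    _ ≤ _ := s2

/-! ### Weights subordinate to `ψ` and the dual description of the norm -/

/-- Bounded weights `h ≥ 0` with `∫_B h ≤ ψ(m(B))`: elements of the unit ball of the
Marcinkiewicz space dual to `Λ(ψ)`. -/
structure IsSubordinate (ψ : Psi) (h : unitInterval → ℝ) : Prop where
  measurable : Measurable h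
  nonneg : ∀ u, 0 ≤ h u
  bounded : ∃ H : ℝ, ∀ u, h u ≤ H
  setIntegral_le : ∀ B, MeasurableSet B → ∫ u in B, h u ≤ ψ ((volume : Measure unitInterval).real B)

lemma IsSubordinate.integrable {ψ : Psi} {h : unitInterval → ℝ} (hh : IsSubordinate ψ h) :
    Integrable h := by
  obtain ⟨H, hH⟩ := hh.bounded
  refine Integrable.of_bound hh.measurable.aestronglyMeasurable H (ae_of_all _ fun u => ?_)
  rw [Real.norm_of_nonneg (hh.nonneg u)]; exact hH u

lemma IsSubordinate.setLIntegral_le {ψ : Psi} {h : unitInterval → ℝ} (hh : IsSubordinate ψ h)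
    {B : Set unitInterval} (hB : MeasurableSet B) :
    ∫⁻ u in B, ENNReal.ofReal (h u) ≤
      ENNReal.ofReal (ψ ((volume : Measure unitInterval).real B)) := by
  rw [← ofReal_integral_eq_lintegral_ofReal hh.integrable.restrict (ae_of_all _ hh.nonneg)]
  exact ENNReal.ofReal_le_ofReal (hh.setIntegral_le B hB)

/-- Layer cake for the measure with density `H`, compared level by level with `lorentzENorm_eq`. The
constant `C` is kept free because sums of subordinate weights are later controlled only up to the
factor 3. -/
lemma lintegral_mul_le_lorentzENorm (ψ : Psi) {C : ℝ≥0∞} {x : unitInterval → ℝ} (hx : Measurable x)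
    {H : unitInterval → ℝ≥0∞} (hH : Measurable H)
    (h : ∀ B, MeasurableSet B → ∫⁻ u in B, H u ≤
      C * ENNReal.ofReal (ψ ((volume : Measure unitInterval).real B))) :
    ∫⁻ u, ENNReal.ofReal |x u| * H u ≤ C * lorentzENorm ψ x := by
  have h1 : ∫⁻ u, ENNReal.ofReal |x u| * H u
      = ∫⁻ u, ENNReal.ofReal |x u| ∂(volume.withDensity H) := by
    rw [lintegral_withDensity_eq_lintegral_mul _ hH (by fun_prop)]
    simp only [Pi.mul_apply, mul_comm]
  have hm : Measurable fun s => ENNReal.ofReal (ψ (distrib x s)) := by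
    refine Antitone.measurable fun a b h => ENNReal.ofReal_le_ofReal ?_
    exact ψ.monotoneOn (distrib_mem x b) (distrib_mem x a) (distrib_anti x h)
  rw [h1, lintegral_eq_lintegral_meas_lt _ (ae_of_all _ fun u => abs_nonneg _)
    (by fun_prop), lorentzENorm_eq ψ hx.aemeasurable, ← lintegral_const_mul _ hm]
  refine setLIntegral_mono' measurableSet_Ioi fun s _ => ?_
  have hs : MeasurableSet {u | s < |x u|} := measurableSet_lt measurable_const (by fun_prop)
  rw [withDensity_apply _ hs]
  exact h _ hs

lemma IsSubordinate.lintegral_mul_le {ψ : Psi} {h : unitInterval → ℝ} (hh : IsSubordinate ψ h)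
    {x : unitInterval → ℝ} (hx : Measurable x) :
    ∫⁻ u, ENNReal.ofReal |x u| * ENNReal.ofReal (h u) ≤ lorentzENorm ψ x := by
  have := lintegral_mul_le_lorentzENorm ψ (C := 1) hx (H := fun u => ENNReal.ofReal (h u))
    hh.measurable.ennreal_ofReal (fun B hB => by rw [one_mul]; exact hh.setLIntegral_le hB)
  rwa [one_mul] at this

/-- A chain of sets is normed simultaneously by one subordinate weight. -/
lemma isSubordinate_chain (ψ : Psi) {E : ℕ → Set unitInterval} (hE : ∀ i, MeasurableSet (E i))
    (hanti : Antitone E) (n : ℕ) (hn : E n = ∅) :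
    ∃ w : ℕ → ℝ, (∀ i, 0 ≤ w i) ∧
      IsSubordinate ψ (fun u => ∑ i ∈ Finset.range n, (E i \ E (i + 1)).indicator (fun _ => w i) u) ∧
      ∀ j < n, ∫ u in E j, ∑ i ∈ Finset.range n, (E i \ E (i + 1)).indicator (fun _ => w i) u
        = ψ ((volume : Measure unitInterval).real (E j)) := by
  set μ := (volume : Measure unitInterval) with hμ
  set d : ℕ → ℝ := fun i => μ.real (E i) with hd
  have hdm : ∀ i, d i ∈ Icc (0 : ℝ) 1 := fun i => measureReal_mem _
  have hda : ∀ i, d (i + 1) ≤ d i := fun i => measureReal_mono (hanti (Nat.le_succ i))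
  -- The slope of ψ across the i-th layer, so that the layer carries exactly the increment of ψ. If
  -- the layer is null the quotient is 0 by convention, and so is the increment.
  set w : ℕ → ℝ := fun i => (ψ (d i) - ψ (d (i + 1))) / (d i - d (i + 1)) with hw
  have hw0 : ∀ i, 0 ≤ w i := fun i => div_nonneg
    (sub_nonneg.2 (ψ.monotoneOn (hdm _) (hdm _) (hda i))) (sub_nonneg.2 (hda i))
  have hms : ∀ i, MeasurableSet (E i \ E (i + 1)) := fun i => (hE i).diff (hE _)
  have hint : ∀ B, MeasurableSet B →
      ∫ u in B, ∑ i ∈ Finset.range n, (E i \ E (i + 1)).indicator (fun _ => w i) u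
        = ∑ i ∈ Finset.range n, w i * μ.real (B ∩ (E i \ E (i + 1))) := by
    intro B hB
    rw [integral_finsetSum]
    · refine Finset.sum_congr rfl fun i _ => ?_
      rw [integral_indicator (hms i), Measure.restrict_restrict (hms i), setIntegral_const,
        smul_eq_mul, mul_comm, inter_comm]
    · intro i _
      exact (integrable_const (w i)).indicator (hms i)
  have hsplit : ∀ (B : Set unitInterval), MeasurableSet B → ∀ i,
      μ.real (B ∩ (E i \ E (i + 1))) = μ.real (B ∩ E i) - μ.real (B ∩ E (i + 1)) := by
    intro B hB i
    have h1 : B ∩ (E i \ E (i + 1)) = (B ∩ E i) \ (B ∩ E (i + 1)) := by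
      ext u; simp only [mem_inter_iff, Set.mem_sdiff]; tauto
    rw [h1, measureReal_sdiff (inter_subset_inter_right _ (hanti (Nat.le_succ i)))
      (hB.inter (hE _))]
  refine ⟨w, hw0, ⟨?_, ?_, ?_, ?_⟩, ?_⟩
  · exact Finset.measurable_fun_sum _ fun i _ => measurable_const.indicator (hms i)
  · intro u
    exact Finset.sum_nonneg fun i _ => indicator_nonneg (fun _ _ => hw0 i) u
  · refine ⟨∑ i ∈ Finset.range n, w i, fun u => Finset.sum_le_sum fun i _ => ?_⟩
    exact indicator_le_self' (fun _ _ => hw0 i) u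
  · intro B hB
    rw [hint B hB]
    calc ∑ i ∈ Finset.range n, w i * μ.real (B ∩ (E i \ E (i + 1)))
        ≤ ∑ i ∈ Finset.range n, (ψ (μ.real (B ∩ E i)) - ψ (μ.real (B ∩ E (i + 1)))) := by
          refine Finset.sum_le_sum fun i _ => ?_
          -- The part of `B` in layer i is moved left to start at the measure of `B ∩ E (i + 1)`. By
          -- concavity the increment of ψ there is no smaller, and these increments telescope.
          have h := ψ.chord_le (p := d (i + 1)) (q := d i) (T := μ.real (B ∩ E (i + 1)))
            (b := μ.real (B ∩ (E i \ E (i + 1)))) (hdm i).2 measureReal_nonneg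
            (measureReal_mono inter_subset_right) measureReal_nonneg (by
              have h1 : d i - d (i + 1) = μ.real (E i \ E (i + 1)) := by
                rw [measureReal_sdiff (hanti (Nat.le_succ i)) (hE _)]
              rw [h1]
              exact measureReal_mono inter_subset_right)
          have e : μ.real (B ∩ E (i + 1)) + μ.real (B ∩ (E i \ E (i + 1))) = μ.real (B ∩ E i) := by
            rw [hsplit B hB i]; ring
          rw [e] at h
          exact h
      _ = ψ (μ.real (B ∩ E 0)) := by
          rw [Finset.sum_range_sub' (fun i => ψ (μ.real (B ∩ E i))), hn]
          simp [ψ.map_zero]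
      _ ≤ ψ (μ.real B) := ψ.monotoneOn (measureReal_mem _) (measureReal_mem _)
          (measureReal_mono inter_subset_left)
  · intro j hj
    rw [hint _ (hE j)]
    have : ∀ i ∈ Finset.range n, w i * μ.real (E j ∩ (E i \ E (i + 1)))
        = ψ (μ.real (E j ∩ E i)) - ψ (μ.real (E j ∩ E (i + 1))) := by
      intro i _
      rw [hsplit _ (hE j) i]
      rcases le_or_gt j i with hij | hij
      · rw [inter_eq_right.2 (hanti hij), inter_eq_right.2 (hanti (hij.trans (Nat.le_succ i)))]
        change (ψ (d i) - ψ (d (i + 1))) / (d i - d (i + 1)) * (d i - d (i + 1)) = _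
        rcases eq_or_ne (d i - d (i + 1)) 0 with h0 | h0
        · have : d i = d (i + 1) := by linarith
          simp only [hd] at this
          rw [h0, this]; simp
        · rw [div_mul_cancel₀ _ h0]
      · rw [inter_eq_left.2 (hanti hij.le), inter_eq_left.2 (hanti (Nat.succ_le_of_lt hij))]
        simp
    rw [Finset.sum_congr rfl this, Finset.sum_range_sub' (fun i => ψ (μ.real (E j ∩ E i))), hn,
      inter_eq_left.2 (hanti (Nat.zero_le j))]
    simp [ψ.map_zero]

/-- A staircase with jump `c i` at `s i` stays below the identity once its height after each jump is
at most the level just crossed. With r = |x|, it turns a discrete sum over levels into a minorant of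
|x|. -/
lemma sum_indicator_levels_le {s c : ℕ → ℝ} (hs : Monotone s)
    (hcs : ∀ j, ∑ i ∈ Finset.range (j + 1), c i ≤ s j) {r : ℝ} (hr : 0 ≤ r) (n : ℕ) :
    ∑ i ∈ Finset.range n, (Ioi (s i)).indicator (fun _ => c i) r ≤ r := by
  induction n with
  | zero => simpa
  | succ n ih =>
    by_cases h : s n < r
    · refine le_trans (le_of_eq (Finset.sum_congr rfl fun i hi => ?_)) ((hcs n).trans h.le)
      exact indicator_of_mem (show s i < r from
        (hs (Nat.lt_succ_iff.1 (Finset.mem_range.1 hi))).trans_lt h) _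
    · rw [Finset.sum_range_succ, indicator_of_notMem (by simpa using h), add_zero]
      exact ih

/-- For a given grid of levels, a subordinate weight, depending only on the value of `x`, which
norms all the level sets. -/
lemma exists_levelWeight (ψ : Psi) {x : unitInterval → ℝ} (hx : Measurable x) {s : ℕ → ℝ}
    (hs : Monotone s) (n : ℕ) :
    ∃ G : ℝ → ℝ, Measurable G ∧ IsSubordinate ψ (fun u => G (x u)) ∧
      (∀ r, |r| ≤ s 0 → G r = 0) ∧
      ∀ c : ℕ → ℝ, (∀ i, 0 ≤ c i) → (∀ j, ∑ i ∈ Finset.range (j + 1), c i ≤ s j) →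
        ENNReal.ofReal (∑ i ∈ Finset.range n, c i * ψ (distrib x (s i))) ≤
          ∫⁻ u, ENNReal.ofReal |x u| * ENNReal.ofReal (G (x u)) := by
  -- The sets live on the value line, so the weight is a function of `x` alone and inherits
  -- independence. The condition i < n makes the chain end in the empty set.
  set F : ℕ → Set ℝ := fun i => {r | i < n ∧ s i < |r|} with hF
  have hFm : ∀ i, MeasurableSet (F i) := fun i =>
    (MeasurableSet.const _).inter (measurableSet_lt measurable_const measurable_id.abs)
  have hFa : Antitone F := fun i j hij r hr => ⟨hij.trans_lt hr.1, (hs hij).trans_lt hr.2⟩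
  set E : ℕ → Set unitInterval := fun i => x ⁻¹' F i with hE
  have hEm : ∀ i, MeasurableSet (E i) := fun i => hx (hFm i)
  obtain ⟨w, hw0, hsub, hint⟩ := isSubordinate_chain ψ (E := E) hEm
    (fun i j hij => preimage_mono (hFa hij)) n (by ext u; simp [hE, hF])
  set G : ℝ → ℝ := fun r => ∑ i ∈ Finset.range n, (F i \ F (i + 1)).indicator (fun _ => w i) r
    with hG
  have hGx : (fun u => ∑ i ∈ Finset.range n, (E i \ E (i + 1)).indicator (fun _ => w i) u)
      = fun u => G (x u) := rfl
  rw [hGx] at hsub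
  refine ⟨G, Finset.measurable_fun_sum _ fun i _ =>
    measurable_const.indicator ((hFm i).diff (hFm _)), hsub, fun r hr => ?_, fun c hc hcs => ?_⟩
  · refine Finset.sum_eq_zero fun i _ => indicator_of_notMem (fun h => ?_) _
    exact absurd (((hs (Nat.zero_le i)).trans_lt h.1.2)) (not_lt.2 hr)
  · have hmain : ∑ i ∈ Finset.range n, c i * ψ (distrib x (s i)) =
        ∫ u, (∑ i ∈ Finset.range n, (Ioi (s i)).indicator (fun _ => c i) |x u|) * G (x u) := by
      simp_rw [Finset.sum_mul]
      rw [integral_finsetSum]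
      · refine Finset.sum_congr rfl fun i hi => ?_
        have hi' := Finset.mem_range.1 hi
        have hEi : E i = {u | s i < |x u|} := by ext u; simp [hE, hF, hi']
        have h2 := hint i hi'
        rw [hGx] at h2
        have h3 : ψ (distrib x (s i)) = ∫ u in E i, G (x u) := by
          rw [h2, hEi]; rfl
        rw [h3, ← integral_indicator (hEm i), ← integral_const_mul]
        refine integral_congr_ae (ae_of_all _ fun u => ?_)
        by_cases hu : s i < |x u|
        · have : u ∈ E i := by rw [hEi]; exact hu
          simp [indicator_of_mem this, hu]
        · have : u ∉ E i := by rw [hEi]; exact hu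
          simp [indicator_of_notMem this, hu]
      · intro i _
        refine hsub.integrable.bdd_mul (c := |c i|) ?_ (ae_of_all _ fun u => ?_)
        · exact (Measurable.comp (measurable_const.indicator measurableSet_Ioi)
            (by fun_prop : Measurable fun u => |x u|)).aestronglyMeasurable
        · refine (norm_indicator_le_norm_self _ _).trans ?_
          rw [Real.norm_eq_abs]
    rw [hmain]
    have hle : ∀ f : unitInterval → ℝ, (∀ u, 0 ≤ f u) →
        ENNReal.ofReal (∫ u, f u) ≤ ∫⁻ u, ENNReal.ofReal (f u) := by
      intro f hf
      by_cases hi : Integrable f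
      · exact (ofReal_integral_eq_lintegral_ofReal hi (ae_of_all _ hf)).le
      · simp [integral_undef hi]
    refine (hle _ fun u => mul_nonneg (Finset.sum_nonneg fun i _ =>
      indicator_nonneg (fun _ _ => hc i) _) (hsub.nonneg u)).trans ?_
    refine lintegral_mono fun u => ?_
    rw [← ENNReal.ofReal_mul (abs_nonneg _)]
    exact ENNReal.ofReal_le_ofReal (mul_le_mul_of_nonneg_right
      (sum_indicator_levels_le hs hcs (abs_nonneg _) n) (hsub.nonneg u))

/-- Left-endpoint Riemann sums dominate an antitone integrand. The grid starts at ε, not 0, so that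
jumps of size ε at the levels (i + 1)ε satisfy the staircase condition. -/
lemma setLIntegral_Ioc_le_sum {f : ℝ → ℝ≥0∞} (hf : Antitone f) {ε : ℝ} (n : ℕ) :
    ∫⁻ s in Ioc ε ((n + 1) * ε), f s ≤
      ∑ i ∈ Finset.range n, ENNReal.ofReal ε * f ((i + 1) * ε) := by
  induction n with
  | zero => simp
  | succ n ih =>
    rw [Finset.sum_range_succ]
    have h1 : Ioc ε (((n + 1 : ℕ) + 1 : ℝ) * ε) ⊆
        Ioc ε ((n + 1) * ε) ∪ Ioc ((n + 1) * ε) (((n + 1 : ℕ) + 1 : ℝ) * ε) :=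
      fun r hr => by
        rcases le_or_gt r ((n + 1) * ε) with h | h
        · exact Or.inl ⟨hr.1, h⟩
        · exact Or.inr ⟨h, hr.2⟩
    refine (lintegral_mono_set h1).trans ((lintegral_union_le _ _ _).trans (add_le_add ih ?_))
    calc ∫⁻ s in Ioc ((n + 1) * ε) (((n + 1 : ℕ) + 1 : ℝ) * ε), f s
        ≤ ∫⁻ _ in Ioc ((n + 1) * ε) (((n + 1 : ℕ) + 1 : ℝ) * ε), f ((n + 1) * ε) :=
          setLIntegral_mono' measurableSet_Ioc fun s hs => hf hs.1.le
      _ = _ := by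
          rw [setLIntegral_const, Real.volume_Ioc, mul_comm]
          congr 2
          push_cast; ring

lemma lintegral_Ioi_le_of_forall {f : ℝ → ℝ≥0∞} {K : ℝ≥0∞}
    (h : ∀ n : ℕ, ∫⁻ s in Ioc ((n : ℝ) + 1)⁻¹ ((n : ℝ) + 1), f s ≤ K) :
    ∫⁻ s in Ioi (0 : ℝ), f s ≤ K := by
  have hmono : Monotone fun n : ℕ => Ioc ((n : ℝ) + 1)⁻¹ ((n : ℝ) + 1) := by
    intro a b hab
    have : (a : ℝ) ≤ b := Nat.cast_le.2 hab
    exact Ioc_subset_Ioc (by gcongr) (by gcongr)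
  have hU : ⋃ n : ℕ, Ioc ((n : ℝ) + 1)⁻¹ ((n : ℝ) + 1) = Ioi (0 : ℝ) := by
    ext r
    simp only [mem_iUnion, mem_Ioc, mem_Ioi]
    constructor
    · rintro ⟨n, h1, -⟩
      exact lt_trans (by positivity) h1
    · intro hr
      obtain ⟨n, hn⟩ := exists_nat_one_div_lt hr
      obtain ⟨k, hk⟩ := exists_nat_ge r
      refine ⟨max n k, ?_, ?_⟩
      · refine lt_of_le_of_lt ?_ hn
        rw [one_div]
        have : (n : ℝ) ≤ (max n k : ℕ) := Nat.cast_le.2 (le_max_left _ _)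
        gcongr
      · have : (k : ℝ) ≤ (max n k : ℕ) := Nat.cast_le.2 (le_max_right _ _)
        linarith
  rw [← hU, setLIntegral_iUnion_of_directed _ hmono.directed_le]
  exact iSup_le h

lemma antitone_ofReal_psi_distrib (ψ : Psi) (x : unitInterval → ℝ) :
    Antitone fun s => ENNReal.ofReal (ψ (distrib x s)) := fun a b h =>
  ENNReal.ofReal_le_ofReal (ψ.monotoneOn (distrib_mem x b) (distrib_mem x a) (distrib_anti x h))

/-- The Lorentz norm is determined by the pairings with subordinate weights. -/
lemma lorentzENorm_le_of_forall (ψ : Psi) {x : unitInterval → ℝ} (hx : Measurable x) {K : ℝ≥0∞}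
    (h : ∀ w, IsSubordinate ψ w → ∫⁻ u, ENNReal.ofReal |x u| * ENNReal.ofReal (w u) ≤ K) :
    lorentzENorm ψ x ≤ K := by
  rw [lorentzENorm_eq ψ hx.aemeasurable]
  refine lintegral_Ioi_le_of_forall fun N => ?_
  set ε : ℝ := ((N : ℝ) + 1)⁻¹ with hε
  have hN : (0 : ℝ) < (N : ℝ) + 1 := by positivity
  have hε0 : 0 < ε := inv_pos.2 hN
  have hf := antitone_ofReal_psi_distrib ψ x
  -- With mesh 1/(N + 1), this number of cells reaches exactly from 1/(N + 1) to N + 1.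
  set n : ℕ := (N + 1) ^ 2 - 1 with hn
  have hn1 : ((n : ℝ) + 1) * ε = (N : ℝ) + 1 := by
    have : n + 1 = (N + 1) ^ 2 := by
      rw [hn, Nat.sub_add_cancel (Nat.one_le_pow _ _ (Nat.succ_pos _))]
    have h' : (n : ℝ) + 1 = ((N : ℝ) + 1) ^ 2 := by exact_mod_cast this
    rw [h', hε]; field_simp
  rw [← hn1]
  refine (setLIntegral_Ioc_le_sum hf n).trans ?_
  obtain ⟨G, -, hsub, -, hG⟩ := exists_levelWeight ψ hx (s := fun i : ℕ => ((i : ℝ) + 1) * ε)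
    (fun a b hab => by
      have : (a : ℝ) ≤ b := Nat.cast_le.2 hab
      exact mul_le_mul_of_nonneg_right (by linarith) hε0.le) n
  refine le_trans ?_ (h _ hsub)
  refine le_trans (le_of_eq ?_) (hG (fun _ => ε) (fun _ => hε0.le) (fun j => by simp))
  rw [ENNReal.ofReal_sum_of_nonneg fun i _ => mul_nonneg hε0.le (ψ.nonneg (distrib_mem _ _))]
  exact Finset.sum_congr rfl fun i _ => (ENNReal.ofReal_mul hε0.le).symm

/-! ### Triangle inequality and elementary bounds for the norm -/

lemma lorentzENorm_add_le (ψ : Psi) {x y : unitInterval → ℝ} (hx : Measurable x)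
    (hy : Measurable y) :
    lorentzENorm ψ (fun u => x u + y u) ≤ lorentzENorm ψ x + lorentzENorm ψ y := by
  -- The pairing of |x| with a fixed weight is plainly subadditive in x, and by duality the norm is
  -- determined by such pairings.
  refine lorentzENorm_le_of_forall ψ (hx.add hy) fun w hw => ?_
  refine le_trans ?_ (add_le_add (hw.lintegral_mul_le hx) (hw.lintegral_mul_le hy))
  have hm := hw.measurable
  rw [← lintegral_add_left (by fun_prop)]
  refine lintegral_mono fun u => ?_
  rw [← add_mul, ← ENNReal.ofReal_add (abs_nonneg _) (abs_nonneg _)]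
  gcongr
  exact abs_add_le _ _

lemma lorentzENorm_zero (ψ : Psi) : lorentzENorm ψ (fun _ => 0) = 0 := by
  have h := lorentzENorm_smul_le ψ (x := fun _ => 0) aemeasurable_const 0
  simpa using h

lemma lorentzENorm_sum_le (ψ : Psi) {ι : Type*} (s : Finset ι) {x : ι → unitInterval → ℝ}
    (hx : ∀ i ∈ s, Measurable (x i)) :
    lorentzENorm ψ (fun u => ∑ i ∈ s, x i u) ≤ ∑ i ∈ s, lorentzENorm ψ (x i) := by
  classical
  induction s using Finset.induction_on with
  | empty => simp [lorentzENorm_zero]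
  | insert a s ha ih =>
    simp only [Finset.sum_insert ha]
    refine (lorentzENorm_add_le ψ (hx a (Finset.mem_insert_self _ _))
      (Finset.measurable_fun_sum _ fun i hi => hx i (Finset.mem_insert_of_mem hi))).trans ?_
    exact add_le_add le_rfl (ih fun i hi => hx i (Finset.mem_insert_of_mem hi))

lemma lorentzENorm_mono (ψ : Psi) {x y : unitInterval → ℝ} (hx : Measurable x) (hy : Measurable y)
    (h : ∀ s, 0 < s → distrib x s ≤ distrib y s) : lorentzENorm ψ x ≤ lorentzENorm ψ y := by
  rw [lorentzENorm_eq ψ hx.aemeasurable, lorentzENorm_eq ψ hy.aemeasurable]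
  exact setLIntegral_mono' measurableSet_Ioi fun s hs =>
    ENNReal.ofReal_le_ofReal (ψ.monotoneOn (distrib_mem x s) (distrib_mem y s) (h s hs))

/-- A Chebyshev inequality: the layer-cake integrand is at least ψ(t) on (0, s). Only levels r < s
enter, so a lower bound |x| ≥ s on a set suffices. -/
lemma mul_psi_le_lorentzENorm (ψ : Psi) {x : unitInterval → ℝ} (hx : Measurable x) {s t : ℝ}
    (ht : t ∈ Icc (0 : ℝ) 1) (h : ∀ r < s, t ≤ distrib x r) :
    ENNReal.ofReal (s * ψ t) ≤ lorentzENorm ψ x := by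
  rcases le_or_gt s 0 with h0 | h0
  · rw [ENNReal.ofReal_of_nonpos (mul_nonpos_of_nonpos_of_nonneg h0 (ψ.nonneg ht))]
    exact zero_le
  rw [lorentzENorm_eq ψ hx.aemeasurable, ENNReal.ofReal_mul h0.le, mul_comm]
  calc ENNReal.ofReal (ψ t) * ENNReal.ofReal s = ∫⁻ _ in Ioo 0 s, ENNReal.ofReal (ψ t) := by
        rw [setLIntegral_const, Real.volume_Ioo, sub_zero]
    _ ≤ ∫⁻ r in Ioo 0 s, ENNReal.ofReal (ψ (distrib x r)) :=
        setLIntegral_mono' measurableSet_Ioo fun r hr =>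
          ENNReal.ofReal_le_ofReal (ψ.monotoneOn ht (distrib_mem x r) (h r hr.2))
    _ ≤ _ := lintegral_mono_set Ioo_subset_Ioi_self

/-- Three-level upper bound for the norm of a bounded function. -/
lemma lorentzENorm_le_of_bounded (ψ : Psi) {x : unitInterval → ℝ} (hx : Measurable x)
    {s₁ s₀ M : ℝ} (h1 : 0 ≤ s₁) (h0 : 0 ≤ s₀) (hM : 0 ≤ M) (hxM : ∀ᵐ u, |x u| ≤ M) :
    lorentzENorm ψ x ≤ ENNReal.ofReal
      (s₁ * ψ 1 + s₀ * ψ (distrib x s₁) + M * ψ (distrib x s₀)) := by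
  rw [lorentzENorm_eq ψ hx.aemeasurable]
  have hf := antitone_ofReal_psi_distrib ψ x
  have one : (1 : ℝ) ∈ Icc (0 : ℝ) 1 := by simp
  -- The heights split into pieces on which the integrand is at most ψ(1), ψ(distrib x s₁),
  -- ψ(distrib x s₀) and 0. The pieces may overlap, since no order among s₁, s₀ and M is assumed.
  have hcov : Ioi (0 : ℝ) ⊆ (Ioc 0 s₁ ∪ Ioc s₁ (s₁ + s₀)) ∪ (Ioo s₀ M ∪ Ici M) := by
    intro r hr
    rcases le_or_gt r s₁ with h | h
    · exact Or.inl (Or.inl ⟨hr, h⟩)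
    rcases le_or_gt r s₀ with h' | h'
    · exact Or.inl (Or.inr ⟨h, by linarith⟩)
    rcases lt_or_ge r M with h'' | h''
    · exact Or.inr (Or.inl ⟨h', h''⟩)
    · exact Or.inr (Or.inr h'')
  refine (lintegral_mono_set hcov).trans ((lintegral_union_le _ _ _).trans ?_)
  have n1 := ψ.nonneg one
  have n2 := ψ.nonneg (distrib_mem x s₁)
  have n3 := ψ.nonneg (distrib_mem x s₀)
  rw [ENNReal.ofReal_add (by positivity) (by positivity),
    ENNReal.ofReal_add (by positivity) (by positivity)]
  have cst : ∀ (a b c : ℝ), (∀ s ∈ Ioc a b, ψ (distrib x s) ≤ c) →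
      ∫⁻ s in Ioc a b, ENNReal.ofReal (ψ (distrib x s)) ≤
        ENNReal.ofReal (b - a) * ENNReal.ofReal c := by
    intro a b c h
    refine (setLIntegral_mono' measurableSet_Ioc (g := fun _ => ENNReal.ofReal c)
      fun s hs => ENNReal.ofReal_le_ofReal (h s hs)).trans ?_
    rw [setLIntegral_const, Real.volume_Ioc, mul_comm]
  have hm : ∀ {a b}, a ≤ b → ψ (distrib x b) ≤ ψ (distrib x a) := fun {a b} h =>
    ψ.monotoneOn (distrib_mem x b) (distrib_mem x a) (distrib_anti x h)
  refine add_le_add ((lintegral_union_le _ _ _).trans (add_le_add ?_ ?_))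
    ((lintegral_union_le _ _ _).trans ?_)
  · refine (cst 0 s₁ (ψ 1) fun s _ => ψ.monotoneOn (distrib_mem x s) one
      (distrib_le_one x s)).trans ?_
    rw [sub_zero, ENNReal.ofReal_mul h1]
  · refine (cst s₁ (s₁ + s₀) (ψ (distrib x s₁)) fun s hs => hm hs.1.le).trans ?_
    rw [add_sub_cancel_left, ENNReal.ofReal_mul h0]
  · have hz : ∫⁻ s in Ici M, ENNReal.ofReal (ψ (distrib x s)) = 0 := by
      rw [setLIntegral_congr_fun (g := fun _ => 0) measurableSet_Ici, lintegral_zero]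
      intro s hs
      have : distrib x s = 0 := by
        rw [distrib, measureReal_def, measure_mono_null (t := {u | ¬ |x u| ≤ M}) _ hxM,
          ENNReal.toReal_zero]
        intro u hu
        exact not_le.2 (lt_of_le_of_lt hs hu)
      simp [this, ψ.map_zero]
    rw [hz, add_zero]
    refine (lintegral_mono_set Ioo_subset_Ioc_self).trans
      ((cst s₀ M (ψ (distrib x s₀)) fun s hs => hm hs.1.le).trans ?_)
    rw [ENNReal.ofReal_mul hM]
    gcongr
    linarith

lemma lorentzENorm_const_le (ψ : Psi) (c : ℝ) :
    lorentzENorm ψ (fun _ => c) ≤ ENNReal.ofReal (|c| * ψ 1) := by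
  have hd : distrib (fun _ => c) |c| = 0 := by simp [distrib]
  have h := lorentzENorm_le_of_bounded ψ (x := fun _ => c) measurable_const (s₁ := |c|)
    (s₀ := |c|) (abs_nonneg c) (abs_nonneg c) (abs_nonneg c) (ae_of_all _ fun _ => le_rfl)
  simpa [hd, ψ.map_zero] using h

/-! ### The norm of `Λ(ψ)` as a seminorm; weakly null sequences are bounded -/

/-- Uniform boundedness applied on the dual, which is complete even if the space is not: the members
of the sequence act on it as elements of the bidual. -/
lemma seminorm_bounded_of_weakly_null {E : Type*} [AddCommGroup E] [Module ℝ E]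
    (p : Seminorm ℝ E) (x : ℕ → E)
    (h : ∀ φ : E →ₗ[ℝ] ℝ, (∃ C : ℝ, ∀ y, |φ y| ≤ C * p y) →
      Tendsto (fun n => φ (x n)) atTop (𝓝 0)) : ∃ C : ℝ, ∀ n, p (x n) ≤ C := by
  let : SeminormedAddCommGroup E := p.toAddGroupSeminorm.toSeminormedAddCommGroup
  have hnorm : ∀ y : E, ‖y‖ = p y := fun y => rfl
  let : NormedSpace ℝ E := ⟨fun c y => by rw [hnorm, hnorm, map_smul_eq_mul]⟩
  obtain ⟨C, hC⟩ := banach_steinhaus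
    (g := fun n => NormedSpace.inclusionInDoubleDualLi (E := E) ℝ (x n)) (fun f => by
      have ht := h f.toLinearMap ⟨‖f‖, fun y => f.le_opNorm y⟩
      obtain ⟨C, hC⟩ := ht.norm.bddAbove_range
      exact ⟨C, fun n => hC ⟨n, rfl⟩⟩)
  refine ⟨C, fun n => ?_⟩
  have := hC n
  rwa [LinearIsometry.norm_map, hnorm] at this

lemma measurable_coe {ψ : Psi} (x : Lorentz ψ) :
    Measurable ((x : unitInterval →ₘ[volume] ℝ) : unitInterval → ℝ) :=
  (x : unitInterval →ₘ[volume] ℝ).measurable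

lemma ofReal_lorentzNorm {ψ : Psi} (x : Lorentz ψ) :
    ENNReal.ofReal (lorentzNorm ψ x) = lorentzENorm ψ (x : unitInterval →ₘ[volume] ℝ) :=
  ENNReal.ofReal_toReal (ne_of_lt x.2)

lemma lorentzNorm_nonneg {ψ : Psi} (x : Lorentz ψ) : 0 ≤ lorentzNorm ψ x := ENNReal.toReal_nonneg

lemma lorentzNorm_le_iff {ψ : Psi} (x : Lorentz ψ) {C : ℝ} (hC : 0 ≤ C) :
    lorentzNorm ψ x ≤ C ↔
      lorentzENorm ψ (x : unitInterval →ₘ[volume] ℝ) ≤ ENNReal.ofReal C := by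
  rw [← ofReal_lorentzNorm, ENNReal.ofReal_le_ofReal_iff hC]

lemma lorentzNorm_add_le {ψ : Psi} (x y : Lorentz ψ) :
    lorentzNorm ψ (x + y) ≤ lorentzNorm ψ x + lorentzNorm ψ y := by
  rw [lorentzNorm_le_iff _ (add_nonneg (lorentzNorm_nonneg x) (lorentzNorm_nonneg y)),
    ENNReal.ofReal_add (lorentzNorm_nonneg x) (lorentzNorm_nonneg y), ofReal_lorentzNorm,
    ofReal_lorentzNorm, Submodule.coe_add, lorentzENorm_congr ψ (AEEqFun.coeFn_add _ _)]
  exact lorentzENorm_add_le ψ (measurable_coe x) (measurable_coe y)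

lemma lorentzNorm_smul_le {ψ : Psi} (c : ℝ) (x : Lorentz ψ) :
    lorentzNorm ψ (c • x) ≤ |c| * lorentzNorm ψ x := by
  rw [lorentzNorm_le_iff _ (mul_nonneg (abs_nonneg c) (lorentzNorm_nonneg x)),
    ENNReal.ofReal_mul (abs_nonneg c), ofReal_lorentzNorm, Submodule.coe_smul,
    lorentzENorm_congr ψ (AEEqFun.coeFn_smul c _)]
  exact lorentzENorm_smul_le ψ (measurable_coe x).aemeasurable c

lemma lorentzNorm_zero (ψ : Psi) : lorentzNorm ψ 0 = 0 := by
  have h := lorentzNorm_smul_le (ψ := ψ) 0 0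
  rw [smul_zero, abs_zero, zero_mul] at h
  exact le_antisymm h (lorentzNorm_nonneg _)

/-- The norm of `Λ(ψ)`, bundled. -/
noncomputable def lorentzSeminorm (ψ : Psi) : Seminorm ℝ (Lorentz ψ) :=
  Seminorm.ofSMulLE (lorentzNorm ψ) (lorentzNorm_zero ψ) lorentzNorm_add_le
    (fun c x => lorentzNorm_smul_le c x)

lemma lorentzNorm_sum_le {ψ : Psi} {ι : Type*} (s : Finset ι) (x : ι → Lorentz ψ) :
    lorentzNorm ψ (∑ i ∈ s, x i) ≤ ∑ i ∈ s, lorentzNorm ψ (x i) := by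
  classical
  induction s using Finset.induction_on with
  | empty => simp [lorentzNorm_zero]
  | insert a s ha ih =>
    rw [Finset.sum_insert ha, Finset.sum_insert ha]
    exact (lorentzNorm_add_le _ _).trans (add_le_add le_rfl ih)

lemma WeaklyNull.bounded {ψ : Psi} {x : ℕ → Lorentz ψ} (hx : WeaklyNull ψ x) :
    ∃ C : ℝ, ∀ n, lorentzNorm ψ (x n) ≤ C :=
  seminorm_bounded_of_weakly_null (lorentzSeminorm ψ) x hx

/-- The triangle inequality gives linear growth of the sums. Hence the index set differs from {1}
exactly when it contains some p > 1. -/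
lemma one_mem_GammaInd (ψ : Psi) : (1 : ℝ) ∈ GammaInd ψ := by
  refine ⟨le_rfl, fun x hx _ => ⟨id, strictMono_id, ?_⟩⟩
  obtain ⟨C, hC⟩ := hx.bounded
  refine ⟨⟨C, hC⟩, fun σ _ => ⟨C, fun m hm => ?_⟩⟩
  have hm0 : (0 : ℝ) < m := by exact_mod_cast hm
  have h1 : lorentzNorm ψ (∑ k ∈ Finset.range m, (x ∘ id) (σ k)) ≤ m * C := by
    refine (lorentzNorm_sum_le _ _).trans ((Finset.sum_le_sum fun i _ => hC _).trans ?_)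
    simp
  rw [div_one, Real.rpow_neg_one, inv_mul_le_iff₀ hm0]
  exact h1

lemma coe_sum_ae {ψ : Psi} {ι : Type*} (s : Finset ι) (x : ι → Lorentz ψ) :
    (((∑ i ∈ s, x i : Lorentz ψ) : unitInterval →ₘ[volume] ℝ) : unitInterval → ℝ) =ᵐ[volume]
      fun u => ∑ i ∈ s, ((x i : unitInterval →ₘ[volume] ℝ) : unitInterval → ℝ) u := by
  classical
  induction s using Finset.induction_on with
  | empty =>
    simp only [Finset.sum_empty]
    exact AEEqFun.coeFn_zero
  | insert a s ha ih =>
    simp only [Finset.sum_insert ha, Submodule.coe_add]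
    filter_upwards [AEEqFun.coeFn_add (x a : unitInterval →ₘ[volume] ℝ)
      ((∑ i ∈ s, x i : Lorentz ψ) : unitInterval →ₘ[volume] ℝ), ih] with u h1 h2
    rw [h1, Pi.add_apply, h2]

/-- The class in `Λ(ψ)` of a measurable function of finite norm. -/
noncomputable def mkLorentz (ψ : Psi) (f : unitInterval → ℝ) (hf : Measurable f)
    (h : lorentzENorm ψ f < ∞) : Lorentz ψ :=
  ⟨AEEqFun.mk f hf.aestronglyMeasurable, by
    change lorentzENorm ψ _ < ∞
    rwa [lorentzENorm_congr ψ (AEEqFun.coeFn_mk f hf.aestronglyMeasurable)]⟩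

lemma mkLorentz_ae (ψ : Psi) (f : unitInterval → ℝ) (hf : Measurable f)
    (h : lorentzENorm ψ f < ∞) :
    ((mkLorentz ψ f hf h : unitInterval →ₘ[volume] ℝ) : unitInterval → ℝ) =ᵐ[volume] f :=
  AEEqFun.coeFn_mk f hf.aestronglyMeasurable

/-! ### Integrability -/

/-- By concavity ψ(t) ≥ tψ(1). Pairing with this weight embeds the Lorentz space into L¹, so that
means make sense. -/
lemma isSubordinate_const (ψ : Psi) : IsSubordinate ψ fun _ => ψ 1 where
  measurable := measurable_const
  nonneg _ := ψ.nonneg (by simp)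
  bounded := ⟨ψ 1, fun _ => le_rfl⟩
  setIntegral_le B _ := by
    rw [setIntegral_const, smul_eq_mul]
    exact ψ.mul_le (measureReal_mem B)

lemma lintegral_abs_mul_le (ψ : Psi) {x : unitInterval → ℝ} (hx : Measurable x) :
    (∫⁻ u, ENNReal.ofReal |x u|) * ENNReal.ofReal (ψ 1) ≤ lorentzENorm ψ x := by
  rw [← lintegral_mul_const _ (by fun_prop)]
  exact (isSubordinate_const ψ).lintegral_mul_le hx

lemma integrable_of_lorentzENorm_lt_top (ψ : Psi) {x : unitInterval → ℝ} (hx : Measurable x)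
    (h : lorentzENorm ψ x < ∞) : Integrable x := by
  refine ⟨hx.aestronglyMeasurable, ?_⟩
  rw [hasFiniteIntegral_iff_norm]
  simp only [Real.norm_eq_abs]
  have h1 := (lintegral_abs_mul_le ψ hx).trans_lt h
  by_contra! hc
  rw [top_le_iff.1 hc, ENNReal.top_mul] at h1
  · exact absurd h1 (lt_irrefl _)
  · exact (ENNReal.ofReal_pos.2 (ψ.pos one_pos le_rfl)).ne'

lemma integrable_coe {ψ : Psi} (x : Lorentz ψ) :
    Integrable ((x : unitInterval →ₘ[volume] ℝ) : unitInterval → ℝ) :=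
  integrable_of_lorentzENorm_lt_top ψ (measurable_coe x) x.2

lemma abs_integral_mul_le (ψ : Psi) {x : unitInterval → ℝ} (hx : Measurable x)
    (h : lorentzENorm ψ x < ∞) : |∫ u, x u| * ψ 1 ≤ (lorentzENorm ψ x).toReal := by
  have h1 := lintegral_abs_mul_le ψ hx
  have hi := integrable_of_lorentzENorm_lt_top ψ hx h
  rw [← ofReal_integral_eq_lintegral_ofReal hi.abs (ae_of_all _ fun _ => abs_nonneg _),
    ← ENNReal.ofReal_mul (integral_nonneg fun _ => abs_nonneg _)] at h1
  refine le_trans ?_ ((ENNReal.ofReal_le_iff_le_toReal h.ne).1 h1)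
  exact mul_le_mul_of_nonneg_right (abs_integral_le_integral_abs) (ψ.nonneg (by simp))

lemma WeaklyNull.tendsto_integral {ψ : Psi} {x : ℕ → Lorentz ψ} (hx : WeaklyNull ψ x) :
    Tendsto (fun n => ∫ u, ((x n : unitInterval →ₘ[volume] ℝ) : unitInterval → ℝ) u) atTop (𝓝 0) := by
  let φ : Lorentz ψ →ₗ[ℝ] ℝ :=
    { toFun := fun y => ∫ u, ((y : unitInterval →ₘ[volume] ℝ) : unitInterval → ℝ) u
      map_add' := fun y z => by
        rw [Submodule.coe_add, integral_congr_ae (AEEqFun.coeFn_add _ _)]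
        exact integral_add (integrable_coe y) (integrable_coe z)
      map_smul' := fun c y => by
        rw [Submodule.coe_smul, integral_congr_ae (AEEqFun.coeFn_smul _ _)]
        exact integral_const_mul c _ }
  refine hx φ ⟨(ψ 1)⁻¹, fun y => ?_⟩
  rw [← div_eq_inv_mul, le_div_iff₀ (ψ.pos one_pos le_rfl)]
  exact abs_integral_mul_le ψ (measurable_coe y) y.2

/-! ### Power estimates from the two `limsup` conditions -/

/-- Besides the range of u, this supplies the two-sided bounds on the quotient without which a real
`limsup` says nothing. -/
lemma Psi.div_mul_le (ψ : Psi) {k : ℕ} (hk : 1 ≤ k) :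
    ∀ᶠ u : ℝ in 𝓝[>] 0, 0 < u ∧ k * u ≤ 1 ∧ 0 ≤ ψ (k * u) / ψ u ∧ ψ (k * u) / ψ u ≤ k := by
  have hk0 : (0 : ℝ) < k := by exact_mod_cast hk
  have hk1 : (1 : ℝ) ≤ k := by exact_mod_cast hk
  filter_upwards [Ioo_mem_nhdsGT (show (0 : ℝ) < (k : ℝ)⁻¹ by positivity)] with u hu
  have h1 : k * u ≤ 1 := by
    have := mul_le_mul_of_nonneg_left hu.2.le hk0.le
    rwa [mul_inv_cancel₀ hk0.ne'] at this
  have hu0 : 0 < u := hu.1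
  have hku : u ≤ k * u := le_mul_of_one_le_left hu0.le hk1
  have hm : k * u ∈ Icc (0 : ℝ) 1 := ⟨by positivity, h1⟩
  have hp := ψ.pos hu0 (hku.trans h1)
  refine ⟨hu0, h1, div_nonneg (ψ.nonneg hm) hp.le, ?_⟩
  rw [div_le_iff₀ hp]
  exact ψ.le_mul ⟨hu0.le, hku.trans h1⟩ hm hk1 le_rfl

lemma Psi.div_pow_le (ψ : Psi) {l : ℕ} (hl : 1 ≤ l) :
    ∀ᶠ u : ℝ in 𝓝[>] 0, 0 < u ∧ u ≤ 1 ∧ 0 ≤ ψ (u ^ l) / ψ u ∧ ψ (u ^ l) / ψ u ≤ 1 := by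
  filter_upwards [Ioo_mem_nhdsGT (show (0 : ℝ) < 1 by norm_num)] with u hu
  have hp := ψ.pos hu.1 hu.2.le
  have hpow : u ^ l ≤ u := by
    simpa using pow_le_pow_of_le_one hu.1.le hu.2.le hl
  have hm : u ^ l ∈ Icc (0 : ℝ) 1 := ⟨pow_nonneg hu.1.le _, hpow.trans hu.2.le⟩
  refine ⟨hu.1, hu.2.le, div_nonneg (ψ.nonneg hm) hp.le, ?_⟩
  rw [div_le_one hp]
  exact ψ.mono hm.1 hu.2.le hpow

/-- Iterating ψ(ku) ≤ qψ(u) with q < k along u, ku, k²u, … gives a power law with exponent log q /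
log k < 1. -/
lemma Psi.exists_upper_index (ψ : Psi) {k : ℕ} (hk : 2 ≤ k)
    (h : limsup (fun u : ℝ => ψ (k * u) / ψ u) (𝓝[>] 0) < k) :
    ∃ α A : ℝ, 1 / 2 ≤ α ∧ α < 1 ∧ 1 ≤ A ∧
      ∀ u t : ℝ, 0 < u → u ≤ t → t ≤ 1 → ψ t ≤ A * (t / u) ^ α * ψ u := by
  obtain ⟨q, hq1, hq2⟩ := exists_between h
  have hk0 : (0 : ℝ) < k := by positivity
  have hk1 : (1 : ℝ) < k := by exact_mod_cast hk
  have hb : IsBoundedUnder (· ≤ ·) (𝓝[>] (0 : ℝ)) fun u : ℝ => ψ (k * u) / ψ u :=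
    ⟨k, eventually_map.2 ((ψ.div_mul_le (by lia)).mono fun u hu => hu.2.2.2)⟩
  obtain ⟨u₀, hu₀, hev⟩ := mem_nhdsGT_iff_exists_Ioo_subset.1
    ((eventually_lt_of_limsup_lt hq1 hb).and (ψ.div_mul_le (k := k) (by lia)))
  have hu₀' : (0 : ℝ) < u₀ := hu₀
  -- The exponent is raised to at least 1/2 so that it also absorbs square roots coming from
  -- standard deviations; max q 1 keeps the logarithm non-negative.
  set α : ℝ := max (1 / 2) (Real.log (max q 1) / Real.log k) with hα
  have hlogk : 0 < Real.log k := Real.log_pos hk1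
  have hα1 : α < 1 := by
    refine max_lt (by norm_num) ((div_lt_one hlogk).2 ?_)
    exact Real.log_lt_log (by positivity) (max_lt hq2 hk1)
  have hα0 : 1 / 2 ≤ α := le_max_left _ _
  have hqα : q ≤ (k : ℝ) ^ α := by
    refine (le_max_left q 1).trans ?_
    rw [← Real.log_le_log_iff (by positivity) (by positivity), Real.log_rpow hk0,
      ← div_le_iff₀ hlogk]
    exact le_max_right _ _
  -- For u ≥ u₀ the recursion is unavailable, but t ≤ 1 ≤ u₀⁻¹u and concavity end the iteration at
  -- the cost of one factor `C`.
  set C : ℝ := max 1 u₀⁻¹ with hC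
  have hC1 : 1 ≤ C := le_max_left _ _
  set Q : ℝ := (k : ℝ) ^ α with hQ
  have hQ1 : 1 ≤ Q := Real.one_le_rpow hk1.le (by linarith)
  have step : ∀ n : ℕ, ∀ u t : ℝ, 0 < u → u ≤ 1 → 0 ≤ t → t ≤ 1 → t ≤ (k : ℝ) ^ n * u →
      ψ t ≤ C * Q ^ n * ψ u := by
    intro n
    induction n with
    | zero =>
      intro u t hu hu1 ht0 ht htn
      rw [pow_zero, one_mul] at htn
      rw [pow_zero, mul_one]
      have := ψ.mono ht0 hu1 htn
      exact this.trans (le_mul_of_one_le_left (ψ.pos hu hu1).le hC1)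
    | succ n ih =>
      intro u t hu hu1 ht0 ht htn
      have hp := ψ.pos hu hu1
      rcases lt_or_ge u u₀ with hlt | hge
      · have hh := hev ⟨hu, hlt⟩
        have h1 := ih (k * u) t (by positivity) hh.2.2.1 ht0 ht (by
          rw [← mul_assoc, ← pow_succ]; exact htn)
        have h2 : ψ (k * u) ≤ Q * ψ u := by
          have := (div_lt_iff₀ hp).1 hh.1
          exact this.le.trans (mul_le_mul_of_nonneg_right hqα hp.le)
        calc ψ t ≤ C * Q ^ n * ψ (k * u) := h1
          _ ≤ C * Q ^ n * (Q * ψ u) := by gcongr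
          _ = C * Q ^ (n + 1) * ψ u := by ring
      · have h1 : ψ t ≤ C * ψ u := ψ.le_mul ⟨hu.le, hu1⟩ ⟨ht0, ht⟩ hC1 (by
          refine ht.trans ?_
          have : u₀⁻¹ * u₀ ≤ C * u := mul_le_mul (le_max_right _ _) hge hu₀'.le (by positivity)
          rwa [inv_mul_cancel₀ hu₀'.ne'] at this)
        refine h1.trans (mul_le_mul_of_nonneg_right ?_ hp.le)
        exact le_mul_of_one_le_right (by positivity) (one_le_pow₀ hQ1)
  refine ⟨α, C * Q, hα0, hα1, by nlinarith, fun u t hu hut ht => ?_⟩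
  have hp := ψ.pos hu (hut.trans ht)
  obtain ⟨n, hn1, hn2⟩ := exists_nat_pow_near ((one_le_div hu).2 hut) hk1
  have h1 := step (n + 1) u t hu (hut.trans ht) (hu.le.trans hut) ht
    ((div_le_iff₀ hu).1 hn2.le)
  refine h1.trans (mul_le_mul_of_nonneg_right ?_ hp.le)
  have h2 : Q ^ n ≤ (t / u) ^ α := by
    rw [hQ, ← Real.rpow_natCast, ← Real.rpow_mul hk0.le, mul_comm, Real.rpow_mul hk0.le,
      Real.rpow_natCast]
    exact Real.rpow_le_rpow (by positivity) hn1 (by linarith)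
  calc C * Q ^ (n + 1) = C * Q * Q ^ n := by ring
    _ ≤ C * Q * (t / u) ^ α := by gcongr

/-- Iterating ψ(u^l) ≤ qψ(u) along u, u^l, u^(l²), … yields decay of order r^(-δ) with l^(-δ) = q.
The bound u ≤ 1/2 keeps u away from 1, the fixed point of the powers. -/
lemma Psi.exists_log_index (ψ : Psi) {l : ℕ} (hl : 2 ≤ l)
    (h : limsup (fun u : ℝ => ψ (u ^ l) / ψ u) (𝓝[>] 0) < 1) :
    ∃ δ A : ℝ, 0 < δ ∧ 1 ≤ A ∧
      ∀ u r : ℝ, 0 < u → u ≤ 1 / 2 → 1 ≤ r → ψ (u ^ r) ≤ A * r ^ (-δ) * ψ u := by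
  -- Taking q above 1/2 keeps it positive, so that log q may be used.
  obtain ⟨q, hq1, hq2⟩ := exists_between (max_lt h (show (1 / 2 : ℝ) < 1 by norm_num))
  have hq0 : 0 < q := lt_trans (by norm_num) ((le_max_right _ _).trans_lt hq1)
  have hl1 : (1 : ℝ) < l := by exact_mod_cast hl
  have hl0 : (0 : ℝ) < l := by positivity
  have hb : IsBoundedUnder (· ≤ ·) (𝓝[>] (0 : ℝ)) fun u : ℝ => ψ (u ^ l) / ψ u :=
    ⟨1, eventually_map.2 ((ψ.div_pow_le (by lia)).mono fun u hu => hu.2.2.2)⟩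
  obtain ⟨u₀, hu₀, hev⟩ := mem_nhdsGT_iff_exists_Ioo_subset.1
    ((eventually_lt_of_limsup_lt ((le_max_left _ _).trans_lt hq1) hb).and
      (ψ.div_pow_le (l := l) (by lia)))
  have hu₀' : (0 : ℝ) < u₀ := hu₀
  have hlogl : 0 < Real.log l := Real.log_pos hl1
  set δ : ℝ := - Real.log q / Real.log l with hδ
  have hδ0 : 0 < δ := div_pos (neg_pos.2 (Real.log_neg hq0 hq2)) hlogl
  have hqδ : q = (l : ℝ) ^ (-δ) := by
    rw [Real.rpow_def_of_pos hl0, hδ, ← Real.exp_log hq0]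
    congr 1
    rw [Real.log_exp]
    field_simp
  have step : ∀ n : ℕ, ∀ u : ℝ, 0 < u → u < u₀ → u ≤ 1 → ψ (u ^ (l ^ n)) ≤ q ^ n * ψ u := by
    intro n
    induction n with
    | zero => intro u _ _ _; simp
    | succ n ih =>
      intro u hu hu' hu1
      have hp := ψ.pos hu hu1
      have hh := hev ⟨hu, hu'⟩
      have hle : u ^ l ≤ u := by simpa using pow_le_pow_of_le_one hu.le hu1 (show 1 ≤ l by lia)
      have h1 := ih (u ^ l) (by positivity) (hle.trans_lt hu') (hle.trans hu1)
      rw [← pow_mul, ← pow_succ'] at h1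
      have h2 : ψ (u ^ l) ≤ q * ψ u := ((div_lt_iff₀ hp).1 hh.1).le
      calc ψ (u ^ l ^ (n + 1)) ≤ q ^ n * ψ (u ^ l) := h1
        _ ≤ q ^ n * (q * ψ u) := by gcongr
        _ = q ^ (n + 1) * ψ u := by ring
  -- After n₀ powers every u ≤ 1/2 has dropped below u₀, where the recursion holds; the unused first
  -- n₀ steps cost the constant q^(-n₀).
  obtain ⟨n₀, hn₀⟩ := exists_pow_lt_of_lt_one hu₀' (show (1 / 2 : ℝ) < 1 by norm_num)
  have hn₀l : (1 / 2 : ℝ) ^ (l ^ n₀) < u₀ :=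
    (pow_le_pow_of_le_one (by norm_num) (by norm_num) (Nat.lt_pow_self (by lia)).le).trans_lt hn₀
  have step2 : ∀ n : ℕ, ∀ u : ℝ, 0 < u → u ≤ 1 / 2 →
      ψ (u ^ (l ^ n)) ≤ (q ^ n₀)⁻¹ * q ^ n * ψ u := by
    intro n u hu hu'
    have hu1 : u ≤ 1 := by linarith
    have hp := ψ.pos hu hu1
    have hdec : ∀ j : ℕ, u ^ (l ^ j) ≤ u := fun j => by
      simpa using pow_le_pow_of_le_one hu.le hu1 (Nat.one_le_pow j l (by lia))
    rcases le_or_gt n₀ n with hn | hn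
    · obtain ⟨j, rfl⟩ := Nat.exists_eq_add_of_le hn
      have h1 := step j (u ^ (l ^ n₀)) (by positivity)
        ((pow_le_pow_left₀ hu.le hu' _).trans_lt hn₀l) ((hdec n₀).trans hu1)
      rw [← pow_mul, ← pow_add] at h1
      refine h1.trans ?_
      have : (q ^ n₀)⁻¹ * q ^ (n₀ + j) = q ^ j := by
        rw [pow_add]; field_simp
      rw [this]
      have := ψ.mono (a := u ^ (l ^ n₀)) (by positivity) hu1 (hdec n₀)
      gcongr
    · refine (ψ.mono (by positivity) hu1 (hdec n)).trans (le_mul_of_one_le_left hp.le ?_)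
      rw [← div_eq_inv_mul, one_le_div (by positivity)]
      exact pow_le_pow_of_le_one hq0.le hq2.le hn.le
  refine ⟨δ, (q ^ n₀)⁻¹ * q⁻¹, hδ0, ?_, fun u r hu hu' hr => ?_⟩
  · have h1 : 1 ≤ (q ^ n₀)⁻¹ := (one_le_inv₀ (by positivity)).2 (pow_le_one₀ hq0.le hq2.le)
    have h2 : 1 ≤ q⁻¹ := (one_le_inv₀ hq0).2 hq2.le
    nlinarith
  · have hu1 : u ≤ 1 := by linarith
    have hp := ψ.pos hu hu1
    obtain ⟨n, hn1, hn2⟩ := exists_nat_pow_near hr hl1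
    have h1 : ψ (u ^ r) ≤ ψ (u ^ (l ^ n)) := by
      have e : u ^ (l ^ n) = u ^ ((l : ℝ) ^ n) := by
        rw [← Real.rpow_natCast]; push_cast; rfl
      rw [e]
      exact ψ.mono (Real.rpow_nonneg hu.le _) (Real.rpow_le_one hu.le hu1 (by positivity))
        (Real.rpow_le_rpow_of_exponent_ge hu hu1 hn1)
    refine (h1.trans (step2 n u hu hu')).trans (mul_le_mul_of_nonneg_right ?_ hp.le)
    have h3 : q ^ (n + 1) ≤ r ^ (-δ) := by
      rw [hqδ, ← Real.rpow_natCast, ← Real.rpow_mul hl0.le, mul_comm, Real.rpow_mul hl0.le,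
        Real.rpow_natCast]
      exact Real.rpow_le_rpow_of_nonpos (by linarith) hn2.le (by linarith)
    calc (q ^ n₀)⁻¹ * q ^ n = (q ^ n₀)⁻¹ * q⁻¹ * q ^ (n + 1) := by
          rw [pow_succ]; field_simp
      _ ≤ _ := by gcongr

/-! ### Exponential tail estimates -/

lemma distrib_le_of_imp {x : unitInterval → ℝ} {s : ℝ} {B : Set unitInterval}
    (h : ∀ u, s < |x u| → u ∈ B) : distrib x s ≤ (volume : Measure unitInterval).real B :=
  measureReal_mono fun _ hu => h _ hu

section Chernoff

variable {w : ℕ → unitInterval → ℝ} {v : ℝ}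

lemma integrable_of_abs_le {f : unitInterval → ℝ} (hf : Measurable f) {c : ℝ}
    (h : ∀ a, |f a| ≤ c) : Integrable f :=
  Integrable.of_bound hf.aestronglyMeasurable c (ae_of_all _ h)

lemma abs_integral_le_measureReal {f : unitInterval → ℝ} (hf : Measurable f) (h1 : ∀ a, |f a| ≤ 1) :
    |∫ a, f a| ≤ (volume : Measure unitInterval).real {a | f a ≠ 0} := by
  have hs : MeasurableSet {a | f a ≠ 0} := (hf (measurableSet_singleton 0)).compl
  rw [← integral_indicator_one hs]
  refine abs_integral_le_integral_abs.trans (integral_mono (integrable_of_abs_le hf h1).abs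
    ((integrable_const 1).indicator hs) fun a => ?_)
  by_cases ha : f a = 0
  · simp [ha]
  · simpa [ha] using h1 a

/-- Uses e^y ≤ 1 + y + y² for |y| ≤ 1, which applies since |f - ∫f| ≤ 2 and t ≤ 1/2. The linear term
integrates to 0 and the quadratic one to at most t²v, because f² is at most the indicator of the
support. -/
lemma mgf_centered_le {f : unitInterval → ℝ} (hf : Measurable f) (h1 : ∀ a, |f a| ≤ 1)
    (hv : (volume : Measure unitInterval).real {a | f a ≠ 0} ≤ v) {t : ℝ} (ht0 : 0 ≤ t)
    (ht : t ≤ 1 / 2) :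
    mgf (fun a => f a - ∫ b, f b) volume t ≤ Real.exp (t ^ 2 * v) := by
  set c := ∫ b, f b with hc
  have hfi := integrable_of_abs_le hf h1
  have hc1 : |c| ≤ 1 := (abs_integral_le_measureReal hf h1).trans measureReal_le_one
  have hy2 : ∀ a, |f a - c| ≤ 2 := fun a => by
    have := abs_sub (f a) c
    linarith [h1 a]
  have hs : MeasurableSet {a | f a ≠ 0} := (hf (measurableSet_singleton 0)).compl
  have hf2 : Integrable fun a => f a ^ 2 :=
    integrable_of_abs_le (c := 1) (by fun_prop) fun a => by
      rw [abs_pow]; exact pow_le_one₀ (abs_nonneg _) (h1 a)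
  have hsq : ∫ a, f a ^ 2 ≤ v := by
    refine le_trans ?_ hv
    rw [← integral_indicator_one hs]
    refine integral_mono hf2 ((integrable_const 1).indicator hs) fun a => ?_
    by_cases ha : f a = 0
    · simp [ha]
    · have := pow_le_one₀ (n := 2) (abs_nonneg _) (h1 a)
      simpa [ha, sq_abs] using this
  have hpt : ∀ a, Real.exp (t * (f a - c)) ≤ 1 + t * (f a - c) + t ^ 2 * (f a - c) ^ 2 := by
    intro a
    have hle : |t * (f a - c)| ≤ 1 := by
      rw [abs_mul, abs_of_nonneg ht0]
      nlinarith [hy2 a, abs_nonneg (f a - c)]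
    have := (abs_le.1 (Real.abs_exp_sub_one_sub_id_le hle)).2
    rw [← mul_pow]
    linarith
  have hrhs : Integrable fun a => 1 + t * (f a - c) + t ^ 2 * (f a - c) ^ 2 := by
    have : (fun a => 1 + t * (f a - c) + t ^ 2 * (f a - c) ^ 2) =
        fun a => (1 - t * c + t ^ 2 * c ^ 2) + (t - 2 * t ^ 2 * c) * f a + t ^ 2 * f a ^ 2 := by
      funext a; ring
    rw [this]
    exact ((integrable_const _).add (hfi.const_mul _)).add (hf2.const_mul _)
  have hval : ∫ a, (1 + t * (f a - c) + t ^ 2 * (f a - c) ^ 2)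
      = 1 + t ^ 2 * ((∫ a, f a ^ 2) - c ^ 2) := by
    have : (fun a => 1 + t * (f a - c) + t ^ 2 * (f a - c) ^ 2) =
        fun a => (1 - t * c + t ^ 2 * c ^ 2) + (t - 2 * t ^ 2 * c) * f a + t ^ 2 * f a ^ 2 := by
      funext a; ring
    have i1 : Integrable fun a => (1 - t * c + t ^ 2 * c ^ 2) + (t - 2 * t ^ 2 * c) * f a :=
      (integrable_const _).add (hfi.const_mul _)
    rw [this, integral_add i1 (hf2.const_mul _),
      integral_add (integrable_const _) (hfi.const_mul _), integral_const_mul, integral_const_mul,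
      ← hc]
    simp
    ring
  calc mgf (fun a => f a - c) volume t
      ≤ ∫ a, (1 + t * (f a - c) + t ^ 2 * (f a - c) ^ 2) :=
        integral_mono_of_nonneg (ae_of_all _ fun a => (Real.exp_pos _).le) hrhs
          (ae_of_all _ hpt)
    _ = 1 + t ^ 2 * ((∫ a, f a ^ 2) - c ^ 2) := hval
    _ ≤ 1 + t ^ 2 * v := by
        have := sq_nonneg c
        have h2 := sq_nonneg t
        have : t ^ 2 * ((∫ a, f a ^ 2) - c ^ 2) ≤ t ^ 2 * v :=
          mul_le_mul_of_nonneg_left (by linarith) h2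
        linarith
    _ ≤ Real.exp (t ^ 2 * v) := by
        have := Real.add_one_le_exp (t ^ 2 * v)
        linarith

/-- Chernoff: Markov's inequality for e^(tS), whose mean factorises by independence. -/
lemma measure_sum_ge_le_of_mgf {y : ℕ → unitInterval → ℝ} (hy : ∀ i, Measurable (y i))
    (hind : iIndepFun y volume) {c b : ℝ} (hc : ∀ i a, |y i a| ≤ c) (m : ℕ) {t : ℝ}
    (ht0 : 0 ≤ t) (hb : ∀ i < m, mgf (y i) volume t ≤ Real.exp b) (s : ℝ) :
    (volume : Measure unitInterval).real {a | s ≤ ∑ i ∈ Finset.range m, y i a}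
      ≤ Real.exp (-t * s + m * b) := by
  have hS : ∀ a, ∑ i ∈ Finset.range m, y i a = (∑ i ∈ Finset.range m, y i) a := fun a => by simp
  have hbd : ∀ a, |(∑ i ∈ Finset.range m, y i) a| ≤ m * c := fun a => by
    rw [← hS]
    refine (Finset.abs_sum_le_sum_abs _ _).trans ((Finset.sum_le_sum fun i _ => hc i a).trans ?_)
    simp
  have hSm : Measurable (∑ i ∈ Finset.range m, y i) := by
    have := Finset.measurable_fun_sum (Finset.range m) fun i _ => hy i
    exact (funext fun a => hS a) ▸ this
  have hint : Integrable (fun a => Real.exp (t * (∑ i ∈ Finset.range m, y i) a))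
      (volume : Measure unitInterval) := by
    refine integrable_of_abs_le (c := Real.exp (t * (m * c)))
      (Real.measurable_exp.comp (hSm.const_mul t)) fun a => ?_
    rw [abs_of_pos (Real.exp_pos _)]
    exact Real.exp_le_exp.2 (mul_le_mul_of_nonneg_left ((le_abs_self _).trans (hbd a)) ht0)
  have h := measure_ge_le_exp_mul_mgf (μ := (volume : Measure unitInterval)) s ht0 hint
  rw [hind.mgf_sum hy] at h
  simp only [hS]
  refine h.trans ?_
  rw [Real.exp_add]
  refine mul_le_mul_of_nonneg_left ?_ (Real.exp_pos _).le
  rw [Real.exp_nat_mul]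
  calc ∏ i ∈ Finset.range m, mgf (y i) volume t ≤ ∏ _i ∈ Finset.range m, Real.exp b :=
        Finset.prod_le_prod (fun i _ => mgf_nonneg) fun i hi => hb i (Finset.mem_range.1 hi)
    _ = Real.exp b ^ m := by simp

lemma abs_centered_le {f : unitInterval → ℝ} (hf : Measurable f) (h1 : ∀ a, |f a| ≤ 1) (a) :
    |f a - ∫ b, f b| ≤ 2 := by
  have := (abs_integral_le_measureReal hf h1).trans measureReal_le_one
  have := abs_sub (f a) (∫ b, f b)
  linarith [h1 a]

lemma distrib_sum_centered_le (hw : ∀ i, Measurable (w i)) (hind : iIndepFun w volume)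
    (h1 : ∀ i a, |w i a| ≤ 1) {m : ℕ}
    (hv : ∀ i < m, (volume : Measure unitInterval).real {a | w i a ≠ 0} ≤ v) {t : ℝ} (ht0 : 0 ≤ t)
    (ht : t ≤ 1 / 2) (s : ℝ) :
    distrib (fun a => ∑ i ∈ Finset.range m, (w i a - ∫ b, w i b)) s ≤
      2 * Real.exp (-t * s + m * (t ^ 2 * v)) := by
  have e1 := measure_sum_ge_le_of_mgf (y := fun i a => w i a - ∫ b, w i b)
    (fun i => (hw i).sub_const _)
    (hind.comp (fun i r => r - ∫ b, w i b) fun i => measurable_id.sub_const _)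
    (c := 2) (fun i a => abs_centered_le (hw i) (h1 i) a) m ht0
    (fun i hi => mgf_centered_le (hw i) (h1 i) (hv i hi) ht0 ht) s
  have e2 := measure_sum_ge_le_of_mgf (y := fun i a => (- w i a) - ∫ b, - w i b)
    (fun i => (hw i).neg.sub_const _)
    (hind.comp (fun i r => (-r) - ∫ b, - w i b) fun i => measurable_id.neg.sub_const _)
    (c := 2) (fun i a => abs_centered_le (hw i).neg (fun a => by
      simpa [Pi.neg_apply, abs_neg] using h1 i a) a) m ht0
    (fun i hi => mgf_centered_le (hw i).neg (fun a => by
      simpa [Pi.neg_apply, abs_neg] using h1 i a) (by simpa using hv i hi) ht0 ht) s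
  refine (distrib_le_of_imp (B := {a | s ≤ ∑ i ∈ Finset.range m, (w i a - ∫ b, w i b)} ∪
    {a | s ≤ ∑ i ∈ Finset.range m, ((- w i a) - ∫ b, - w i b)}) fun a ha => ?_).trans
    ((measureReal_union_le _ _).trans ?_)
  · rcases lt_abs.1 ha with h | h
    · exact Or.inl h.le
    · refine Or.inr ?_
      change s ≤ _
      refine h.le.trans (le_of_eq ?_)
      rw [← Finset.sum_neg_distrib]
      exact Finset.sum_congr rfl fun i _ => by rw [integral_neg]; ring
  · rw [two_mul]; exact add_le_add e1 e2

lemma mgf_indicator_le {f : unitInterval → ℝ} (hf : Measurable f)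
    (hv : (volume : Measure unitInterval).real {a | f a ≠ 0} ≤ v) {t : ℝ} :
    mgf (fun a => if f a = 0 then 0 else 1) volume t ≤ Real.exp (Real.exp t * v) := by
  have hs : MeasurableSet {a | f a ≠ 0} := (hf (measurableSet_singleton 0)).compl
  have : mgf (fun a => if f a = 0 then (0 : ℝ) else 1) volume t ≤
      ∫ a, (1 + {a | f a ≠ 0}.indicator (fun _ => Real.exp t) a) := by
    refine integral_mono_of_nonneg (ae_of_all _ fun a => (Real.exp_pos _).le)
      ((integrable_const _).add ((integrable_const _).indicator hs)) (ae_of_all _ fun a => ?_)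
    by_cases ha : f a = 0
    · simp [ha]
    · simp [ha]
  refine this.trans ?_
  rw [integral_add (integrable_const _) ((integrable_const _).indicator hs),
    integral_indicator_const _ hs]
  simp only [integral_const, probReal_univ, smul_eq_mul, one_mul]
  have h2 := Real.add_one_le_exp (Real.exp t * v)
  have h3 := mul_le_mul_of_nonneg_right hv (Real.exp_pos t).le
  linarith

/-- A Poisson-type tail for the number of non-zero summands. Unlike the variance bound, it allows
every t ≥ 0, which is what rare events need. -/
lemma measure_count_ge_le (hw : ∀ i, Measurable (w i)) (hind : iIndepFun w volume) {m : ℕ}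
    (hv : ∀ i < m, (volume : Measure unitInterval).real {a | w i a ≠ 0} ≤ v) {t : ℝ} (ht0 : 0 ≤ t)
    (s : ℝ) :
    (volume : Measure unitInterval).real
      {a | s ≤ ∑ i ∈ Finset.range m, if w i a = 0 then (0 : ℝ) else 1} ≤
      Real.exp (-t * s + m * (Real.exp t * v)) := by
  have hm : Measurable fun r : ℝ => if r = 0 then (0 : ℝ) else 1 :=
    Measurable.ite (measurableSet_singleton 0) measurable_const measurable_const
  exact measure_sum_ge_le_of_mgf (y := fun i a => if w i a = 0 then (0 : ℝ) else 1)
    (fun i => hm.comp (hw i)) (hind.comp (fun _ r => if r = 0 then (0 : ℝ) else 1) fun _ => hm)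
    (c := 1) (fun i a => by split_ifs <;> simp) m ht0
    (fun i hi => mgf_indicator_le (hw i) (hv i hi)) s

end Chernoff

/-! ### Sums of bounded independent variables with small supports -/

lemma abs_sum_centered_le {w : ℕ → unitInterval → ℝ} (hw : ∀ i, Measurable (w i))
    (h1 : ∀ i a, |w i a| ≤ 1) (m : ℕ) (a) :
    |∑ i ∈ Finset.range m, (w i a - ∫ b, w i b)| ≤ 2 * m := by
  refine (Finset.abs_sum_le_sum_abs _ _).trans ((Finset.sum_le_sum fun i _ =>
    abs_centered_le (hw i) (h1 i) a).trans (le_of_eq ?_))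
  simp [mul_comm]

lemma measurable_sum_centered {w : ℕ → unitInterval → ℝ} (hw : ∀ i, Measurable (w i)) (m : ℕ) :
    Measurable fun a => ∑ i ∈ Finset.range m, (w i a - ∫ b, w i b) :=
  Finset.measurable_fun_sum _ fun i _ => (hw i).sub_const _

/-- The regime where v is not much smaller than 1/m. Up to a level s₀ slightly above the standard
deviation, the bound s₀ψ(1) and the power law suffice. Beyond s₀ the tail exp(-K m^θ) is at most a
power u^r with r = m^(θ/2), and the logarithmic index gains m^(-δθ/2) over the trivial bound 2m. -/
lemma lorentzENorm_sum_le_of_large (ψ : Psi) {α δ A θ : ℝ} (hα0 : 1 / 2 ≤ α) (hα1 : α < 1)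
    (hA : 1 ≤ A) (hθ : 0 < θ) (hθ1 : θ ≤ 1)
    (hup : ∀ u t : ℝ, 0 < u → u ≤ t → t ≤ 1 → ψ t ≤ A * (t / u) ^ α * ψ u)
    (hlog : ∀ u r : ℝ, 0 < u → u ≤ 1 / 2 → 1 ≤ r → ψ (u ^ r) ≤ A * r ^ (-δ) * ψ u)
    {w : ℕ → unitInterval → ℝ} (hw : ∀ i, Measurable (w i)) (hind : iIndepFun w volume)
    (h1 : ∀ i a, |w i a| ≤ 1) {m : ℕ} (hm : 1 ≤ m) {v : ℝ} (hv0 : 0 < v) (hv1 : v ≤ 1)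
    (hv : ∀ i < m, (volume : Measure unitInterval).real {a | w i a ≠ 0} ≤ v)
    (hlarge : 1 / 2 * (m : ℝ) ^ (-(1 + θ)) ≤ v) :
    lorentzENorm ψ (fun a => ∑ i ∈ Finset.range m, (w i a - ∫ b, w i b)) ≤
      ENNReal.ofReal ((8 * (1 + 4 / θ) * A * (m : ℝ) ^ (θ + α * (1 + θ)) +
        12 * A * (m : ℝ) ^ (1 - θ / 2 * δ)) * ψ v) := by
  set x : ℝ := (m : ℝ) with hx
  have hx1 : 1 ≤ x := by rw [hx]; exact_mod_cast hm
  have hx0 : 0 < x := by linarith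
  -- Tuned to give -log u ≤ K r below: 4/θ comes from log x ≤ (2/θ)x^(θ/2) and 1 + θ ≤ 2, and the 1
  -- covers log 2.
  set K : ℝ := 1 + 4 / θ with hK
  have hK1 : 1 ≤ K := by rw [hK]; have : 0 < 4 / θ := by positivity
                         linarith
  set V : ℝ := max (x * v) 1 with hV
  have hV1 : 1 ≤ V := le_max_right _ _
  set R : ℝ := √V with hR
  have hR1 : 1 ≤ R := Real.one_le_sqrt.2 hV1
  have hRR : R * R = V := Real.mul_self_sqrt (by linarith)
  set s₀ : ℝ := 2 * K * x ^ θ * R with hs₀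
  have hxθ : 1 ≤ x ^ θ := Real.one_le_rpow hx1 hθ.le
  have hs₀0 : 0 ≤ s₀ := by positivity
  set S : unitInterval → ℝ := fun a => ∑ i ∈ Finset.range m, (w i a - ∫ b, w i b) with hS
  have hSm : Measurable S := measurable_sum_centered hw m
  have one : (1 : ℝ) ∈ Icc (0 : ℝ) 1 := by simp
  have hpv := ψ.pos hv0 hv1
  have hp1 := ψ.pos one_pos le_rfl
  -- the tail beyond `s₀`
  have htail : distrib S s₀ ≤ 6 * Real.exp (-(K * x ^ θ)) := by
    -- With this t the linear exponent is exactly -K x^θ, while the quadratic one is at most 1; the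
    -- 6 is 2 · 3 with e < 3.
    have h := distrib_sum_centered_le hw hind h1 hv (t := 1 / (2 * R)) (by positivity)
      (by rw [div_le_div_iff₀ (by positivity) (by norm_num)]; linarith) s₀
    have e1 : -(1 / (2 * R)) * s₀ = -(K * x ^ θ) := by
      rw [hs₀]; field_simp
    have e2 : (m : ℝ) * ((1 / (2 * R)) ^ 2 * v) ≤ 1 := by
      have : (m : ℝ) * ((1 / (2 * R)) ^ 2 * v) = x * v / (4 * V) := by
        rw [← hRR, ← hx]; field_simp; norm_num
      rw [this, div_le_one (by positivity)]
      have := le_max_left (x * v) 1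
      linarith
    rw [e1, Real.exp_add] at h
    have e3 : Real.exp ((m : ℝ) * ((1 / (2 * R)) ^ 2 * v)) ≤ 3 :=
      (Real.exp_le_exp.2 e2).trans (by have := Real.exp_one_lt_d9; linarith)
    have := mul_le_mul_of_nonneg_left e3 (Real.exp_pos (-(K * x ^ θ))).le
    linarith
  -- Capped at 1/2, where the logarithmic estimate applies; ψ(u) ≤ ψ(v) returns to v afterwards.
  set u : ℝ := min v (1 / 2) with hu
  have hu0 : 0 < u := lt_min hv0 (by norm_num)
  have huh : u ≤ 1 / 2 := min_le_right _ _
  set r : ℝ := x ^ (θ / 2) with hr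
  have hr1 : 1 ≤ r := Real.one_le_rpow hx1 (by positivity)
  have hrr : r * r = x ^ θ := by
    rw [hr, ← Real.rpow_add hx0]; ring_nf
  have hlogu : -Real.log u ≤ K * r := by
    have h2 : 1 / 2 * x ^ (-(1 + θ)) ≤ u := by
      refine le_min hlarge ?_
      have : x ^ (-(1 + θ)) ≤ 1 := Real.rpow_le_one_of_one_le_of_nonpos hx1 (by linarith)
      linarith
    have h3 : Real.log (1 / 2 * x ^ (-(1 + θ))) ≤ Real.log u :=
      Real.log_le_log (by positivity) h2
    rw [Real.log_mul (by norm_num) (by positivity), Real.log_rpow hx0, one_div,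
      Real.log_inv] at h3
    have h4 : Real.log x ≤ r / (θ / 2) := Real.log_le_rpow_div hx0.le (by positivity)
    have h5 : Real.log 2 ≤ 1 := by have := Real.log_two_lt_d9; linarith
    have h6 : (1 + θ) * Real.log x ≤ 2 * (r / (θ / 2)) :=
      mul_le_mul (by linarith) h4 (Real.log_nonneg hx1) (by norm_num)
    have h7 : K * r = r + 2 * (r / (θ / 2)) := by rw [hK]; field_simp; ring
    rw [h7]
    linarith
  have hexp : Real.exp (-(K * x ^ θ)) ≤ u ^ r := by
    rw [Real.rpow_def_of_pos hu0, Real.exp_le_exp, ← hrr]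
    have := mul_le_mul_of_nonneg_right hlogu (zero_le_one.trans hr1)
    linarith
  have hψtail : ψ (distrib S s₀) ≤ 6 * A * x ^ (-(θ / 2 * δ)) * ψ v := by
    have hur : u ^ r ∈ Icc (0 : ℝ) 1 :=
      ⟨Real.rpow_nonneg hu0.le _, Real.rpow_le_one hu0.le (by linarith) (by linarith)⟩
    have h2 := ψ.le_mul (c := 6) hur (distrib_mem S s₀) (by norm_num)
      (htail.trans (by linarith))
    have h3 := hlog u r hu0 huh hr1
    have h4 : r ^ (-δ) = x ^ (-(θ / 2 * δ)) := by
      rw [hr, ← Real.rpow_mul hx0.le]; ring_nf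
    have h5 : ψ u ≤ ψ v := ψ.mono hu0.le hv1 (min_le_left _ _)
    rw [h4] at h3
    have h6 : A * x ^ (-(θ / 2 * δ)) * ψ u ≤ A * x ^ (-(θ / 2 * δ)) * ψ v := by gcongr
    linarith
  -- the part up to `s₀`
  have hRv : R * (1 / v) ^ α ≤ 2 * x ^ (α * (1 + θ)) := by
    -- If mv ≤ 1 then R = 1 and the lower bound on v decides. Otherwise √(mv) ≤ (mv)^α, because α ≥
    -- 1/2, and the powers of v cancel.
    rcases le_or_gt (x * v) 1 with hc | hc
    · have hR' : R = 1 := by rw [hR, hV, max_eq_right hc, Real.sqrt_one]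
      rw [hR', one_mul]
      have h2 : 1 / v ≤ 2 * x ^ (1 + θ) := by
        rw [div_le_iff₀ hv0]
        rw [Real.rpow_neg hx0.le] at hlarge
        have h3 : 0 < x ^ (1 + θ) := by positivity
        have h4 := mul_le_mul_of_nonneg_left hlarge (show 0 ≤ 2 * x ^ (1 + θ) by positivity)
        have h5 : 2 * x ^ (1 + θ) * (1 / 2 * (x ^ (1 + θ))⁻¹) = 1 := by field_simp
        linarith
      calc (1 / v) ^ α ≤ (2 * x ^ (1 + θ)) ^ α :=
            Real.rpow_le_rpow (by positivity) h2 (by linarith)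
        _ = 2 ^ α * x ^ (α * (1 + θ)) := by
            rw [Real.mul_rpow (by norm_num) (by positivity), ← Real.rpow_mul hx0.le, mul_comm α]
        _ ≤ 2 * x ^ (α * (1 + θ)) := by
            gcongr
            calc (2 : ℝ) ^ α ≤ 2 ^ (1 : ℝ) :=
                  Real.rpow_le_rpow_of_exponent_le (by norm_num) hα1.le
              _ = 2 := Real.rpow_one 2
    · have hR' : R ≤ (x * v) ^ α := by
        rw [hR, hV, max_eq_left hc.le, Real.sqrt_eq_rpow]
        exact Real.rpow_le_rpow_of_exponent_le hc.le hα0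
      calc R * (1 / v) ^ α ≤ (x * v) ^ α * (1 / v) ^ α := by gcongr
        _ = x ^ α := by
            rw [← Real.mul_rpow (by positivity) (by positivity)]
            congr 1; field_simp
        _ ≤ x ^ (α * (1 + θ)) :=
            Real.rpow_le_rpow_of_exponent_le hx1 (by nlinarith)
        _ ≤ 2 * x ^ (α * (1 + θ)) := by
            have : 0 < x ^ (α * (1 + θ)) := by positivity
            linarith
  have hhead : s₀ * ψ 1 ≤ 4 * K * A * x ^ (θ + α * (1 + θ)) * ψ v := by
    have h2 := hup v 1 hv0 hv1 le_rfl
    calc s₀ * ψ 1 ≤ s₀ * (A * (1 / v) ^ α * ψ v) := by gcongr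
      _ = 2 * K * A * x ^ θ * (R * (1 / v) ^ α) * ψ v := by rw [hs₀]; ring
      _ ≤ 2 * K * A * x ^ θ * (2 * x ^ (α * (1 + θ))) * ψ v := by gcongr
      _ = 4 * K * A * x ^ (θ + α * (1 + θ)) * ψ v := by rw [Real.rpow_add hx0]; ring
  refine (lorentzENorm_le_of_bounded ψ hSm hs₀0 hs₀0 (show 0 ≤ 2 * x by positivity)
    (ae_of_all _ fun a => abs_sum_centered_le hw h1 m a)).trans (ENNReal.ofReal_le_ofReal ?_)
  have h2 : s₀ * ψ (distrib S s₀) ≤ s₀ * ψ 1 :=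
    mul_le_mul_of_nonneg_left (ψ.monotoneOn (distrib_mem S s₀) one (distrib_le_one S s₀)) hs₀0
  have h3 : 2 * x * ψ (distrib S s₀) ≤ 12 * A * x ^ (1 - θ / 2 * δ) * ψ v := by
    calc 2 * x * ψ (distrib S s₀) ≤ 2 * x * (6 * A * x ^ (-(θ / 2 * δ)) * ψ v) := by gcongr
      _ = 12 * A * (x ^ (1 : ℝ) * x ^ (-(θ / 2 * δ))) * ψ v := by rw [Real.rpow_one]; ring
      _ = _ := by rw [← Real.rpow_add hx0, sub_eq_add_neg]
  linarith

/-- The regime of rare events. Off the union of the supports, of measure at most mv, only the means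
remain. On that union the number of active summands is typically at most of order m^θ, with ψ(mv) ≤
A m^α ψ(v). The excess has probability at most 3v^r with r = m^θ, where the logarithmic index
applies. -/
lemma lorentzENorm_sum_le_of_small (ψ : Psi) {α δ A θ : ℝ} (hα0 : 1 / 2 ≤ α) (hα1 : α < 1)
    (hA : 1 ≤ A) (hθ : 0 < θ)
    (hup : ∀ u t : ℝ, 0 < u → u ≤ t → t ≤ 1 → ψ t ≤ A * (t / u) ^ α * ψ u)
    (hlog : ∀ u r : ℝ, 0 < u → u ≤ 1 / 2 → 1 ≤ r → ψ (u ^ r) ≤ A * r ^ (-δ) * ψ u)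
    {w : ℕ → unitInterval → ℝ} (hw : ∀ i, Measurable (w i)) (hind : iIndepFun w volume)
    (h1 : ∀ i a, |w i a| ≤ 1) {m : ℕ} (hm : 1 ≤ m) {v : ℝ} (hv0 : 0 < v)
    (hv : ∀ i < m, (volume : Measure unitInterval).real {a | w i a ≠ 0} ≤ v)
    (hsmall : v < 1 / 2 * (m : ℝ) ^ (-(1 + θ))) :
    lorentzENorm ψ (fun a => ∑ i ∈ Finset.range m, (w i a - ∫ b, w i b)) ≤
      ENNReal.ofReal (((2 + (1 + θ) / θ) * A * (m : ℝ) ^ (θ + α) +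
        6 * A * (m : ℝ) ^ (1 - θ * δ)) * ψ v) := by
  set x : ℝ := (m : ℝ) with hx
  have hx1 : 1 ≤ x := by rw [hx]; exact_mod_cast hm
  have hx0 : 0 < x := by linarith
  set S : unitInterval → ℝ := fun a => ∑ i ∈ Finset.range m, (w i a - ∫ b, w i b) with hS
  have hSm : Measurable S := measurable_sum_centered hw m
  have one : (1 : ℝ) ∈ Icc (0 : ℝ) 1 := by simp
  have hxp : 0 < x ^ (1 + θ) := by positivity
  have hvx : v * x ^ (1 + θ) ≤ 1 / 2 := by
    rw [Real.rpow_neg hx0.le, ← div_eq_mul_inv, lt_div_iff₀ hxp] at hsmall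
    exact hsmall.le
  have hxle : x ≤ x ^ (1 + θ) := by
    calc x = x ^ (1 : ℝ) := (Real.rpow_one x).symm
      _ ≤ _ := Real.rpow_le_rpow_of_exponent_le hx1 (by linarith)
  have hxv : x * v ≤ 1 / 2 := by
    have := mul_le_mul_of_nonneg_left hxle hv0.le
    linarith
  have hvh : v ≤ 1 / 2 := by nlinarith
  have hv1 : v ≤ 1 := by linarith
  have hvxv : v ≤ x * v := le_mul_of_one_le_left hv0.le hx1
  have hpv := ψ.pos hv0 hv1
  have hxv0 : 0 < x * v := by positivity
  -- The exponent for which the smallness of v gives mv ≤ v^ρ, so that tails in powers of mv become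
  -- tails in powers of v.
  set ρ : ℝ := θ / (1 + θ) with hρ
  have hρ0 : 0 < ρ := by positivity
  have hxvρ : x * v ≤ v ^ ρ := by
    have h2 : x ≤ v ^ (-(1 / (1 + θ))) := by
      have h3 : x ^ (1 + θ) ≤ v⁻¹ := by
        rw [← one_div, le_div_iff₀ hv0]; linarith
      have h4 := Real.rpow_le_rpow hxp.le h3 (show 0 ≤ 1 / (1 + θ) by positivity)
      rw [← Real.rpow_mul hx0.le, mul_one_div_cancel (by positivity), Real.rpow_one,
        Real.inv_rpow hv0.le, ← Real.rpow_neg hv0.le] at h4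
      exact h4
    calc x * v ≤ v ^ (-(1 / (1 + θ))) * v ^ (1 : ℝ) := by rw [Real.rpow_one]; gcongr
      _ = v ^ ρ := by
        rw [← Real.rpow_add hv0]; congr 1; rw [hρ]; field_simp; ring
  -- the counting function
  set N : unitInterval → ℝ := fun a => ∑ i ∈ Finset.range m, if w i a = 0 then (0 : ℝ) else 1
    with hN
  have hSN : ∀ a, |S a| ≤ N a + x * v := by
    intro a
    rw [hS, hN]
    refine (Finset.abs_sum_le_sum_abs _ _).trans ?_
    have : N a + x * v = ∑ i ∈ Finset.range m, ((if w i a = 0 then (0 : ℝ) else 1) + v) := by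
      rw [Finset.sum_add_distrib]; simp [hN, hx]
    rw [hN] at this
    refine le_trans (Finset.sum_le_sum fun i hi => ?_) this.ge
    refine (abs_sub _ _).trans (add_le_add ?_ ((abs_integral_le_measureReal (hw i) (h1 i)).trans
      (hv i (Finset.mem_range.1 hi))))
    split_ifs with h
    · rw [h, abs_zero]
    · exact h1 i a
  have hd1 : distrib S (x * v) ≤ x * v := by
    refine (distrib_le_of_imp (B := ⋃ i ∈ Finset.range m, {a | w i a ≠ 0}) fun a ha => ?_).trans ?_
    · by_contra hc
      simp only [mem_iUnion, not_exists] at hc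
      have hN0 : N a = 0 := Finset.sum_eq_zero fun i hi => by
        have := hc i hi
        rw [if_pos (by simpa using this)]
      have := hSN a
      linarith
    · refine (measureReal_biUnion_finset_le _ _).trans
        ((Finset.sum_le_sum fun i hi => hv i (Finset.mem_range.1 hi)).trans (le_of_eq ?_))
      simp [hx]
  set r : ℝ := x ^ θ with hr
  have hr1 : 1 ≤ r := Real.one_le_rpow hx1 hθ.le
  -- The extra 1 absorbs the total mean, which is at most mv ≤ 1/2.
  set s₀ : ℝ := 1 + r / ρ with hs₀
  have hs₀0 : 0 ≤ s₀ := by positivity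
  have hd0 : distrib S s₀ ≤ 3 * v ^ r := by
    refine (distrib_le_of_imp (B := {a | r / ρ ≤ N a}) fun a ha => ?_).trans ?_
    · have := hSN a
      change r / ρ ≤ N a
      linarith
    · have h := measure_count_ge_le hw hind hv (t := -Real.log (x * v))
        (neg_nonneg.2 (Real.log_nonpos hxv0.le (by linarith))) (r / ρ)
      refine h.trans ?_
      have e1 : (m : ℝ) * (Real.exp (-Real.log (x * v)) * v) = 1 := by
        rw [Real.exp_neg, Real.exp_log hxv0, ← hx]; field_simp
      rw [e1, neg_neg, Real.exp_add, ← Real.rpow_def_of_pos hxv0]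
      have e2 : (x * v) ^ (r / ρ) ≤ v ^ r := by
        calc (x * v) ^ (r / ρ) ≤ (v ^ ρ) ^ (r / ρ) :=
              Real.rpow_le_rpow hxv0.le hxvρ (by positivity)
          _ = v ^ r := by rw [← Real.rpow_mul hv0.le, mul_div_cancel₀ _ hρ0.ne']
      have e3 : Real.exp 1 ≤ 3 := by have := Real.exp_one_lt_d9; linarith
      have e4 : 0 ≤ v ^ r := by positivity
      calc (x * v) ^ (r / ρ) * Real.exp 1 ≤ v ^ r * 3 :=
            mul_le_mul e2 e3 (Real.exp_pos 1).le e4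
        _ = _ := mul_comm _ _
  have hψ0 : ψ (distrib S s₀) ≤ 3 * A * x ^ (-(θ * δ)) * ψ v := by
    have h2 := ψ.le_mul (c := 3) ⟨Real.rpow_nonneg hv0.le r,
      Real.rpow_le_one hv0.le hv1 (by linarith)⟩ (distrib_mem S s₀) (by norm_num) hd0
    have h3 := hlog v r hv0 hvh hr1
    have h4 : r ^ (-δ) = x ^ (-(θ * δ)) := by
      rw [hr, ← Real.rpow_mul hx0.le]; ring_nf
    rw [h4] at h3
    linarith
  have hψ1 : ψ (distrib S (x * v)) ≤ A * x ^ α * ψ v := by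
    refine (ψ.monotoneOn (distrib_mem S _) ⟨hxv0.le, by linarith⟩ hd1).trans ?_
    have := hup v (x * v) hv0 hvxv (by linarith)
    rwa [mul_div_cancel_right₀ _ hv0.ne'] at this
  have hmean : x * v * ψ 1 ≤ A * x ^ α * ψ v := by
    have h2 := hup v 1 hv0 hv1 le_rfl
    have h3 : x * v * (1 / v) ^ α ≤ x ^ α := by
      have h4 : x * v ≤ (x * v) ^ α := by
        calc x * v = (x * v) ^ (1 : ℝ) := (Real.rpow_one _).symm
          _ ≤ _ := Real.rpow_le_rpow_of_exponent_ge hxv0 (by linarith) hα1.le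
      calc x * v * (1 / v) ^ α ≤ (x * v) ^ α * (1 / v) ^ α := by gcongr
        _ = x ^ α := by
            rw [← Real.mul_rpow (by positivity) (by positivity)]
            congr 1; field_simp
    calc x * v * ψ 1 ≤ x * v * (A * (1 / v) ^ α * ψ v) := by gcongr
      _ = A * (x * v * (1 / v) ^ α) * ψ v := by ring
      _ ≤ A * x ^ α * ψ v := by gcongr
  refine (lorentzENorm_le_of_bounded ψ hSm hxv0.le hs₀0 (show 0 ≤ 2 * x by positivity)
    (ae_of_all _ fun a => abs_sum_centered_le hw h1 m a)).trans (ENNReal.ofReal_le_ofReal ?_)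
  have hs₀r : s₀ ≤ (1 + (1 + θ) / θ) * x ^ θ := by
    have : r / ρ = (1 + θ) / θ * r := by rw [hρ]; field_simp
    rw [hs₀, this, ← hr]
    linarith
  have h2 : s₀ * ψ (distrib S (x * v)) ≤ (1 + (1 + θ) / θ) * A * x ^ (θ + α) * ψ v := by
    calc s₀ * ψ (distrib S (x * v)) ≤ (1 + (1 + θ) / θ) * x ^ θ * (A * x ^ α * ψ v) :=
          mul_le_mul hs₀r hψ1 (ψ.nonneg (distrib_mem _ _)) (by positivity)
      _ = _ := by rw [Real.rpow_add hx0]; ring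
  have h3 : 2 * x * ψ (distrib S s₀) ≤ 6 * A * x ^ (1 - θ * δ) * ψ v := by
    calc 2 * x * ψ (distrib S s₀) ≤ 2 * x * (3 * A * x ^ (-(θ * δ)) * ψ v) := by gcongr
      _ = 6 * A * (x ^ (1 : ℝ) * x ^ (-(θ * δ))) * ψ v := by rw [Real.rpow_one]; ring
      _ = _ := by rw [← Real.rpow_add hx0, sub_eq_add_neg]
  have h4 : A * x ^ α * ψ v ≤ A * x ^ (θ + α) * ψ v := by
    have : x ^ α ≤ x ^ (θ + α) := Real.rpow_le_rpow_of_exponent_le hx1 (by linarith)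
    gcongr
  linarith

/-- Sums of `m` independent centred variables, bounded by `1` with supports of measure at most
`v`, grow like a power of `m` less than one. -/
lemma exists_lorentzENorm_sum_le (ψ : Psi) {α δ A B : ℝ} (hα0 : 1 / 2 ≤ α) (hα1 : α < 1)
    (hδ : 0 < δ) (hA : 1 ≤ A)
    (hup : ∀ u t : ℝ, 0 < u → u ≤ t → t ≤ 1 → ψ t ≤ A * (t / u) ^ α * ψ u)
    (hlog : ∀ u r : ℝ, 0 < u → u ≤ 1 / 2 → 1 ≤ r → ψ (u ^ r) ≤ B * r ^ (-δ) * ψ u) :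
    ∃ β C : ℝ, 0 < β ∧ β < 1 ∧ 0 ≤ C ∧ ∀ w : ℕ → unitInterval → ℝ, (∀ i, Measurable (w i)) →
      iIndepFun w volume → (∀ i a, |w i a| ≤ 1) → ∀ m : ℕ, 1 ≤ m → ∀ v : ℝ, 0 < v → v ≤ 1 →
      (∀ i < m, (volume : Measure unitInterval).real {a | w i a ≠ 0} ≤ v) →
      lorentzENorm ψ (fun a => ∑ i ∈ Finset.range m, (w i a - ∫ b, w i b)) ≤
        ENNReal.ofReal (C * (m : ℝ) ^ β * ψ v) := by
  set D : ℝ := max A B with hD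
  have hD1 : 1 ≤ D := hA.trans (le_max_left _ _)
  have hup' : ∀ u t : ℝ, 0 < u → u ≤ t → t ≤ 1 → ψ t ≤ D * (t / u) ^ α * ψ u := by
    intro u t hu hut ht
    have hp := ψ.pos hu (hut.trans ht)
    have : 0 < t / u := div_pos (hu.trans_le hut) hu
    refine (hup u t hu hut ht).trans ?_
    gcongr
    exact le_max_left _ _
  have hlog' : ∀ u r : ℝ, 0 < u → u ≤ 1 / 2 → 1 ≤ r → ψ (u ^ r) ≤ D * r ^ (-δ) * ψ u := by
    intro u r hu hu' hr
    have hp := ψ.pos hu (by linarith)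
    refine (hlog u r hu hu' hr).trans ?_
    gcongr
    exact le_max_right _ _
  -- Small enough that θ(1 + α) < 1 - α, hence θ + α(1 + θ) < 1.
  set θ : ℝ := (1 - α) / 4 with hθ
  have hθ0 : 0 < θ := by rw [hθ]; linarith
  have hθ1 : θ ≤ 1 := by rw [hθ]; linarith
  set β : ℝ := max (θ + α * (1 + θ)) (1 - θ / 2 * δ) with hβ
  have hβ1 : β < 1 := max_lt (by rw [hθ]; nlinarith) (by nlinarith [mul_pos hθ0 hδ])
  have hβ0 : 0 < β := lt_of_lt_of_le (by nlinarith) (le_max_left _ _)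
  refine ⟨β, 8 * (1 + 4 / θ) * D + (2 + (1 + θ) / θ) * D + 12 * D, hβ0, hβ1, by positivity,
    fun w hw hind h1 m hm v hv0 hv1 hv => ?_⟩
  have hm1 : (1 : ℝ) ≤ m := by exact_mod_cast hm
  have hpv := ψ.pos hv0 hv1
  have hpow : ∀ e ≤ β, (m : ℝ) ^ e ≤ (m : ℝ) ^ β := fun e he =>
    Real.rpow_le_rpow_of_exponent_le hm1 he
  have p1 := hpow _ (le_max_left (θ + α * (1 + θ)) (1 - θ / 2 * δ))
  have p2 := hpow _ (le_max_right (θ + α * (1 + θ)) (1 - θ / 2 * δ))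
  have p3 := hpow (θ + α) (le_trans (by nlinarith) (le_max_left _ _))
  have p4 := hpow (1 - θ * δ) (le_trans (by nlinarith [mul_pos hθ0 hδ]) (le_max_right _ _))
  have hb : 0 < (m : ℝ) ^ β := by positivity
  have hD0 : 0 < D := by linarith
  have q0 : 0 ≤ 8 * (1 + 4 / θ) * D * (m : ℝ) ^ β := by positivity
  have q1 : 0 ≤ (2 + (1 + θ) / θ) * D * (m : ℝ) ^ β := by positivity
  have q2 : 0 ≤ D * (m : ℝ) ^ β := by positivity
  rcases le_or_gt (1 / 2 * (m : ℝ) ^ (-(1 + θ))) v with hc | hc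
  · refine (lorentzENorm_sum_le_of_large ψ hα0 hα1 hD1 hθ0 hθ1 hup' hlog' hw hind h1 hm hv0 hv1 hv
      hc).trans (ENNReal.ofReal_le_ofReal (mul_le_mul_of_nonneg_right ?_ hpv.le))
    have r1 : 8 * (1 + 4 / θ) * D * (m : ℝ) ^ (θ + α * (1 + θ)) ≤
      8 * (1 + 4 / θ) * D * (m : ℝ) ^ β := by gcongr
    have r2 : 12 * D * (m : ℝ) ^ (1 - θ / 2 * δ) ≤ 12 * D * (m : ℝ) ^ β := by gcongr
    linarith
  · refine (lorentzENorm_sum_le_of_small ψ hα0 hα1 hD1 hθ0 hup' hlog' hw hind h1 hm hv0 hv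
      hc).trans (ENNReal.ofReal_le_ofReal (mul_le_mul_of_nonneg_right ?_ hpv.le))
    have r1 : (2 + (1 + θ) / θ) * D * (m : ℝ) ^ (θ + α) ≤
      (2 + (1 + θ) / θ) * D * (m : ℝ) ^ β := by gcongr
    have r2 : 6 * D * (m : ℝ) ^ (1 - θ * δ) ≤ 6 * D * (m : ℝ) ^ β := by gcongr
    linarith

/-! ### Weakly null independent sequences have uniformly small tails -/

lemma exists_seq_of_step {α : Type*} (P : ℕ → α → Prop) (R : ℕ → α → α → Prop)
    (h0 : ∃ a, P 0 a) (hs : ∀ k a, P k a → ∃ b, P (k + 1) b ∧ R k a b) :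
    ∃ s : ℕ → α, ∀ k, P k (s k) ∧ R k (s k) (s (k + 1)) := by
  obtain ⟨a, ha⟩ := h0
  choose f hf using hs
  let t : ∀ k, {a // P k a} := fun k =>
    Nat.rec ⟨a, ha⟩ (fun k c => ⟨f k c.1 c.2, (hf k c.1 c.2).1⟩) k
  exact ⟨fun k => (t k).1, fun k => ⟨(t k).2, (hf k (t k).1 (t k).2).2⟩⟩

lemma sum_half_pow_le (n : ℕ) : ∑ k ∈ Finset.range n, (1 / 2 : ℝ) ^ k ≤ 2 := by
  have := (summable_geometric_two).sum_le_tsum (Finset.range n) fun i _ => by positivity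
  rwa [tsum_geometric_two] at this

/-- The dyadic tail of the norm beyond the level `2 ^ I`. -/
noncomputable def dyadicTail (ψ : Psi) (x : unitInterval → ℝ) (I : ℕ) : ℝ≥0∞ :=
  ∑' i : ℕ, ENNReal.ofReal (2 ^ (i + I) * ψ (distrib x (2 ^ (i + I))))

lemma dyadic_coeff_le (I j : ℕ) :
    ∑ i ∈ Finset.range (j + 1), (2 : ℝ) ^ (i + I) / 2 ≤ 2 ^ (j + I) := by
  have h : ∀ j : ℕ, ∑ i ∈ Finset.range (j + 1), (2 : ℝ) ^ (i + I) / 2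
      = 2 ^ (j + I) - 2 ^ I / 2 := by
    intro j
    induction j with
    | zero => simp; ring
    | succ j ih => rw [Finset.sum_range_succ, ih]; ring
  rw [h]
  have : (0 : ℝ) < 2 ^ I := by positivity
  linarith

lemma monotone_two_pow_add (I : ℕ) : Monotone fun i : ℕ => (2 : ℝ) ^ (i + I) := fun a b h =>
  pow_le_pow_right₀ (by norm_num) (by lia)

lemma dyadicTail_le (ψ : Psi) {x : unitInterval → ℝ} (hx : Measurable x) (I : ℕ) :
    dyadicTail ψ x I ≤ 2 * lorentzENorm ψ x := by
  refine ENNReal.tsum_le_of_sum_range_le fun n => ?_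
  obtain ⟨G, -, hsub, -, hG⟩ := exists_levelWeight ψ hx (monotone_two_pow_add I) n
  have h := (hG (fun i => 2 ^ (i + I) / 2) (fun i => by positivity)
    (dyadic_coeff_le I)).trans (hsub.lintegral_mul_le hx)
  refine le_trans (le_of_eq ?_) (mul_le_mul_right h 2)
  rw [← ENNReal.ofReal_sum_of_nonneg fun i _ =>
    mul_nonneg (by positivity) (ψ.nonneg (distrib_mem _ _)), show (2 : ℝ≥0∞) = ENNReal.ofReal 2 by
      simp, ← ENNReal.ofReal_mul (by norm_num), Finset.mul_sum]
  congr 1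
  exact Finset.sum_congr rfl fun i _ => by ring

lemma dyadicTail_antitone (ψ : Psi) (x : unitInterval → ℝ) : Antitone (dyadicTail ψ x) := by
  refine antitone_nat_of_succ_le fun I => ?_
  rw [dyadicTail, dyadicTail]
  conv_rhs => rw [tsum_eq_zero_add' ENNReal.summable]
  refine le_trans (le_of_eq (tsum_congr fun i => ?_)) le_add_self
  rw [show i + (I + 1) = i + 1 + I by ring]

lemma tendsto_dyadicTail (ψ : Psi) {x : unitInterval → ℝ} (hx : Measurable x)
    (h : lorentzENorm ψ x < ∞) : Tendsto (dyadicTail ψ x) atTop (𝓝 0) := by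
  refine ENNReal.tendsto_sum_nat_add
    (fun i => ENNReal.ofReal (2 ^ i * ψ (distrib x (2 ^ i)))) ?_
  have h1 := (dyadicTail_le ψ hx 0).trans_lt (ENNReal.mul_lt_top ENNReal.ofNat_lt_top h)
  exact h1.ne

/-- `b k` stands for the mass of the k-th weight on a set of measure t. While t ≤ τ_k the weight
contributes at most 2^(-k)ψ(t). The first k with τ_k < t contributes at most ψ(t). Later weights are
already small compared with ψ of an earlier scale below t. The total is 2 + 1. -/
lemma sum_le_of_scales {ψ : Psi} {b τ : ℕ → ℝ} {t : ℝ} (ht : t ∈ Icc (0 : ℝ) 1)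
    (hτ : Antitone τ) (hτ0 : ∀ k, 0 < τ k)
    (h1 : ∀ k, b k ≤ ψ t) (h2 : ∀ k, t ≤ τ k → b k ≤ (1 / 2) ^ k * ψ t)
    (h3 : ∀ k, b (k + 1) ≤ (1 / 2) ^ (k + 1) * ψ (τ k)) (n : ℕ) :
    ∑ k ∈ Finset.range n, b k ≤ 3 * ψ t := by
  classical
  have hp := ψ.nonneg ht
  have hgeo : ∑ k ∈ Finset.range n, (1 / 2 : ℝ) ^ k * ψ t ≤ 2 * ψ t := by
    rw [← Finset.sum_mul]; exact mul_le_mul_of_nonneg_right (sum_half_pow_le n) hp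
  by_cases hall : ∀ k, t ≤ τ k
  · have := Finset.sum_le_sum fun k (_ : k ∈ Finset.range n) => h2 k (hall k)
    linarith
  · push Not at hall
    set k₀ := Nat.find hall with hk₀
    have hk₀t : τ k₀ < t := Nat.find_spec hall
    have hb : ∀ k ∈ Finset.range n, b k ≤ (1 / 2) ^ k * ψ t + if k = k₀ then ψ t else 0 := by
      intro k _
      have hpk : 0 ≤ (1 / 2 : ℝ) ^ k * ψ t := by positivity
      rcases lt_trichotomy k k₀ with h | h | h
      · rw [if_neg h.ne, add_zero]
        exact h2 k (not_lt.1 (Nat.find_min hall h))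
      · rw [if_pos h]; linarith [h1 k]
      · rw [if_neg h.ne', add_zero]
        obtain ⟨j, rfl⟩ : ∃ j, k = j + 1 := ⟨k - 1, by lia⟩
        refine (h3 j).trans ?_
        have hle : τ j ≤ t := (hτ (by lia : k₀ ≤ j)).trans hk₀t.le
        have := ψ.mono (hτ0 j).le ht.2 hle
        gcongr
    have h4 := Finset.sum_le_sum hb
    rw [Finset.sum_add_distrib, Finset.sum_ite_eq'] at h4
    split_ifs at h4 <;> linarith

/-- A bounded functional built from a summable family of weights. -/
lemma exists_functional (ψ : Psi) {W h : ℕ → unitInterval → ℝ}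
    (hW : ∀ k, IsSubordinate ψ (W k)) (hh : ∀ k, Measurable (h k)) (hhW : ∀ k u, |h k u| ≤ W k u)
    (hsum : ∀ n B, MeasurableSet B → ∑ k ∈ Finset.range n, ∫ u in B, W k u ≤
      3 * ψ ((volume : Measure unitInterval).real B)) :
    ∃ φ : Lorentz ψ →ₗ[ℝ] ℝ, (∃ C : ℝ, ∀ y, |φ y| ≤ C * lorentzNorm ψ y) ∧
      ∀ y : Lorentz ψ,
        HasSum (fun k => ∫ u, ((y : unitInterval →ₘ[volume] ℝ) : unitInterval → ℝ) u * h k u)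
          (φ y) := by
  have hint : ∀ k (y : Lorentz ψ), Integrable fun u =>
      |((y : unitInterval →ₘ[volume] ℝ) : unitInterval → ℝ) u| * W k u := by
    intro k y
    obtain ⟨H, hH⟩ := (hW k).bounded
    refine (integrable_coe y).abs.mul_bdd (c := H) (hW k).measurable.aestronglyMeasurable
      (ae_of_all _ fun u => ?_)
    rw [Real.norm_of_nonneg ((hW k).nonneg u)]; exact hH u
  have hint' : ∀ k (y : Lorentz ψ), Integrable fun u =>
      ((y : unitInterval →ₘ[volume] ℝ) : unitInterval → ℝ) u * h k u := by
    intro k y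
    refine (hint k y).mono' ((measurable_coe y).mul (hh k)).aestronglyMeasurable
      (ae_of_all _ fun u => ?_)
    rw [Real.norm_eq_abs, abs_mul]
    exact mul_le_mul_of_nonneg_left (hhW k u) (abs_nonneg _)
  have hpart : ∀ (y : Lorentz ψ) n, ∑ k ∈ Finset.range n,
      ∫ u, |((y : unitInterval →ₘ[volume] ℝ) : unitInterval → ℝ) u| * W k u ≤
        3 * lorentzNorm ψ y := by
    intro y n
    rw [← ENNReal.ofReal_le_ofReal_iff (mul_nonneg (by norm_num) (lorentzNorm_nonneg y)),
      ENNReal.ofReal_mul (by norm_num), ofReal_lorentzNorm]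
    -- The partial sum of the weights is paired as one density, which keeps the bound independent of
    -- n.
    have h1 := lintegral_mul_le_lorentzENorm ψ (C := ENNReal.ofReal 3) (measurable_coe y)
      (H := fun u => ∑ k ∈ Finset.range n, ENNReal.ofReal (W k u))
      (Finset.measurable_fun_sum _ fun k _ => (hW k).measurable.ennreal_ofReal) (by
        intro B hB
        rw [lintegral_finsetSum _ fun k _ => (hW k).measurable.ennreal_ofReal,
          ← ENNReal.ofReal_mul (by norm_num)]
        refine le_trans (le_of_eq ?_) (ENNReal.ofReal_le_ofReal (hsum n B hB))
        rw [ENNReal.ofReal_sum_of_nonneg fun k _ => integral_nonneg fun u => (hW k).nonneg u]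
        exact Finset.sum_congr rfl fun k _ => (ofReal_integral_eq_lintegral_ofReal
          (hW k).integrable.restrict (ae_of_all _ (hW k).nonneg)).symm)
    refine le_trans (le_of_eq ?_) h1
    rw [ENNReal.ofReal_sum_of_nonneg fun k _ => integral_nonneg fun u =>
      mul_nonneg (abs_nonneg _) ((hW k).nonneg u)]
    simp_rw [Finset.mul_sum]
    rw [lintegral_finsetSum _ fun k _ => by
      have := (hW k).measurable
      have := measurable_coe y
      fun_prop]
    refine Finset.sum_congr rfl fun k _ => ?_
    rw [ofReal_integral_eq_lintegral_ofReal (hint k y)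
      (ae_of_all _ fun u => mul_nonneg (abs_nonneg _) ((hW k).nonneg u))]
    exact lintegral_congr fun u => ENNReal.ofReal_mul (abs_nonneg _)
  have hle : ∀ (y : Lorentz ψ) k,
      |∫ u, ((y : unitInterval →ₘ[volume] ℝ) : unitInterval → ℝ) u * h k u| ≤
      ∫ u, |((y : unitInterval →ₘ[volume] ℝ) : unitInterval → ℝ) u| * W k u := by
    intro y k
    refine abs_integral_le_integral_abs.trans (integral_mono (hint' k y).abs (hint k y)
      fun u => ?_)
    rw [abs_mul]
    exact mul_le_mul_of_nonneg_left (hhW k u) (abs_nonneg _)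
  have hs1 : ∀ y : Lorentz ψ, Summable fun k =>
      ∫ u, |((y : unitInterval →ₘ[volume] ℝ) : unitInterval → ℝ) u| * W k u := fun y =>
    summable_of_sum_range_le (fun k => integral_nonneg fun u =>
      mul_nonneg (abs_nonneg _) ((hW k).nonneg u)) (hpart y)
  have hs2 : ∀ y : Lorentz ψ, Summable fun k =>
      ∫ u, ((y : unitInterval →ₘ[volume] ℝ) : unitInterval → ℝ) u * h k u := fun y =>
    Summable.of_norm_bounded (hs1 y) (hle y)
  refine ⟨{ toFun := fun y => ∑' k,
              ∫ u, ((y : unitInterval →ₘ[volume] ℝ) : unitInterval → ℝ) u * h k u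
            map_add' := fun y z => ?_
            map_smul' := fun c y => ?_ }, ⟨3, fun y => ?_⟩, fun y => (hs2 y).hasSum⟩
  · rw [← (hs2 y).tsum_add (hs2 z)]
    refine tsum_congr fun k => ?_
    rw [← integral_add (hint' k y) (hint' k z)]
    refine integral_congr_ae ?_
    filter_upwards [AEEqFun.coeFn_add (y : unitInterval →ₘ[volume] ℝ) z] with u hu
    rw [Submodule.coe_add, hu, Pi.add_apply, add_mul]
  · rw [RingHom.id_apply, smul_eq_mul, ← tsum_mul_left]
    refine tsum_congr fun k => ?_
    rw [← integral_const_mul]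
    refine integral_congr_ae ?_
    filter_upwards [AEEqFun.coeFn_smul c (y : unitInterval →ₘ[volume] ℝ)] with u hu
    rw [Submodule.coe_smul, hu, Pi.smul_apply, smul_eq_mul, mul_assoc]
  · change |∑' k, ∫ u, ((y : unitInterval →ₘ[volume] ℝ) : unitInterval → ℝ) u * h k u| ≤ _
    rw [← Real.norm_eq_abs]
    refine (tsum_of_norm_bounded (hs1 y).hasSum (hle y)).trans ?_
    exact Real.tsum_le_of_sum_range_le (fun k => integral_nonneg fun u =>
      mul_nonneg (abs_nonneg _) ((hW k).nonneg u)) (hpart y)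

/-- A weight normed by the part of `x` above a high level. -/
lemma exists_tail_weight (ψ : Psi) {x : unitInterval → ℝ} (hx : Measurable x) {C ε : ℝ}
    (hC : lorentzENorm ψ x ≤ ENNReal.ofReal C) (hC0 : 0 ≤ C) {I : ℕ}
    (hI : ENNReal.ofReal ε < dyadicTail ψ x I) :
    ∃ G : ℝ → ℝ, Measurable G ∧ IsSubordinate ψ (fun u => G (x u)) ∧
      ∫ u, G (x u) ≤ C / 2 ^ I ∧ ε / 2 ≤ ∫ u, |x u| * G (x u) := by
  obtain ⟨n, hn⟩ : ∃ n, ENNReal.ofReal ε < ∑ i ∈ Finset.range n,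
      ENNReal.ofReal (2 ^ (i + I) * ψ (distrib x (2 ^ (i + I)))) := by
    rw [dyadicTail, ENNReal.tsum_eq_iSup_nat] at hI
    exact lt_iSup_iff.1 hI
  obtain ⟨G, hGm, hsub, hG0, hG⟩ := exists_levelWeight ψ hx (monotone_two_pow_add I) n
  refine ⟨G, hGm, hsub, ?_, ?_⟩
  · have hs : MeasurableSet {u | (2 : ℝ) ^ I < |x u|} :=
      measurableSet_lt measurable_const (by fun_prop)
    -- The weight lives on {|x| > 2^I}, a set on which ψ of the measure is at most C/2^I by
    -- Chebyshev.
    have h1 : ∫ u, G (x u) = ∫ u in {u | (2 : ℝ) ^ I < |x u|}, G (x u) := by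
      refine (setIntegral_eq_integral_of_forall_compl_eq_zero fun u hu => hG0 _ ?_).symm
      simpa using hu
    rw [h1]
    refine (hsub.setIntegral_le _ hs).trans ?_
    rw [le_div_iff₀ (by positivity), mul_comm]
    have h2 := (mul_psi_le_lorentzENorm ψ hx (s := 2 ^ I) (distrib_mem x (2 ^ I))
      (fun r hr => distrib_anti x hr.le)).trans hC
    exact (ENNReal.ofReal_le_ofReal_iff hC0).1 h2
  · have hint : Integrable fun u => |x u| * G (x u) := by
      obtain ⟨H, hH⟩ := hsub.bounded
      refine (integrable_of_lorentzENorm_lt_top ψ hx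
        (hC.trans_lt ENNReal.ofReal_lt_top)).abs.mul_bdd (c := H)
        hsub.measurable.aestronglyMeasurable (ae_of_all _ fun u => ?_)
      rw [Real.norm_of_nonneg (hsub.nonneg u)]; exact hH u
    have h := hG (fun i => 2 ^ (i + I) / 2) (fun i => by positivity) (dyadic_coeff_le I)
    have e : ∫⁻ u, ENNReal.ofReal |x u| * ENNReal.ofReal (G (x u))
        = ENNReal.ofReal (∫ u, |x u| * G (x u)) := by
      rw [ofReal_integral_eq_lintegral_ofReal hint
        (ae_of_all _ fun u => mul_nonneg (abs_nonneg _) (hsub.nonneg u))]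
      exact lintegral_congr fun u => (ENNReal.ofReal_mul (abs_nonneg _)).symm
    rw [e, ENNReal.ofReal_le_ofReal_iff
      (integral_nonneg fun u => mul_nonneg (abs_nonneg _) (hsub.nonneg u))] at h
    refine le_trans ?_ h
    rw [← ENNReal.ofReal_sum_of_nonneg fun i _ =>
      mul_nonneg (by positivity) (ψ.nonneg (distrib_mem _ _))] at hn
    have h3 := (ENNReal.ofReal_lt_ofReal_iff'.1 hn).1.le
    refine (div_le_div_of_nonneg_right h3 (by norm_num : (0 : ℝ) ≤ 2)).trans (le_of_eq ?_)
    rw [Finset.sum_div]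
    exact Finset.sum_congr rfl fun i _ => by ring

/-- Gliding hump. If high levels kept carrying norm, weights concentrated there could be summed to
one bounded functional: `hψ` makes each bounded weight negligible on small sets, and later weights
have tiny total mass. Independence reduces the pairing with the other weights to products of means,
so the functional stays near or above ε/2 along a subsequence, against weak nullity. -/
lemma WeaklyNull.uniform_tail {ψ : Psi}
    (hψ : ∀ H ε : ℝ, 0 < ε → ∃ τ : ℝ, 0 < τ ∧ ∀ t, 0 ≤ t → t ≤ τ → t ≤ 1 → H * t ≤ ε * ψ t)
    {x : ℕ → Lorentz ψ} (hx : WeaklyNull ψ x)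
    (hind : iIndepFun (fun n => ((x n : unitInterval →ₘ[volume] ℝ) : unitInterval → ℝ)) volume)
    {ε : ℝ} (hε : 0 < ε) :
    ∃ I, ∀ n, dyadicTail ψ ((x n : unitInterval →ₘ[volume] ℝ) : unitInterval → ℝ) I
      ≤ ENNReal.ofReal ε := by
  by_contra! hcon
  set X : ℕ → unitInterval → ℝ := fun n => ((x n : unitInterval →ₘ[volume] ℝ) : unitInterval → ℝ)
    with hX
  have hXm : ∀ n, Measurable (X n) := fun n => measurable_coe (x n)
  obtain ⟨C₀, hC₀⟩ := hx.bounded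
  set C : ℝ := max C₀ 0 with hC
  have hC0 : 0 ≤ C := le_max_right _ _
  have hXC : ∀ n, lorentzENorm ψ (X n) ≤ ENNReal.ofReal C := fun n =>
    (lorentzNorm_le_iff _ hC0).1 ((hC₀ n).trans (le_max_left _ _))
  -- the tails stay large along arbitrarily late members
  have hfreq : ∀ I n₀ : ℕ, ∃ n ≥ n₀, ENNReal.ofReal ε < dyadicTail ψ (X n) I := by
    intro I n₀
    -- Each single member has vanishing tails, so beyond some J none of the first n₀ members can
    -- violate the bound; the violating index is therefore late.
    have h1 : ∀ᶠ J in atTop, ∀ n ∈ Finset.range n₀, dyadicTail ψ (X n) J < ENNReal.ofReal ε := by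
      rw [eventually_all_finset]
      intro n _
      exact (tendsto_dyadicTail ψ (hXm n) ((hXC n).trans_lt ENNReal.ofReal_lt_top)).eventually
        (gt_mem_nhds (ENNReal.ofReal_pos.2 hε))
    obtain ⟨J, hJ, hIJ⟩ := (h1.and (eventually_ge_atTop I)).exists
    obtain ⟨n, hn⟩ := hcon J
    refine ⟨n, ?_, hn.trans_le (dyadicTail_antitone ψ _ hIJ)⟩
    by_contra! hlt
    exact absurd (hJ n (Finset.mem_range.2 hlt)) (not_lt.2 hn.le)
  have hstep : ∀ η : ℝ, 0 < η → ∀ n₀ : ℕ, ∃ n ≥ n₀, ∃ G : ℝ → ℝ, Measurable G ∧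
      IsSubordinate ψ (fun u => G (X n u)) ∧ ∫ u, G (X n u) ≤ η ∧
      ε / 2 ≤ ∫ u, |X n u| * G (X n u) := by
    intro η hη n₀
    obtain ⟨I, hI⟩ := pow_unbounded_of_one_lt (C / η) (one_lt_two (α := ℝ))
    obtain ⟨n, hn, hnI⟩ := hfreq I n₀
    obtain ⟨G, h1, h2, h3, h4⟩ := exists_tail_weight ψ (hXm n) (hXC n) hC0 hnI
    refine ⟨n, hn, G, h1, h2, h3.trans ?_, h4⟩
    rw [div_le_iff₀ (by positivity), mul_comm]
    exact ((div_lt_iff₀ hη).1 hI).le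
  -- inductive choice of members, weights and scales
  have hscale : ∀ (k : ℕ) (W : unitInterval → ℝ), IsSubordinate ψ W → ∀ τ₀ : ℝ, 0 < τ₀ →
      ∃ τ : ℝ, 0 < τ ∧ τ ≤ τ₀ ∧ τ ≤ 1 ∧
        ∀ t, 0 ≤ t → t ≤ τ → ∀ u, W u * t ≤ (1 / 2) ^ k * ψ t := by
    intro k W hW τ₀ hτ₀
    obtain ⟨H, hH⟩ := hW.bounded
    obtain ⟨τ, hτ, hτH⟩ := hψ H ((1 / 2) ^ k) (by positivity)
    refine ⟨min τ (min τ₀ 1), lt_min hτ (lt_min hτ₀ one_pos),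
      (min_le_right _ _).trans (min_le_left _ _), (min_le_right _ _).trans (min_le_right _ _),
      fun t ht0 ht u => ?_⟩
    refine (mul_le_mul_of_nonneg_right (hH u) ht0).trans (hτH t ht0 (ht.trans (min_le_left _ _))
      (ht.trans ((min_le_right _ _).trans (min_le_right _ _))))
  -- A state is a triple (index, weight, scale). The next weight has mass small against ψ at the
  -- current scale; the next scale is then taken so small that this new weight is negligible on sets
  -- below it.
  obtain ⟨s, hs⟩ := exists_seq_of_step (α := ℕ × (ℝ → ℝ) × ℝ)
    (fun k a => Measurable a.2.1 ∧ IsSubordinate ψ (fun u => a.2.1 (X a.1 u)) ∧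
      ε / 2 ≤ ∫ u, |X a.1 u| * a.2.1 (X a.1 u) ∧ 0 < a.2.2 ∧ a.2.2 ≤ 1 ∧
      ∀ t, 0 ≤ t → t ≤ a.2.2 → ∀ u, a.2.1 (X a.1 u) * t ≤ (1 / 2) ^ k * ψ t)
    (fun k a b => a.1 < b.1 ∧ b.2.2 ≤ a.2.2 ∧
      ∫ u, b.2.1 (X b.1 u) ≤ (1 / 2) ^ (k + 1) * ψ a.2.2) (by
      obtain ⟨n, -, G, h1, h2, h3, h4⟩ := hstep 1 one_pos 0
      obtain ⟨τ, t1, -, t3, t4⟩ := hscale 0 _ h2 1 one_pos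
      exact ⟨(n, G, τ), h1, h2, h4, t1, t3, t4⟩) (by
      rintro k ⟨n₀, G₀, τ₀⟩ ⟨-, -, -, p4, p5, -⟩
      obtain ⟨n, hn, G, h1, h2, h3, h4⟩ := hstep ((1 / 2) ^ (k + 1) * ψ τ₀)
        (mul_pos (by positivity) (ψ.pos p4 p5)) (n₀ + 1)
      obtain ⟨τ, t1, t2, t3, t4⟩ := hscale (k + 1) _ h2 τ₀ p4
      exact ⟨(n, G, τ), ⟨h1, h2, h4, t1, t3, t4⟩, hn, t2, h3⟩)
  set N : ℕ → ℕ := fun k => (s k).1 with hN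
  set G : ℕ → ℝ → ℝ := fun k => (s k).2.1 with hG
  set τ : ℕ → ℝ := fun k => (s k).2.2 with hτ
  have hNmono : StrictMono N := strictMono_nat_of_lt_succ fun k => (hs k).2.1
  have hτanti : Antitone τ := antitone_nat_of_succ_le fun k => (hs k).2.2.1
  set W : ℕ → unitInterval → ℝ := fun k u => G k (X (N k) u) with hW
  have hWs : ∀ k, IsSubordinate ψ (W k) := fun k => (hs k).1.2.1
  have hτ0 : ∀ k, 0 < τ k := fun k => (hs k).1.2.2.2.1
  have hGm : ∀ k, Measurable (G k) := fun k => (hs k).1.1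
  have hsum : ∀ n B, MeasurableSet B → ∑ k ∈ Finset.range n, ∫ u in B, W k u ≤
      3 * ψ ((volume : Measure unitInterval).real B) := by
    intro n B hB
    refine sum_le_of_scales (τ := τ) (measureReal_mem B) hτanti hτ0
      (fun k => (hWs k).setIntegral_le B hB) (fun k hk => ?_) (fun k => ?_) n
    -- At t = m(B) the scale condition bounds tW_k pointwise by 2^(-k)ψ(t); integrating over `B`
    -- leaves a common factor t to cancel.
    · have hb : ∫ u in B, W k u * (volume : Measure unitInterval).real B ≤
          ∫ _ in B, (1 / 2) ^ k * ψ ((volume : Measure unitInterval).real B) :=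
        integral_mono ((hWs k).integrable.restrict.mul_const _) (integrable_const _)
          fun u => (hs k).1.2.2.2.2.2 _ measureReal_nonneg hk u
      rw [integral_mul_const, setIntegral_const, smul_eq_mul, mul_comm] at hb
      rcases eq_or_lt_of_le (measureReal_nonneg (μ := (volume : Measure unitInterval)) (s := B))
        with h0 | h0
      · have := (hWs k).setIntegral_le B hB
        rw [← h0, ψ.map_zero] at this ⊢
        rwa [mul_zero]
      · exact le_of_mul_le_mul_left hb h0
    · refine le_trans ?_ (hs k).2.2.2
      exact setIntegral_le_integral (hWs (k + 1)).integrable (ae_of_all _ (hWs (k + 1)).nonneg)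
  set sg : ℝ → ℝ := fun r => if 0 ≤ r then 1 else -1 with hsg
  have hsgm : Measurable sg :=
    Measurable.ite measurableSet_Ici measurable_const measurable_const
  have hsg1 : ∀ r, |sg r| = 1 := fun r => by simp only [hsg]; split_ifs <;> simp
  have hsgr : ∀ r, r * sg r = |r| := fun r => by
    simp only [hsg]; split_ifs with h
    · rw [mul_one, abs_of_nonneg h]
    · rw [abs_of_neg (not_le.1 h)]; ring
  set h : ℕ → unitInterval → ℝ := fun k u => sg (X (N k) u) * G k (X (N k) u) with hh
  have hhW : ∀ k u, |h k u| ≤ W k u := fun k u => by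
    rw [hh]
    simp only
    rw [abs_mul, hsg1, one_mul, abs_of_nonneg ((hWs k).nonneg u)]
  have hgm : ∀ k, Measurable fun r => sg r * G k r := fun k => hsgm.mul (hGm k)
  have hhm : ∀ k, Measurable (h k) := fun k => (hgm k).comp (hXm (N k))
  obtain ⟨φ, hφ, hφsum⟩ := exists_functional ψ hWs hhm hhW hsum
  have hlower : ∀ j, ε / 2 - |∫ u, X (N j) u| * (3 * ψ 1) ≤ φ (x (N j)) := by
    intro j
    have hsm := hφsum (x (N j))
    set a : ℕ → ℝ := fun k => ∫ u, X (N j) u * h k u with ha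
    have haj : ε / 2 ≤ a j := by
      refine (hs j).1.2.2.1.trans (le_of_eq ?_)
      refine integral_congr_ae (ae_of_all _ fun u => ?_)
      change |X (N j) u| * G j (X (N j) u) = X (N j) u * (sg (X (N j) u) * G j (X (N j) u))
      rw [← mul_assoc, hsgr]
    have hak : ∀ k, k ≠ j → |a k| ≤ |∫ u, X (N j) u| * ∫ u, W k u := by
      intro k hk
      -- This is where it matters that the k-th weight is a function of the k-th chosen variable
      -- only.
      have hi : IndepFun (X (N j)) (h k) volume :=
        (hind.indepFun (hNmono.injective.ne hk.symm)).comp measurable_id (hgm k)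
      rw [ha]
      simp only
      rw [hi.integral_fun_mul_eq_mul_integral (hXm _).aestronglyMeasurable
        (hhm k).aestronglyMeasurable, abs_mul]
      refine mul_le_mul_of_nonneg_left ?_ (abs_nonneg _)
      refine abs_integral_le_integral_abs.trans (integral_mono_of_nonneg
        (ae_of_all _ fun u => abs_nonneg _) (hWs k).integrable (ae_of_all _ (hhW k)))
    have hWsum : ∀ n, ∑ k ∈ Finset.range n, ∫ u, W k u ≤ 3 * ψ 1 := by
      intro n
      have := hsum n univ MeasurableSet.univ
      simpa using this
    have hWn : ∀ k, 0 ≤ ∫ u, W k u := fun k => integral_nonneg (hWs k).nonneg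
    have hWS : Summable fun k => ∫ u, W k u := summable_of_sum_range_le hWn hWsum
    have hsplit := hsm.summable.tsum_eq_add_tsum_ite j
    have hrest : |∑' k, ite (k = j) 0 (a k)| ≤ |∫ u, X (N j) u| * (3 * ψ 1) := by
      rw [← Real.norm_eq_abs]
      refine (tsum_of_norm_bounded (hWS.mul_left |∫ u, X (N j) u|).hasSum fun k => ?_).trans ?_
      · split_ifs with hk
        · rw [norm_zero]; exact mul_nonneg (abs_nonneg _) (hWn k)
        · exact hak k hk
      · rw [tsum_mul_left]
        exact mul_le_mul_of_nonneg_left (Real.tsum_le_of_sum_range_le hWn hWsum) (abs_nonneg _)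
    rw [← hsm.tsum_eq]
    change _ ≤ ∑' k, a k
    rw [hsplit]
    have := (abs_le.1 hrest).1
    linarith
  have hlim1 : Tendsto (fun j => φ (x (N j))) atTop (𝓝 0) := (hx φ hφ).comp hNmono.tendsto_atTop
  have hlim2 : Tendsto (fun j => ε / 2 - |∫ u, X (N j) u| * (3 * ψ 1)) atTop (𝓝 (ε / 2)) := by
    have := (hx.tendsto_integral.comp hNmono.tendsto_atTop).abs.mul_const (3 * ψ 1)
    have := this.const_sub (ε / 2)
    simpa using this
  have := le_of_tendsto_of_tendsto' hlim2 hlim1 hlower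
  linarith

/-! ### Subsequences with a common summable majorant -/

/-- By compactness of a product of copies of [0,∞], some subsequence converges coordinatewise to a
summable `a`. Uniform tails make the total excess over `a` tend to 0; taking it below 2^(-k) along a
further subsequence bounds the supremum by `a` plus the sum of all excesses. -/
lemma exists_subseq_iSup_summable {e : ℕ → ℕ → ℝ≥0∞} {B : ℕ → ℝ≥0∞} (hB : ∀ i, B i ≠ ∞)
    (heB : ∀ n i, e n i ≤ B i) {K : ℝ≥0∞} (hK : K ≠ ∞) (heK : ∀ n, ∑' i, e n i ≤ K)
    (htail : ∀ ε : ℝ, 0 < ε → ∃ I, ∀ n, ∑' i, e n (i + I) ≤ ENNReal.ofReal ε)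
    {c : ℕ → ℝ} (hc : Tendsto c atTop (𝓝 0)) :
    ∃ τ : ℕ → ℕ, StrictMono τ ∧ ∑' i, ⨆ k, e (τ k) i ≠ ∞ ∧ ∀ k, |c (τ k)| ≤ (1 / 2) ^ k := by
  obtain ⟨a, σ, hσ, ha⟩ := CompactSpace.tendsto_subseq e
  have hai : ∀ i, Tendsto (fun n => e (σ n) i) atTop (𝓝 (a i)) := fun i =>
    (tendsto_pi_nhds.1 ha) i
  have hafin : ∀ i, a i ≠ ∞ := fun i =>
    ne_top_of_le_ne_top (hB i) (le_of_tendsto' (hai i) fun n => heB _ i)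
  have hasum : ∑' i, a i ≤ K := by
    refine ENNReal.tsum_le_of_sum_range_le fun n => ?_
    refine le_of_tendsto' (tendsto_finsetSum (Finset.range n) fun i _ => hai i) fun j => ?_
    exact (ENNReal.sum_le_tsum _).trans (heK _)
  set b : ℕ → ℝ≥0∞ := fun n => ∑' i, (e (σ n) i - a i) with hb
  have hb0 : Tendsto b atTop (𝓝 0) := by
    rw [ENNReal.tendsto_nhds_zero]
    intro ε hε
    rcases eq_or_ne ε ∞ with rfl | hεt
    · exact Eventually.of_forall fun _ => le_top
    have hε2 : 0 < ε.toReal / 2 := half_pos (ENNReal.toReal_pos hε.ne' hεt)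
    obtain ⟨I, hI⟩ := htail (ε.toReal / 2) hε2
    have hfin : Tendsto (fun n => ∑ i ∈ Finset.range I, (e (σ n) i - a i)) atTop (𝓝 0) := by
      have := tendsto_finsetSum (Finset.range I) fun i _ =>
        ENNReal.Tendsto.sub (hai i) (tendsto_const_nhds (x := a i)) (Or.inr (hafin i))
      simpa using this
    filter_upwards [hfin.eventually (gt_mem_nhds (ENNReal.ofReal_pos.2 hε2))] with n hn
    rw [hb]
    simp only
    rw [← Summable.sum_add_tsum_nat_add' (f := fun i => e (σ n) i - a i) (k := I)
      ENNReal.summable]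
    calc _ ≤ ENNReal.ofReal (ε.toReal / 2) + ENNReal.ofReal (ε.toReal / 2) :=
          add_le_add hn.le ((ENNReal.tsum_le_tsum fun i => tsub_le_self).trans (hI _))
      _ = ε := by
          rw [← ENNReal.ofReal_add hε2.le hε2.le, add_halves, ENNReal.ofReal_toReal hεt]
  have hcσ : Tendsto (fun n => |c (σ n)|) atTop (𝓝 0) := by
    have := (hc.comp hσ.tendsto_atTop).abs
    simpa using this
  obtain ⟨ρ, hρ, hρk⟩ := extraction_forall_of_eventually
    (P := fun k n => b n < ENNReal.ofReal ((1 / 2) ^ k) ∧ |c (σ n)| < (1 / 2) ^ k) fun k =>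
      (hb0.eventually (gt_mem_nhds (ENNReal.ofReal_pos.2 (by positivity)))).and
        (hcσ.eventually (gt_mem_nhds (by positivity)))
  refine ⟨σ ∘ ρ, hσ.comp hρ, ?_, fun k => (hρk k).2.le⟩
  have h1 : ∀ i, ⨆ k, e ((σ ∘ ρ) k) i ≤ a i + ∑' k, (e (σ (ρ k)) i - a i) := fun i =>
    iSup_le fun k => (le_add_tsub).trans
      (add_le_add le_rfl (ENNReal.le_tsum (f := fun k => e (σ (ρ k)) i - a i) k))
  have h2 : ∑' i, ⨆ k, e ((σ ∘ ρ) k) i ≤ K + 2 := by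
    refine (ENNReal.tsum_le_tsum h1).trans ?_
    rw [ENNReal.tsum_add, ENNReal.tsum_comm]
    refine add_le_add hasum ((ENNReal.tsum_le_tsum fun k => (hρk k).1.le).trans ?_)
    rw [← ENNReal.ofReal_tsum_of_nonneg (fun _ => by positivity) summable_geometric_two,
      tsum_geometric_two]
    simp
  exact ne_top_of_le_ne_top (by simp [hK]) h2

/-! ### Truncation -/

/-- Truncation at the level `2 ^ J`. -/
noncomputable def truncAt (J : ℕ) (r : ℝ) : ℝ := if |r| ≤ 2 ^ J then r else 0

lemma measurable_truncAt (J : ℕ) : Measurable (truncAt J) :=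
  Measurable.ite (measurableSet_le measurable_id.abs measurable_const) measurable_id
    measurable_const

lemma abs_truncAt_le (J : ℕ) (r : ℝ) : |truncAt J r| ≤ 2 ^ J := by
  unfold truncAt; split_ifs with h
  · exact h
  · rw [abs_zero]; positivity

lemma abs_truncAt_succ_sub_le (J : ℕ) (r : ℝ) : |truncAt (J + 1) r - truncAt J r| ≤ 2 ^ (J + 1) := by
  have h2 : (2 : ℝ) ^ J ≤ 2 ^ (J + 1) := pow_le_pow_right₀ (by norm_num) (Nat.le_succ J)
  unfold truncAt; split_ifs with h h' h'
  · rw [sub_self, abs_zero]; positivity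
  · rw [sub_zero]; exact h
  · exact absurd (h'.trans h2) h
  · rw [sub_self, abs_zero]; positivity

lemma truncAt_succ_sub_ne_zero {J : ℕ} {r : ℝ} (h : truncAt (J + 1) r - truncAt J r ≠ 0) :
    2 ^ J < |r| := by
  by_contra! hc
  have h2 : (2 : ℝ) ^ J ≤ 2 ^ (J + 1) := pow_le_pow_right₀ (by norm_num) (Nat.le_succ J)
  apply h
  rw [truncAt, truncAt, if_pos hc, if_pos (hc.trans h2), sub_self]

lemma Psi.tendsto_zero (ψ : Psi) {t : ℕ → ℝ} (ht : ∀ n, t n ∈ Icc (0 : ℝ) 1)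
    (h : Tendsto t atTop (𝓝 0)) : Tendsto (fun n => ψ (t n)) atTop (𝓝 0) := by
  have h1 := (ψ.continuousOn 0 (by simp)).tendsto.comp
    (tendsto_nhdsWithin_iff.2 ⟨h, Eventually.of_forall ht⟩)
  rwa [ψ.map_zero] at h1

lemma tendsto_distrib {x : unitInterval → ℝ} (hx : Measurable x) {s : ℕ → ℝ}
    (hs : Tendsto s atTop atTop) : Tendsto (fun n => distrib x (s n)) atTop (𝓝 0) := by
  rw [Metric.tendsto_atTop]
  intro ε hε
  obtain ⟨r, -, hr⟩ := exists_distrib_le hx.aemeasurable (half_pos hε)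
  obtain ⟨n₀, hn₀⟩ := eventually_atTop.1 (hs.eventually_ge_atTop r)
  refine ⟨n₀, fun n hn => ?_⟩
  rw [Real.dist_eq, sub_zero, abs_of_nonneg (distrib_nonneg _ _)]
  have := distrib_anti x (hn₀ n hn)
  linarith

/-- Dominated convergence in the layer-cake formula, with the integrand of x itself as majorant;
continuity of ψ at 0 gives the pointwise limit. -/
lemma tendsto_lorentzENorm_sub_truncAt (ψ : Psi) {x : unitInterval → ℝ} (hx : Measurable x)
    (h : lorentzENorm ψ x < ∞) :
    Tendsto (fun J => lorentzENorm ψ fun u => x u - truncAt J (x u)) atTop (𝓝 0) := by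
  have hm : ∀ J, Measurable fun u => x u - truncAt J (x u) := fun J =>
    hx.sub ((measurable_truncAt J).comp hx)
  have hsub : ∀ J u, x u - truncAt J (x u) = if |x u| ≤ 2 ^ J then 0 else x u := by
    intro J u; unfold truncAt; split_ifs <;> simp
  have e : ∀ J, lorentzENorm ψ (fun u => x u - truncAt J (x u)) = ∫⁻ s in Ioi (0 : ℝ),
      ENNReal.ofReal (ψ (distrib (fun u => x u - truncAt J (x u)) s)) := fun J =>
    lorentzENorm_eq ψ (hm J).aemeasurable
  simp_rw [e]
  have h0 : (0 : ℝ≥0∞) = ∫⁻ _ in Ioi (0 : ℝ), 0 := by simp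
  rw [h0]
  refine tendsto_lintegral_of_dominated_convergence
    (fun s => ENNReal.ofReal (ψ (distrib x s))) (fun J =>
      (antitone_ofReal_psi_distrib ψ _).measurable) (fun J => ?_) ?_ ?_
  · filter_upwards [ae_restrict_mem measurableSet_Ioi] with s hs
    refine ENNReal.ofReal_le_ofReal (ψ.monotoneOn (distrib_mem _ _) (distrib_mem _ _)
      (measureReal_mono fun u hu => ?_))
    have hu' : s < |x u - truncAt J (x u)| := hu
    rw [hsub] at hu'
    split_ifs at hu'
    · rw [abs_zero] at hu'; exact absurd (lt_trans hs hu') (lt_irrefl _)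
    · exact hu'
  · rw [← lorentzENorm_eq ψ hx.aemeasurable]; exact h.ne
  · filter_upwards [ae_restrict_mem measurableSet_Ioi] with s hs
    rw [← ENNReal.ofReal_zero]
    refine ENNReal.tendsto_ofReal (ψ.tendsto_zero (fun J => distrib_mem _ _) ?_)
    refine squeeze_zero (fun J => distrib_nonneg _ _) (fun J => ?_)
      (tendsto_distrib hx (tendsto_pow_atTop_atTop_of_one_lt one_lt_two))
    refine measureReal_mono fun u hu => ?_
    have hu' : s < |x u - truncAt J (x u)| := hu
    rw [hsub] at hu'
    split_ifs at hu' with hc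
    · rw [abs_zero] at hu'; exact absurd (lt_trans hs hu') (lt_irrefl _)
    · exact not_le.1 hc

/-! ### Power growth of sums for sequences with a summable majorant -/

/-- The growth estimate for bounded independent variables, as a property of the exponent. -/
def HasPowerGrowth (ψ : Psi) (β C : ℝ) : Prop :=
  ∀ w : ℕ → unitInterval → ℝ, (∀ i, Measurable (w i)) →
    iIndepFun w volume → (∀ i a, |w i a| ≤ 1) → ∀ m : ℕ, 1 ≤ m → ∀ v : ℝ, 0 < v → v ≤ 1 →
    (∀ i < m, (volume : Measure unitInterval).real {a | w i a ≠ 0} ≤ v) →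
    lorentzENorm ψ (fun a => ∑ i ∈ Finset.range m, (w i a - ∫ b, w i b)) ≤
      ENNReal.ofReal (C * (m : ℝ) ^ β * ψ v)

/-- Rescales to the bound 1 and takes for v the largest support measure among the first m. If it is
0, the sum vanishes almost everywhere and must be treated apart, since the growth estimate needs v >
0. -/
lemma HasPowerGrowth.scaled {ψ : Psi} {β C : ℝ} (hg : HasPowerGrowth ψ β C) (hC : 0 ≤ C)
    {f : ℕ → unitInterval → ℝ} (hf : ∀ i, Measurable (f i)) (hind : iIndepFun f volume) {M : ℝ}
    (hM : 0 < M) (hfM : ∀ i a, |f i a| ≤ M) {m : ℕ} (hm : 1 ≤ m) {η : ℝ≥0∞}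
    (hη : ∀ i < m, ENNReal.ofReal
      (M * ψ ((volume : Measure unitInterval).real {a | f i a ≠ 0})) ≤ η) :
    lorentzENorm ψ (fun a => ∑ i ∈ Finset.range m, (f i a - ∫ b, f i b)) ≤
      ENNReal.ofReal ((m : ℝ) ^ β) * (ENNReal.ofReal C * η) := by
  set p : ℕ → ℝ := fun i => (volume : Measure unitInterval).real {a | f i a ≠ 0} with hp
  obtain ⟨k, hk, hmax⟩ := Finset.exists_max_image (Finset.range m) p
    ⟨0, Finset.mem_range.2 (by lia)⟩
  rcases eq_or_lt_of_le (measureReal_nonneg (μ := (volume : Measure unitInterval))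
    (s := {a | f k a ≠ 0})) with h0 | h0
  · have hz : ∀ i ∈ Finset.range m, f i =ᵐ[volume] 0 := by
      intro i hi
      have h1 : p i = 0 := le_antisymm ((hmax i hi).trans h0.ge) measureReal_nonneg
      rw [hp] at h1
      exact (measureReal_eq_zero_iff).1 h1
    have hS : (fun a => ∑ i ∈ Finset.range m, (f i a - ∫ b, f i b)) =ᵐ[volume] fun _ => 0 := by
      have hall : ∀ᵐ a, ∀ i ∈ Finset.range m, f i a = 0 := by
        rw [eventually_all_finset]
        exact fun i hi => hz i hi
      filter_upwards [hall] with a ha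
      refine Finset.sum_eq_zero fun i hi => ?_
      rw [ha i hi, integral_congr_ae (hz i hi)]
      simp
    rw [lorentzENorm_congr ψ hS, lorentzENorm_zero]
    exact zero_le
  · set w : ℕ → unitInterval → ℝ := fun i a => M⁻¹ * f i a with hw
    have hwm : ∀ i, Measurable (w i) := fun i => (hf i).const_mul _
    have hnz : ∀ i, {a | w i a ≠ 0} = {a | f i a ≠ 0} := fun i => by
      ext a; simp [hw, hM.ne']
    have h := hg w hwm (hind.comp (fun _ r => M⁻¹ * r) fun _ => measurable_id.const_mul _)
      (fun i a => by
        rw [hw]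
        simp only
        rw [abs_mul, abs_of_pos (inv_pos.2 hM), inv_mul_le_iff₀ hM, mul_one]
        exact hfM i a) m hm (p k) h0 measureReal_le_one (fun i hi => by
          rw [hnz]; exact hmax i (Finset.mem_range.2 hi))
    have e : (fun a => ∑ i ∈ Finset.range m, (f i a - ∫ b, f i b)) =
        fun a => M * ∑ i ∈ Finset.range m, (w i a - ∫ b, w i b) := by
      funext a
      rw [Finset.mul_sum]
      refine Finset.sum_congr rfl fun i _ => ?_
      simp only [hw]
      rw [integral_const_mul]
      field_simp
    rw [e]
    refine (lorentzENorm_smul_le ψ (measurable_sum_centered hwm m).aemeasurable M).trans ?_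
    rw [abs_of_pos hM]
    refine (mul_le_mul_right h _).trans ?_
    have hmb : 0 ≤ (m : ℝ) ^ β := by positivity
    rw [mul_comm C, mul_assoc, ENNReal.ofReal_mul hmb, ENNReal.ofReal_mul hC, mul_left_comm,
      mul_left_comm (ENNReal.ofReal M), ← ENNReal.ofReal_mul hM.le]
    gcongr
    exact hη k (Finset.mem_range.1 hk)

/-- Each variable is split by telescoping truncations. The centred i-th layer contributes m^β times
a multiple of η_i, the means add up to a constant, and the remainder above 2^J disappears as J grows
with m fixed. -/
lemma exists_sum_growth {ψ : Psi} {β C : ℝ} (hβ : 0 ≤ β) (hC : 0 ≤ C) (hg : HasPowerGrowth ψ β C)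
    {Y : ℕ → unitInterval → ℝ} (hY : ∀ k, Measurable (Y k)) (hind : iIndepFun Y volume)
    (hfin : ∀ k, lorentzENorm ψ (Y k) < ∞) {η : ℕ → ℝ≥0∞} (hη : ∑' i, η i ≠ ∞)
    (hYη : ∀ k i, ENNReal.ofReal (2 ^ i * ψ (distrib (Y k) (2 ^ i))) ≤ η i)
    (hmean : ∀ k, |∫ u, Y k u| ≤ (1 / 2) ^ k) :
    ∃ K : ℝ≥0∞, K ≠ ∞ ∧ ∀ m : ℕ, 1 ≤ m →
      lorentzENorm ψ (fun u => ∑ k ∈ Finset.range m, Y k u) ≤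
        ENNReal.ofReal ((m : ℝ) ^ β) * K := by
  have hp1 : 0 < ψ 1 := ψ.pos one_pos le_rfl
  set K : ℝ≥0∞ := ENNReal.ofReal C * ENNReal.ofReal (ψ 1) +
    ENNReal.ofReal C * (2 * ∑' i, η i) + ENNReal.ofReal (2 * ψ 1) with hK
  refine ⟨K, ?_, fun m hm => ?_⟩
  · rw [hK]
    exact ENNReal.add_ne_top.2 ⟨ENNReal.add_ne_top.2
      ⟨ENNReal.mul_ne_top ENNReal.ofReal_ne_top ENNReal.ofReal_ne_top,
        ENNReal.mul_ne_top ENNReal.ofReal_ne_top (ENNReal.mul_ne_top (by simp) hη)⟩,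
      ENNReal.ofReal_ne_top⟩
  have hm1 : (1 : ℝ) ≤ (m : ℝ) ^ β := Real.one_le_rpow (by exact_mod_cast hm) hβ
  set X : ℝ≥0∞ := ENNReal.ofReal ((m : ℝ) ^ β) with hX
  have hX1 : 1 ≤ X := by rw [hX, ENNReal.one_le_ofReal]; exact hm1
  have htm : ∀ J k, Measurable fun u => truncAt J (Y k u) := fun J k =>
    (measurable_truncAt J).comp (hY k)
  have hti : ∀ J k, Integrable fun u => truncAt J (Y k u) := fun J k =>
    integrable_of_abs_le (htm J k) fun u => abs_truncAt_le J _
  set R : ℕ → ℕ → unitInterval → ℝ := fun J k u => Y k u - truncAt J (Y k u) with hR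
  have hRm : ∀ J k, Measurable (R J k) := fun J k => (hY k).sub (htm J k)
  set T : ℕ → ℝ≥0∞ := fun J => ∑ k ∈ Finset.range m, lorentzENorm ψ (R J k) with hT
  have hT0 : Tendsto T atTop (𝓝 0) := by
    have := tendsto_finsetSum (Finset.range m) fun k _ =>
      tendsto_lorentzENorm_sub_truncAt ψ (hY k) (hfin k)
    simpa using this
  -- the pieces
  set P₀ : unitInterval → ℝ := fun u => ∑ k ∈ Finset.range m,
    (truncAt 0 (Y k u) - ∫ b, truncAt 0 (Y k b)) with hP₀
  set P : ℕ → unitInterval → ℝ := fun i u => ∑ k ∈ Finset.range m,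
    ((truncAt (i + 1) (Y k u) - truncAt i (Y k u)) -
      ∫ b, (truncAt (i + 1) (Y k b) - truncAt i (Y k b))) with hP
  have hP₀m : Measurable P₀ := measurable_sum_centered (htm 0) m
  have hPm : ∀ i, Measurable (P i) := fun i =>
    measurable_sum_centered (fun k => (htm (i + 1) k).sub (htm i k)) m
  have hbound0 : lorentzENorm ψ P₀ ≤ X * (ENNReal.ofReal C * ENNReal.ofReal (ψ 1)) := by
    refine hg.scaled hC (htm 0) (hind.comp (fun _ => truncAt 0) fun _ => measurable_truncAt 0)
      one_pos (fun k u => by simpa using abs_truncAt_le 0 (Y k u)) hm fun k _ => ?_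
    rw [one_mul]
    exact ENNReal.ofReal_le_ofReal (ψ.monotoneOn (measureReal_mem _) (by simp) measureReal_le_one)
  have hboundi : ∀ i, lorentzENorm ψ (P i) ≤ X * (ENNReal.ofReal C * (2 * η i)) := by
    intro i
    refine hg.scaled hC (fun k => (htm (i + 1) k).sub (htm i k))
      (hind.comp (fun _ r => truncAt (i + 1) r - truncAt i r) fun _ =>
        (measurable_truncAt _).sub (measurable_truncAt _))
      (M := 2 ^ (i + 1)) (by positivity) (fun k u => abs_truncAt_succ_sub_le i (Y k u)) hm
      fun k _ => ?_
    have h1 : ψ ((volume : Measure unitInterval).real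
        {a | truncAt (i + 1) (Y k a) - truncAt i (Y k a) ≠ 0}) ≤ ψ (distrib (Y k) (2 ^ i)) :=
      ψ.monotoneOn (measureReal_mem _) (distrib_mem _ _)
        (measureReal_mono fun a ha => truncAt_succ_sub_ne_zero ha)
    calc _ ≤ ENNReal.ofReal (2 * (2 ^ i * ψ (distrib (Y k) (2 ^ i)))) := by
          refine ENNReal.ofReal_le_ofReal ?_
          have := mul_le_mul_of_nonneg_left h1 (show (0 : ℝ) ≤ 2 ^ (i + 1) by positivity)
          refine this.trans (le_of_eq ?_)
          ring
      _ ≤ 2 * η i := by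
          rw [ENNReal.ofReal_mul (by norm_num)]
          simpa using mul_le_mul_right (hYη k i) 2
  have hmeanJ : ∀ J, lorentzENorm ψ (fun _ => ∑ k ∈ Finset.range m, ∫ b, truncAt J (Y k b)) ≤
      ENNReal.ofReal (2 * ψ 1) + T J := by
    intro J
    refine (lorentzENorm_const_le ψ _).trans ?_
    have hRfin : ∀ k, lorentzENorm ψ (R J k) < ∞ := by
      intro k
      refine (lorentzENorm_mono ψ (hRm J k) (hY k) fun s hs => measureReal_mono fun u hu => ?_).trans_lt
        (hfin k)
      have hu' : s < |Y k u - truncAt J (Y k u)| := hu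
      unfold truncAt at hu'
      split_ifs at hu'
      · rw [sub_self, abs_zero] at hu'; exact absurd (hs.trans hu') (lt_irrefl _)
      · rwa [sub_zero] at hu'
    have hYi : ∀ k, Integrable (Y k) := fun k => integrable_of_lorentzENorm_lt_top ψ (hY k) (hfin k)
    -- Only the means of the full variables are known to be small; truncated means are recovered
    -- from them up to the remainder, which is the extra T J.
    have hval : ∀ k, ∫ b, truncAt J (Y k b) = (∫ b, Y k b) - ∫ b, R J k b := by
      intro k
      rw [hR]
      simp only
      rw [integral_sub (hYi k) (hti J k)]
      ring
    have hk : ∀ k ∈ Finset.range m, |∫ b, truncAt J (Y k b)| * ψ 1 ≤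
        (1 / 2) ^ k * ψ 1 + (lorentzENorm ψ (R J k)).toReal := by
      intro k _
      have h1 := abs_integral_mul_le ψ (hRm J k) (hRfin k)
      have h2 : |∫ b, truncAt J (Y k b)| ≤ (1 / 2) ^ k + |∫ b, R J k b| := by
        rw [hval]
        have := abs_sub (∫ b, Y k b) (∫ b, R J k b)
        linarith [hmean k]
      have h3 := mul_le_mul_of_nonneg_right h2 hp1.le
      rw [add_mul] at h3
      linarith
    have hTr : T J = ENNReal.ofReal (∑ k ∈ Finset.range m, (lorentzENorm ψ (R J k)).toReal) := by
      rw [ENNReal.ofReal_sum_of_nonneg fun k _ => ENNReal.toReal_nonneg]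
      exact Finset.sum_congr rfl fun k _ => (ENNReal.ofReal_toReal (hRfin k).ne).symm
    rw [hTr, ← ENNReal.ofReal_add (by positivity)
      (Finset.sum_nonneg fun k _ => ENNReal.toReal_nonneg)]
    refine ENNReal.ofReal_le_ofReal ?_
    calc |∑ k ∈ Finset.range m, ∫ b, truncAt J (Y k b)| * ψ 1
        ≤ (∑ k ∈ Finset.range m, |∫ b, truncAt J (Y k b)|) * ψ 1 :=
          mul_le_mul_of_nonneg_right (Finset.abs_sum_le_sum_abs _ _) hp1.le
      _ ≤ ∑ k ∈ Finset.range m, ((1 / 2) ^ k * ψ 1 + (lorentzENorm ψ (R J k)).toReal) := by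
          rw [Finset.sum_mul]; exact Finset.sum_le_sum hk
      _ ≤ 2 * ψ 1 + ∑ k ∈ Finset.range m, (lorentzENorm ψ (R J k)).toReal := by
          rw [Finset.sum_add_distrib, ← Finset.sum_mul]
          have := mul_le_mul_of_nonneg_right (sum_half_pow_le m) hp1.le
          linarith
  have htotal : ∀ J, lorentzENorm ψ (fun u => ∑ k ∈ Finset.range m, Y k u) ≤
      X * K + 2 * T J := by
    intro J
    have hdec : (fun u => ∑ k ∈ Finset.range m, Y k u) = fun u =>
        (P₀ u + ∑ i ∈ Finset.range J, P i u) +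
          ((∑ k ∈ Finset.range m, ∫ b, truncAt J (Y k b)) + ∑ k ∈ Finset.range m, R J k u) := by
      funext u
      have h1 : ∑ i ∈ Finset.range J, P i u = ∑ k ∈ Finset.range m,
          ((truncAt J (Y k u) - truncAt 0 (Y k u)) -
            ((∫ b, truncAt J (Y k b)) - ∫ b, truncAt 0 (Y k b))) := by
        rw [hP]
        simp only
        rw [Finset.sum_comm]
        refine Finset.sum_congr rfl fun k _ => ?_
        rw [Finset.sum_sub_distrib, Finset.sum_range_sub (fun i => truncAt i (Y k u))]
        congr 1
        rw [← Finset.sum_range_sub (fun i => ∫ b, truncAt i (Y k b))]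
        exact Finset.sum_congr rfl fun i _ => integral_sub (hti _ _) (hti _ _)
      rw [h1, hP₀, hR]
      simp only
      rw [← Finset.sum_add_distrib, ← Finset.sum_add_distrib, ← Finset.sum_add_distrib]
      exact Finset.sum_congr rfl fun k _ => by ring
    rw [hdec]
    have hsPm : Measurable fun u => ∑ i ∈ Finset.range J, P i u :=
      Finset.measurable_fun_sum _ fun i _ => hPm i
    have hsRm : Measurable fun u => ∑ k ∈ Finset.range m, R J k u :=
      Finset.measurable_fun_sum _ fun k _ => hRm J k
    have b1 : lorentzENorm ψ (fun u => P₀ u + ∑ i ∈ Finset.range J, P i u) ≤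
        X * (ENNReal.ofReal C * ENNReal.ofReal (ψ 1)) +
          X * (ENNReal.ofReal C * (2 * ∑' i, η i)) := by
      refine (lorentzENorm_add_le ψ hP₀m hsPm).trans (add_le_add hbound0 ?_)
      refine (lorentzENorm_sum_le ψ _ fun i _ => hPm i).trans
        ((Finset.sum_le_sum fun i _ => hboundi i).trans ?_)
      rw [← Finset.mul_sum, ← Finset.mul_sum, ← Finset.mul_sum]
      gcongr
      exact ENNReal.sum_le_tsum _
    have b2 : lorentzENorm ψ (fun u => (∑ k ∈ Finset.range m, ∫ b, truncAt J (Y k b)) +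
        ∑ k ∈ Finset.range m, R J k u) ≤ (ENNReal.ofReal (2 * ψ 1) + T J) + T J :=
      (lorentzENorm_add_le ψ measurable_const hsRm).trans
        (add_le_add (hmeanJ J) (lorentzENorm_sum_le ψ _ fun k _ => hRm J k))
    refine (lorentzENorm_add_le ψ (hP₀m.add hsPm) (measurable_const.add hsRm)).trans
      ((add_le_add b1 b2).trans ?_)
    have b3 : ENNReal.ofReal (2 * ψ 1) ≤ X * ENNReal.ofReal (2 * ψ 1) := by
      simpa using mul_le_mul_left hX1 (ENNReal.ofReal (2 * ψ 1))
    calc _ ≤ X * (ENNReal.ofReal C * ENNReal.ofReal (ψ 1)) +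
          X * (ENNReal.ofReal C * (2 * ∑' i, η i)) +
            (X * ENNReal.ofReal (2 * ψ 1) + T J + T J) := by gcongr
      _ = X * K + 2 * T J := by rw [hK]; ring
  have hlim : Tendsto (fun J => X * K + 2 * T J) atTop (𝓝 (X * K)) := by
    have := (ENNReal.Tendsto.const_mul (a := 2) hT0 (Or.inr (by simp))).const_add (X * K)
    simpa using this
  exact ge_of_tendsto' hlim htotal

/-! ### Sufficiency -/

/-- Since t^α is at most a multiple of ψ(t) and α < 1, the factor t^(1-α) makes t negligible against
ψ(t) near 0. -/
lemma Psi.exists_scale (ψ : Psi) {α A : ℝ} (hα1 : α < 1) (hA : 1 ≤ A)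
    (hup : ∀ u t : ℝ, 0 < u → u ≤ t → t ≤ 1 → ψ t ≤ A * (t / u) ^ α * ψ u) (H ε : ℝ)
    (hε : 0 < ε) : ∃ τ : ℝ, 0 < τ ∧ ∀ t, 0 ≤ t → t ≤ τ → t ≤ 1 → H * t ≤ ε * ψ t := by
  have hp1 : 0 < ψ 1 := ψ.pos one_pos le_rfl
  set κ : ℝ := 1 - α with hκ
  have hκ0 : 0 < κ := by rw [hκ]; linarith
  set c : ℝ := ε * ψ 1 / (A * (|H| + 1)) with hc
  have hH : 0 < |H| + 1 := by positivity
  have hc0 : 0 < c := by positivity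
  refine ⟨c ^ (1 / κ), by positivity, fun t ht0 htτ ht1 => ?_⟩
  rcases eq_or_lt_of_le ht0 with h0 | h0
  · rw [← h0, ψ.map_zero]; simp
  have h1 := hup t 1 h0 ht1 le_rfl
  have h2 : t ^ κ ≤ c := by
    have := Real.rpow_le_rpow ht0 htτ hκ0.le
    rwa [← Real.rpow_mul hc0.le, one_div_mul_cancel hκ0.ne', Real.rpow_one] at this
  have hta : 0 < t ^ α := by positivity
  have h3 : ψ 1 * t ^ α ≤ A * ψ t := by
    rw [one_div, Real.inv_rpow ht0] at h1
    have := mul_le_mul_of_nonneg_right h1 hta.le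
    refine this.trans (le_of_eq ?_)
    field_simp
  have h4 : t = t ^ κ * t ^ α := by
    rw [← Real.rpow_add h0, hκ, sub_add_cancel, Real.rpow_one]
  have h5 : (|H| + 1) * c * A = ε * ψ 1 := by
    rw [hc]; field_simp
  have h6 : (|H| + 1) * t * A ≤ ε * ψ t * A := by
    calc (|H| + 1) * t * A = (|H| + 1) * (t ^ κ * t ^ α) * A := by rw [← h4]
      _ = (|H| + 1) * t ^ κ * A * t ^ α := by ring
      _ ≤ (|H| + 1) * c * A * t ^ α := by gcongr
      _ = ε * (ψ 1 * t ^ α) := by rw [h5]; ring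
      _ ≤ ε * (A * ψ t) := by gcongr
      _ = ε * ψ t * A := by ring
  have h7 := le_of_mul_le_mul_right h6 (by linarith)
  have h8 : H * t ≤ (|H| + 1) * t := by
    have := le_abs_self H
    nlinarith
  linarith

theorem GammaInd_ne_of_limsup (ψ : Psi) {k l : ℕ} (hk : 2 ≤ k) (hl : 2 ≤ l)
    (h1 : limsup (fun u : ℝ => ψ (k * u) / ψ u) (𝓝[>] 0) < k)
    (h2 : limsup (fun u : ℝ => ψ (u ^ l) / ψ u) (𝓝[>] 0) < 1) : GammaInd ψ ≠ {1} := by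
  obtain ⟨α, A, hα0, hα1, hA, hup⟩ := ψ.exists_upper_index hk h1
  obtain ⟨δ, B, hδ, -, hlog⟩ := ψ.exists_log_index hl h2
  obtain ⟨β, C, hβ0, hβ1, hC, hg⟩ := exists_lorentzENorm_sum_le ψ hα0 hα1 hδ hA hup hlog
  -- Growth of order m^β of the sums is the p-BS property for p = 1/β.
  have hmem : 1 / β ∈ GammaInd ψ := by
    refine ⟨(one_le_div hβ0).2 hβ1.le, fun x hx hind => ?_⟩
    obtain ⟨C₀, hC₀⟩ := hx.bounded
    set M : ℝ := max C₀ 0 with hM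
    have hM0 : 0 ≤ M := le_max_right _ _
    set X : ℕ → unitInterval → ℝ := fun n =>
      ((x n : unitInterval →ₘ[volume] ℝ) : unitInterval → ℝ) with hX
    have hXm : ∀ n, Measurable (X n) := fun n => measurable_coe (x n)
    have hXM : ∀ n, lorentzENorm ψ (X n) ≤ ENNReal.ofReal M := fun n =>
      (lorentzNorm_le_iff _ hM0).1 ((hC₀ n).trans (le_max_left _ _))
    obtain ⟨τ, hτ, hsum, hmean⟩ := exists_subseq_iSup_summable
      (e := fun n i => ENNReal.ofReal (2 ^ i * ψ (distrib (X n) (2 ^ i))))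
      (B := fun i => ENNReal.ofReal (2 ^ i * ψ 1)) (fun i => ENNReal.ofReal_ne_top)
      (fun n i => ENNReal.ofReal_le_ofReal (mul_le_mul_of_nonneg_left
        (ψ.monotoneOn (distrib_mem _ _) (by simp) (distrib_le_one _ _)) (by positivity)))
      (K := 2 * ENNReal.ofReal M) (ENNReal.mul_ne_top (by simp) ENNReal.ofReal_ne_top)
      (fun n => (dyadicTail_le ψ (hXm n) 0).trans (mul_le_mul_right (hXM n) 2))
      (fun ε hε => hx.uniform_tail (ψ.exists_scale hα1 hA hup) hind hε) hx.tendsto_integral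
    refine ⟨τ, hτ, ⟨C₀, fun n => hC₀ _⟩, fun σ hσ => ?_⟩
    have hinj : Function.Injective (τ ∘ σ) := (hτ.comp hσ).injective
    -- The majorant is a supremum over the subsequence and k ≤ σ k, so both hypotheses survive
    -- passing to any further subsequence.
    obtain ⟨K, hK, hKm⟩ := exists_sum_growth hβ0.le hC hg (Y := fun k => X (τ (σ k)))
      (fun k => hXm _) (hind.precomp hinj)
      (fun k => (hXM _).trans_lt ENNReal.ofReal_lt_top) hsum
      (fun k i => le_iSup (fun n => ENNReal.ofReal (2 ^ i * ψ (distrib (X (τ n)) (2 ^ i)))) (σ k))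
      (fun k => (hmean (σ k)).trans (pow_le_pow_of_le_one (by norm_num) (by norm_num)
        (hσ.le_apply)))
    refine ⟨K.toReal, fun m hm => ?_⟩
    have hm0 : (0 : ℝ) < m := by exact_mod_cast hm
    have hmb : 0 ≤ (m : ℝ) ^ β := by positivity
    have h3 : lorentzNorm ψ (∑ k ∈ Finset.range m, (x ∘ τ) (σ k)) ≤ (m : ℝ) ^ β * K.toReal := by
      rw [lorentzNorm_le_iff _ (mul_nonneg hmb ENNReal.toReal_nonneg), ENNReal.ofReal_mul hmb,
        ENNReal.ofReal_toReal hK, lorentzENorm_congr ψ (coe_sum_ae _ _)]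
      exact hKm m hm
    rw [one_div_one_div, Real.rpow_neg hm0.le, inv_mul_le_iff₀ (by positivity)]
    exact h3
  intro heq
  rw [heq, mem_singleton_iff, div_eq_one_iff_eq hβ0.ne'] at hmem
  exact absurd hmem.symm hβ1.ne

/-! ### Independent uniform variables on `[0,1]` -/

/-- The infinite product of Lebesgue measures is the image of Lebesgue measure under a measurable
map; the coordinates of that map are the required variables. -/
lemma exists_iid_uniform : ∃ V : ℕ → unitInterval → unitInterval, (∀ n, Measurable (V n)) ∧
    iIndepFun V volume ∧ ∀ n, MeasurePreserving (V n) volume volume := by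
  obtain ⟨F, hF, hmap⟩ := (Measure.infinitePi
    fun _ : ℕ => (volume : Measure unitInterval)).exists_measurable_map_eq
  have hm : ∀ n, Measurable fun a => F a n := fun n => (measurable_pi_apply n).comp hF
  have hmap' : ∀ n, (volume : Measure unitInterval).map (fun a => F a n) = volume := by
    intro n
    have h : (fun a => F a n) = (fun f : ℕ → unitInterval => f n) ∘ F := rfl
    rw [h, ← Measure.map_map (measurable_pi_apply n) hF, hmap]
    exact Measure.infinitePi_map_eval _ n
  refine ⟨fun n a => F a n, hm, ?_, fun n => ⟨hm n, hmap' n⟩⟩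
  rw [iIndepFun_iff_map_fun_eq_infinitePi_map hm]
  simp_rw [hmap']
  exact hmap

lemma distrib_comp {x : unitInterval → ℝ} (hx : Measurable x) {V : unitInterval → unitInterval}
    (hV : MeasurePreserving V volume volume) : distrib (fun a => x (V a)) = distrib x := by
  funext s
  have hs : MeasurableSet {u | s < |x u|} := measurableSet_lt measurable_const (by fun_prop)
  exact hV.measureReal_preimage hs.nullMeasurableSet

lemma lorentzENorm_comp (ψ : Psi) {x : unitInterval → ℝ} (hx : Measurable x)
    {V : unitInterval → unitInterval} (hV : MeasurePreserving V volume volume) :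
    lorentzENorm ψ (fun a => x (V a)) = lorentzENorm ψ x := by
  have hm : Measurable fun a => x (V a) := hx.comp hV.measurable
  rw [lorentzENorm_eq ψ hm.aemeasurable, lorentzENorm_eq ψ hx.aemeasurable, distrib_comp hx hV]

lemma integral_comp_eq {x : unitInterval → ℝ} (hx : Measurable x) {V : unitInterval → unitInterval}
    (hV : MeasurePreserving V volume volume) : ∫ a, x (V a) = ∫ a, x a := by
  have h := integral_map (μ := (volume : Measure unitInterval)) (f := x) hV.measurable.aemeasurable hx.aestronglyMeasurable
  rw [hV.map_eq] at h
  exact h.symm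

/-! ### Cesàro means and weak convergence -/

/-- A law of large numbers in norm, valid for every ψ. The event that the sum exceeds mε' has
exponentially small measure, so ψ of it tends to 0 and absorbs the trivial bound 2m. -/
lemma eventually_lorentzENorm_sum_le (ψ : Psi) {w : ℕ → unitInterval → ℝ}
    (hw : ∀ i, Measurable (w i)) (hind : iIndepFun w volume) (h1 : ∀ i a, |w i a| ≤ 1) {ε : ℝ}
    (hε : 0 < ε) : ∀ᶠ m : ℕ in atTop,
      lorentzENorm ψ (fun a => ∑ i ∈ Finset.range m, (w i a - ∫ b, w i b)) ≤
        ENNReal.ofReal (m * ε) := by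
  have hp1 : 0 < ψ 1 := ψ.pos one_pos le_rfl
  set ε' : ℝ := min 1 (ε / (4 * ψ 1)) with hε'
  have hε'0 : 0 < ε' := lt_min one_pos (by positivity)
  have hd : ∀ m : ℕ, distrib (fun a => ∑ i ∈ Finset.range m, (w i a - ∫ b, w i b)) (m * ε') ≤
      2 * Real.exp (-(ε' ^ 2 / 4)) ^ m := by
    intro m
    refine (distrib_sum_centered_le hw hind h1 (v := 1) (m := m) (fun i _ => measureReal_le_one)
      (t := ε' / 2) (by positivity) (by linarith [min_le_left 1 (ε / (4 * ψ 1))]) _).trans ?_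
    rw [← Real.exp_nat_mul]
    refine le_of_eq ?_
    congr 2
    ring
  have hexp : Tendsto (fun m : ℕ => 2 * Real.exp (-(ε' ^ 2 / 4)) ^ m) atTop (𝓝 0) := by
    have := (tendsto_pow_atTop_nhds_zero_of_lt_one (Real.exp_pos (-(ε' ^ 2 / 4))).le
      (Real.exp_lt_one_iff.2 (neg_neg_of_pos (by positivity)))).const_mul 2
    simpa using this
  have hψd : Tendsto (fun m : ℕ =>
      ψ (distrib (fun a => ∑ i ∈ Finset.range m, (w i a - ∫ b, w i b)) (m * ε'))) atTop (𝓝 0) :=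
    ψ.tendsto_zero (fun m => distrib_mem _ _)
      (squeeze_zero (fun m => distrib_nonneg _ _) hd hexp)
  filter_upwards [hψd.eventually (gt_mem_nhds (show (0 : ℝ) < ε / 4 by positivity))] with m hm
  have hm0 : (0 : ℝ) ≤ m := Nat.cast_nonneg m
  refine (lorentzENorm_le_of_bounded ψ (measurable_sum_centered hw m)
    (mul_nonneg hm0 hε'0.le) (mul_nonneg hm0 hε'0.le) (show (0 : ℝ) ≤ 2 * m by positivity)
    (ae_of_all _ fun a => abs_sum_centered_le hw h1 m a)).trans (ENNReal.ofReal_le_ofReal ?_)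
  have e1 : ε' * ψ 1 ≤ ε / 4 := by
    have := mul_le_mul_of_nonneg_right (min_le_right 1 (ε / (4 * ψ 1))) hp1.le
    refine this.trans (le_of_eq ?_)
    field_simp
  set d := ψ (distrib (fun a => ∑ i ∈ Finset.range m, (w i a - ∫ b, w i b)) (m * ε'))
  have e2 : ε' * d ≤ ε / 4 := by
    have hd0 : 0 ≤ d := ψ.nonneg (distrib_mem _ _)
    have := mul_le_mul_of_nonneg_right (min_le_left 1 (ε / (4 * ψ 1))) hd0
    linarith
  have e3 : m * (ε' * ψ 1) + m * (ε' * d) + m * (2 * d) ≤ m * (ε / 4) + m * (ε / 4) + m * (ε / 2) := by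
    gcongr
    linarith
  linarith

/-- Centred copies, along independent uniform variables, of a function that can be approximated
in norm by bounded functions form a weakly null sequence. -/
lemma weaklyNull_of_iid {ψ : Psi} {V : ℕ → unitInterval → unitInterval}
    (hV : iIndepFun V volume) (hVp : ∀ n, MeasurePreserving (V n) volume volume)
    {g : unitInterval → ℝ} (hg : Measurable g) (hgfin : lorentzENorm ψ g < ∞)
    (happ : ∀ ε : ℝ, 0 < ε → ∃ (f : unitInterval → ℝ) (M : ℝ), Measurable f ∧ 0 < M ∧
      (∀ a, |f a| ≤ M) ∧ lorentzENorm ψ (fun a => g a - f a) ≤ ENNReal.ofReal ε)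
    {x : ℕ → Lorentz ψ} (hx : ∀ n, ((x n : unitInterval →ₘ[volume] ℝ) : unitInterval → ℝ) =ᵐ[volume]
      fun a => g (V n a) - ∫ b, g b) : WeaklyNull ψ x := by
  have hp1 : 0 < ψ 1 := ψ.pos one_pos le_rfl
  have hgi := integrable_of_lorentzENorm_lt_top ψ hg hgfin
  -- Cesàro means of every subsequence are small in norm: the bounded part by the law of large
  -- numbers, the approximation error and its mean by the triangle inequality.
  have hces : ∀ σ : ℕ → ℕ, StrictMono σ → ∀ ε : ℝ, 0 < ε →
      ∀ᶠ m : ℕ in atTop, lorentzNorm ψ (∑ i ∈ Finset.range m, x (σ i)) ≤ m * ε := by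
    intro σ hσ ε hε
    obtain ⟨f, M, hf, hM, hfM, hfg⟩ := happ (ε / 3) (by positivity)
    have hgf : Measurable fun a => g a - f a := hg.sub hf
    have hfi := integrable_of_abs_le hf hfM
    set w : ℕ → unitInterval → ℝ := fun i a => M⁻¹ * f (V (σ i) a) with hw
    have hwm : ∀ i, Measurable (w i) := fun i => (hf.comp (hVp _).measurable).const_mul _
    have hwi : iIndepFun w volume :=
      (hV.precomp hσ.injective).comp (fun _ r => M⁻¹ * f r) fun _ => hf.const_mul _
    filter_upwards [eventually_lorentzENorm_sum_le ψ hwm hwi (fun i a => by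
      rw [hw]
      simp only
      rw [abs_mul, abs_of_pos (inv_pos.2 hM), inv_mul_le_iff₀ hM, mul_one]
      exact hfM _) (show 0 < M⁻¹ * (ε / 3) by positivity)] with m hm
    have hm0 : (0 : ℝ) ≤ m := Nat.cast_nonneg m
    rw [lorentzNorm_le_iff _ (by positivity), lorentzENorm_congr ψ (coe_sum_ae _ _)]
    have hdec : (fun u => ∑ i ∈ Finset.range m,
        ((x (σ i) : unitInterval →ₘ[volume] ℝ) : unitInterval → ℝ) u) =ᵐ[volume] fun u =>
        M * ∑ i ∈ Finset.range m, (w i u - ∫ b, w i b) +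
          (∑ i ∈ Finset.range m, (g (V (σ i) u) - f (V (σ i) u)) +
            m * -(∫ b, (g b - f b))) := by
      have hall : ∀ᵐ u, ∀ n, ((x n : unitInterval →ₘ[volume] ℝ) : unitInterval → ℝ) u =
          g (V n u) - ∫ b, g b := ae_all_iff.2 hx
      filter_upwards [hall] with u hu
      have e1 : ∀ i, ∫ b, w i b = M⁻¹ * ∫ b, f b := fun i => by
        rw [hw]
        simp only
        rw [integral_const_mul, integral_comp_eq hf (hVp _)]
      have e2 : (m : ℝ) * -(∫ b, (g b - f b)) =
          ∑ _i ∈ Finset.range m, -((∫ b, g b) - ∫ b, f b) := by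
        rw [integral_sub hgi hfi, Finset.sum_const, Finset.card_range, nsmul_eq_mul]
      rw [Finset.mul_sum, e2, ← Finset.sum_add_distrib, ← Finset.sum_add_distrib]
      refine Finset.sum_congr rfl fun i _ => ?_
      rw [hu, e1, hw]
      field_simp
      ring
    rw [lorentzENorm_congr ψ hdec]
    have hm1 : Measurable fun u => M * ∑ i ∈ Finset.range m, (w i u - ∫ b, w i b) :=
      (measurable_sum_centered hwm m).const_mul _
    have hVm : ∀ i, Measurable fun u => g (V (σ i) u) - f (V (σ i) u) := fun i =>
      hgf.comp (hVp _).measurable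
    have hm2 : Measurable fun u => ∑ i ∈ Finset.range m, (g (V (σ i) u) - f (V (σ i) u)) :=
      Finset.measurable_fun_sum _ fun i _ => hVm i
    have b1 : lorentzENorm ψ (fun u => M * ∑ i ∈ Finset.range m, (w i u - ∫ b, w i b)) ≤
        ENNReal.ofReal (m * (ε / 3)) := by
      refine (lorentzENorm_smul_le ψ (measurable_sum_centered hwm m).aemeasurable M).trans ?_
      refine (mul_le_mul_right hm _).trans (le_of_eq ?_)
      rw [← ENNReal.ofReal_mul (abs_nonneg _), abs_of_pos hM]
      congr 1
      field_simp
    have b2 : lorentzENorm ψ (fun u => ∑ i ∈ Finset.range m, (g (V (σ i) u) - f (V (σ i) u))) ≤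
        ENNReal.ofReal (m * (ε / 3)) := by
      refine (lorentzENorm_sum_le ψ _ fun i _ => hVm i).trans ?_
      calc ∑ i ∈ Finset.range m, lorentzENorm ψ (fun u => g (V (σ i) u) - f (V (σ i) u))
          ≤ ∑ _i ∈ Finset.range m, ENNReal.ofReal (ε / 3) := Finset.sum_le_sum fun i _ => by
            rw [lorentzENorm_comp ψ hgf (hVp _)]; exact hfg
        _ = ENNReal.ofReal (m * (ε / 3)) := by
            rw [Finset.sum_const, Finset.card_range, nsmul_eq_mul, ENNReal.ofReal_mul hm0,
              ENNReal.ofReal_natCast]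
    have b3 : lorentzENorm ψ (fun _ => (m : ℝ) * -(∫ b, (g b - f b))) ≤
        ENNReal.ofReal (m * (ε / 3)) := by
      refine (lorentzENorm_const_le ψ _).trans (ENNReal.ofReal_le_ofReal ?_)
      rw [abs_mul, abs_neg, abs_of_nonneg hm0, mul_assoc]
      refine mul_le_mul_of_nonneg_left ?_ hm0
      refine (abs_integral_mul_le ψ hgf (hfg.trans_lt ENNReal.ofReal_lt_top)).trans ?_
      exact ENNReal.toReal_le_of_le_ofReal (by positivity) hfg
    refine (lorentzENorm_add_le ψ hm1 (hm2.add measurable_const)).trans ?_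
    refine (add_le_add b1 ((lorentzENorm_add_le ψ hm2 measurable_const).trans
      (add_le_add b2 b3))).trans (le_of_eq ?_)
    rw [← ENNReal.ofReal_add (by positivity) (by positivity),
      ← ENNReal.ofReal_add (by positivity) (by positivity)]
    congr 1
    ring
  have hone : ∀ φ : Lorentz ψ →ₗ[ℝ] ℝ, (∃ C : ℝ, ∀ y, |φ y| ≤ C * lorentzNorm ψ y) →
      ∀ ε : ℝ, 0 < ε → ∀ᶠ n in atTop, φ (x n) < ε := by
    rintro φ ⟨C, hC⟩ ε hε
    by_contra hcon
    -- If φ were at least ε along a subsequence, it would be so on its Cesàro means, whose norms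
    -- tend to 0.
    obtain ⟨σ, hσ, hσε⟩ := extraction_of_frequently_atTop (not_eventually.1 hcon)
    set D : ℝ := max C 0 + 1 with hD
    have hD0 : 0 < D := by have := le_max_right C 0; linarith
    obtain ⟨m, hm, hm1⟩ := ((hces σ hσ (ε / (2 * D)) (by positivity)).and
      (eventually_ge_atTop 1)).exists
    have hm0 : (0 : ℝ) < m := by exact_mod_cast hm1
    have h1 : m * ε ≤ φ (∑ i ∈ Finset.range m, x (σ i)) := by
      rw [map_sum]
      calc (m : ℝ) * ε = ∑ _i ∈ Finset.range m, ε := by simp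
        _ ≤ _ := Finset.sum_le_sum fun i _ => not_lt.1 (hσε i)
    have h2 : φ (∑ i ∈ Finset.range m, x (σ i)) ≤ D * (m * (ε / (2 * D))) := by
      refine (le_abs_self _).trans ((hC _).trans ?_)
      have hCD : C ≤ D := by have := le_max_left C 0; linarith
      exact mul_le_mul hCD hm (lorentzNorm_nonneg _) hD0.le
    have h3 : D * (m * (ε / (2 * D))) = m * ε / 2 := by field_simp
    have := mul_pos hm0 hε
    linarith
  intro φ hφ
  rw [Metric.tendsto_nhds]
  intro ε hε
  filter_upwards [hone φ hφ ε hε, hone (-φ) (by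
    obtain ⟨C, hC⟩ := hφ
    exact ⟨C, fun y => by simpa using hC y⟩) ε hε] with n h1 h2
  rw [Real.dist_eq, sub_zero, abs_lt]
  rw [LinearMap.neg_apply] at h2
  exact ⟨by linarith, h1⟩

/-! ### Series of indicator functions -/

section Series

variable {A : ℕ → Set unitInterval} {c : ℕ → ℝ}

/-- The series `∑ c_j 1_{A_j}` with values in `[0,∞]`. -/
noncomputable def indSeries (A : ℕ → Set unitInterval) (c : ℕ → ℝ) (a : unitInterval) : ℝ≥0∞ :=
  ∑' j, (A j).indicator (fun _ => ENNReal.ofReal (c j)) a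

lemma measurable_indSeries (hA : ∀ j, MeasurableSet (A j)) : Measurable (indSeries A c) :=
  Measurable.tsum fun j => measurable_const.indicator (hA j)

/-- A countable triangle inequality: duality reduces it to Tonelli against one weight, so
completeness is not needed. -/
lemma lorentzENorm_le_of_le_indSeries (ψ : Psi) (hA : ∀ j, MeasurableSet (A j))
    (hc : ∀ j, 0 ≤ c j) {f : unitInterval → ℝ} (hf : Measurable f)
    (h : ∀ a, ENNReal.ofReal |f a| ≤ indSeries A c a) :
    lorentzENorm ψ f ≤
      ∑' j, ENNReal.ofReal (c j * ψ ((volume : Measure unitInterval).real (A j))) := by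
  refine lorentzENorm_le_of_forall ψ hf fun w hw => ?_
  have hwm := hw.measurable
  calc ∫⁻ u, ENNReal.ofReal |f u| * ENNReal.ofReal (w u)
      ≤ ∫⁻ u, ∑' j, (A j).indicator (fun _ => ENNReal.ofReal (c j)) u * ENNReal.ofReal (w u) := by
        refine lintegral_mono fun u => ?_
        rw [ENNReal.tsum_mul_right]
        exact mul_le_mul_left (h u) _
    _ = ∑' j, ∫⁻ u, (A j).indicator (fun _ => ENNReal.ofReal (c j)) u * ENNReal.ofReal (w u) :=
        lintegral_tsum fun j => ((measurable_const.indicator (hA j)).mul (by fun_prop)).aemeasurable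
    _ ≤ _ := by
        refine ENNReal.tsum_le_tsum fun j => ?_
        have e : ∀ u, (A j).indicator (fun _ => ENNReal.ofReal (c j)) u * ENNReal.ofReal (w u) =
            (A j).indicator (fun u => ENNReal.ofReal (c j) * ENNReal.ofReal (w u)) u := fun u => by
          by_cases hu : u ∈ A j <;> simp [hu]
        simp_rw [e]
        rw [lintegral_indicator (hA j), lintegral_const_mul _ (by fun_prop),
          ENNReal.ofReal_mul (hc j)]
        exact mul_le_mul_right (hw.setLIntegral_le (hA j)) _

lemma lintegral_indSeries (hA : ∀ j, MeasurableSet (A j)) (hc : ∀ j, 0 ≤ c j) :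
    ∫⁻ a, indSeries A c a =
      ∑' j, ENNReal.ofReal (c j * (volume : Measure unitInterval).real (A j)) := by
  unfold indSeries
  rw [lintegral_tsum fun j => (measurable_const.indicator (hA j)).aemeasurable]
  refine tsum_congr fun j => ?_
  rw [lintegral_indicator (hA j), setLIntegral_const, ENNReal.ofReal_mul (hc j),
    ofReal_measureReal (measure_ne_top _ _)]

lemma ofReal_abs_indSeries_sub_le (hc : ∀ j, 0 ≤ c j) (J : ℕ) (a : unitInterval) :
    ENNReal.ofReal |(indSeries A c a).toReal -
        ∑ j ∈ Finset.range J, (A j).indicator (fun _ => c j) a| ≤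
      indSeries (fun j => A (j + J)) (fun j => c (j + J)) a := by
  set s := ∑ j ∈ Finset.range J, (A j).indicator (fun _ => c j) a with hs
  set t := indSeries (fun j => A (j + J)) (fun j => c (j + J)) a with ht
  have hs0 : 0 ≤ s := Finset.sum_nonneg fun j _ => indicator_nonneg (fun _ _ => hc j) a
  have hsplit : indSeries A c a = ENNReal.ofReal s + t := by
    rw [indSeries, ← Summable.sum_add_tsum_nat_add' (k := J) ENNReal.summable, ht, hs,
      ENNReal.ofReal_sum_of_nonneg fun j _ => indicator_nonneg (fun _ _ => hc j) a]
    congr 1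
    refine Finset.sum_congr rfl fun j _ => ?_
    by_cases hu : a ∈ A j <;> simp [hu]
  -- Where the series diverges its `toReal` is 0, but the right-hand side is infinite there.
  rcases eq_or_ne t ∞ with h | h
  · rw [h]; exact le_top
  · rw [hsplit, ENNReal.toReal_add ENNReal.ofReal_ne_top h, ENNReal.toReal_ofReal hs0,
      add_sub_cancel_left, abs_of_nonneg ENNReal.toReal_nonneg, ENNReal.ofReal_toReal h]

lemma le_toReal_indSeries {a : unitInterval} (ha : indSeries A c a ≠ ∞) {j : ℕ} (hj : a ∈ A j) :
    c j ≤ (indSeries A c a).toReal := by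
  have h : ENNReal.ofReal (c j) ≤ indSeries A c a := by
    have := ENNReal.le_tsum (f := fun j => (A j).indicator (fun _ => ENNReal.ofReal (c j)) a) j
    rwa [indicator_of_mem hj] at this
  exact (ENNReal.ofReal_le_iff_le_toReal ha).1 h

end Series

/-! ### Lower bounds for sums of independent copies -/

lemma measureReal_exists_mem_ge {V : ℕ → unitInterval → unitInterval} (hV : iIndepFun V volume)
    (hVp : ∀ n, MeasurePreserving (V n) volume volume) {A : Set unitInterval}
    (hA : MeasurableSet A) {v : ℝ} (hv : (volume : Measure unitInterval).real A = v) {k : ℕ}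
    (hkv : k * v ≤ 1) :
    k * v / 2 ≤ (volume : Measure unitInterval).real {a | ∃ i < k, V i a ∈ A} := by
  have hv0 : 0 ≤ v := hv ▸ measureReal_nonneg
  have hv1 : v ≤ 1 := hv ▸ measureReal_le_one
  have hset : {a | ∃ i < k, V i a ∈ A} = (⋂ i ∈ Finset.range k, V i ⁻¹' Aᶜ)ᶜ := by
    ext a; simp
  have hm : MeasurableSet (⋂ i ∈ Finset.range k, V i ⁻¹' Aᶜ) :=
    Finset.measurableSet_biInter _ fun i _ => (hVp i).measurable hA.compl
  have hprod : (volume : Measure unitInterval).real (⋂ i ∈ Finset.range k, V i ⁻¹' Aᶜ)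
      = (1 - v) ^ k := by
    have h := hV.measure_inter_preimage_eq_mul (Finset.range k) (sets := fun _ => Aᶜ)
      fun i _ => hA.compl
    rw [measureReal_def, h, ENNReal.toReal_prod]
    have : ∀ i ∈ Finset.range k, ((volume : Measure unitInterval) (V i ⁻¹' Aᶜ)).toReal = 1 - v := by
      intro i _
      rw [(hVp i).measure_preimage hA.compl.nullMeasurableSet, ← measureReal_def,
        probReal_compl_eq_one_sub hA, hv]
    rw [Finset.prod_congr rfl this]
    simp
  rw [hset, probReal_compl_eq_one_sub hm, hprod]
  -- From Bernoulli's (1 + v)^k ≥ 1 + kv. It yields 1 - (1 - v)^k ≥ kv/(1 + kv), which is at least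
  -- kv/2 because kv ≤ 1.
  have h1 : (1 - v) ^ k * (1 + k * v) ≤ 1 := by
    calc (1 - v) ^ k * (1 + k * v) ≤ (1 - v) ^ k * (1 + v) ^ k := by
          refine mul_le_mul_of_nonneg_left ?_ (pow_nonneg (by linarith) _)
          exact one_add_mul_le_pow (by linarith) k
      _ = (1 - v ^ 2) ^ k := by rw [← mul_pow]; ring
      _ ≤ 1 := pow_le_one₀ (by nlinarith) (by nlinarith)
  have hkv0 : 0 ≤ k * v := by positivity
  have h2 : 0 ≤ (1 - v) ^ k := pow_nonneg (by linarith) _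
  nlinarith

lemma measureReal_forall_mem {V : ℕ → unitInterval → unitInterval} (hV : iIndepFun V volume)
    (hVp : ∀ n, MeasurePreserving (V n) volume volume) {A : Set unitInterval}
    (hA : MeasurableSet A) {v : ℝ} (hv : (volume : Measure unitInterval).real A = v) (k : ℕ) :
    (volume : Measure unitInterval).real {a | ∀ i < k, V i a ∈ A} = v ^ k := by
  have hset : {a | ∀ i < k, V i a ∈ A} = ⋂ i ∈ Finset.range k, V i ⁻¹' A := by
    ext a; simp
  have h := hV.measure_inter_preimage_eq_mul (Finset.range k) (sets := fun _ => A)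
      fun i _ => hA
  rw [hset, measureReal_def, h, ENNReal.toReal_prod]
  have : ∀ i ∈ Finset.range k, ((volume : Measure unitInterval) (V i ⁻¹' A)).toReal = v := by
    intro i _
    rw [(hVp i).measure_preimage hA.nullMeasurableSet, ← measureReal_def, hv]
  rw [Finset.prod_congr rfl this]
  simp

lemma mul_psi_le_of_ae (ψ : Psi) {x : unitInterval → ℝ} (hx : Measurable x) {s : ℝ}
    {B : Set unitInterval} (hB : ∀ᵐ a, a ∈ B → s ≤ |x a|) :
    ENNReal.ofReal (s * ψ ((volume : Measure unitInterval).real B)) ≤ lorentzENorm ψ x := by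
  refine mul_psi_le_lorentzENorm ψ hx (measureReal_mem B) fun r hr => ?_
  refine ENNReal.toReal_mono (measure_ne_top _ _) (measure_mono_ae ?_)
  filter_upwards [hB] with a ha hab
  exact hr.trans_le (ha hab)

/-- The value of `ψ` behaves almost additively, or is almost insensitive to taking the
`k`-th power. -/
def IsBadScale (ψ : Psi) (k : ℕ) (u : ℝ) : Prop :=
  0 < u ∧ k * u ≤ 1 ∧ (k / 2 * ψ u ≤ ψ (k * u) ∨ 1 / 2 * ψ u ≤ ψ (u ^ k))

/-- Each alternative of a bad scale has its own event. If ψ is almost additive, some copy lies in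
`A` with probability at least ku/2 and the sum is at least c/2. If ψ ignores powers, all copies lie
in `A` with probability u^k and the sum is at least kc/2. `hmean` makes centring cost at most c/2.
-/
lemma lorentzENorm_sum_ge (ψ : Psi) {V : ℕ → unitInterval → unitInterval}
    (hV : iIndepFun V volume) (hVp : ∀ n, MeasurePreserving (V n) volume volume)
    {g : unitInterval → ℝ} (hg : Measurable g) (hg0 : ∀ a, 0 ≤ g a) {A : Set unitInterval}
    (hA : MeasurableSet A) {u c : ℝ} (hu : (volume : Measure unitInterval).real A = u) {k : ℕ}
    (hk : 1 ≤ k) (hbad : IsBadScale ψ k u) (hc : 0 ≤ c) (hgA : ∀ᵐ a, a ∈ A → c ≤ g a)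
    (hmean : 2 * k * ∫ a, g a ≤ c) :
    ENNReal.ofReal (k / 8 * (c * ψ u)) ≤
      lorentzENorm ψ (fun a => ∑ i ∈ Finset.range k, (g (V i a) - ∫ b, g b)) := by
  obtain ⟨hu0, hku, hor⟩ := hbad
  have hk0 : (0 : ℝ) ≤ k := Nat.cast_nonneg k
  have hk1 : (1 : ℝ) ≤ k := by exact_mod_cast hk
  have hu1 : u ≤ 1 := hu ▸ measureReal_le_one
  have hpu := ψ.pos hu0 hu1
  set S : unitInterval → ℝ := fun a => ∑ i ∈ Finset.range k, (g (V i a) - ∫ b, g b) with hS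
  have hSm : Measurable S := Finset.measurable_fun_sum _ fun i _ =>
    (hg.comp (hVp i).measurable).sub_const _
  have hSe : ∀ a, S a = ∑ i ∈ Finset.range k, g (V i a) - k * ∫ b, g b := fun a => by
    rw [hS]; simp [Finset.sum_sub_distrib]
  have hall : ∀ᵐ a, ∀ i, V i a ∈ A → c ≤ g (V i a) :=
    ae_all_iff.2 fun i => (hVp i).quasiMeasurePreserving.ae hgA
  rcases hor with h | h
  · refine le_trans (ENNReal.ofReal_le_ofReal ?_)
      (mul_psi_le_of_ae ψ hSm (s := c / 2) (B := {a | ∃ i < k, V i a ∈ A}) ?_)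
    · have h1 := measureReal_exists_mem_ge hV hVp hA hu hku
      have hkm : k * u / 2 ∈ Icc (0 : ℝ) 1 := ⟨by positivity, by linarith [mul_nonneg hk0 hu0.le]⟩
      have h2 := ψ.monotoneOn hkm (measureReal_mem {a | ∃ i < k, V i a ∈ A}) h1
      have h3 : ψ (k * u) ≤ 2 * ψ (k * u / 2) :=
        ψ.le_mul hkm ⟨by positivity, hku⟩ (by norm_num) (by linarith)
      have h4 : k / 4 * ψ u ≤ ψ ((volume : Measure unitInterval).real {a | ∃ i < k, V i a ∈ A}) := by
        linarith
      calc k / 8 * (c * ψ u) = c / 2 * (k / 4 * ψ u) := by ring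
        _ ≤ _ := by gcongr
    · filter_upwards [hall] with a ha hab
      obtain ⟨i, hi, hiA⟩ := hab
      have h1 : c ≤ ∑ i ∈ Finset.range k, g (V i a) :=
        (ha i hiA).trans (Finset.single_le_sum (f := fun i => g (V i a))
          (fun j _ => hg0 _) (Finset.mem_range.2 hi))
      refine le_trans ?_ (le_abs_self _)
      rw [hSe]; linarith
  · refine le_trans (ENNReal.ofReal_le_ofReal ?_)
      (mul_psi_le_of_ae ψ hSm (s := k * c / 2) (B := {a | ∀ i < k, V i a ∈ A}) ?_)
    · rw [measureReal_forall_mem hV hVp hA hu]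
      have h1 : k * c / 2 * (1 / 2 * ψ u) ≤ k * c / 2 * ψ (u ^ k) := by gcongr
      have h2 : 0 ≤ k * (c * ψ u) := by positivity
      linarith
    · filter_upwards [hall] with a ha hab
      have h1 : k * c ≤ ∑ i ∈ Finset.range k, g (V i a) := by
        calc k * c = ∑ _i ∈ Finset.range k, c := by simp
          _ ≤ _ := Finset.sum_le_sum fun i hi => ha i (hab i (Finset.mem_range.1 hi))
      refine le_trans ?_ (le_abs_self _)
      rw [hSe]
      have h2 : c ≤ k * c := le_mul_of_one_le_left hc hk1
      linarith

/-! ### Necessity -/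

lemma tsum_ofReal_half_pow (J : ℕ) :
    ∑' j, ENNReal.ofReal ((1 / 2 : ℝ) ^ (j + J)) = ENNReal.ofReal (2 * (1 / 2) ^ J) := by
  simp_rw [pow_add]
  rw [← ENNReal.ofReal_tsum_of_nonneg (fun _ => by positivity)
    (summable_geometric_two.mul_right _), tsum_mul_right, tsum_geometric_two]

/-- Necessity: if bad scales exist for all `k`, no exponent larger than `1` is admissible. -/
lemma notMem_GammaInd_of_bad {ψ : Psi}
    (hbad : ∀ k : ℕ, 2 ≤ k → ∃ᶠ u : ℝ in 𝓝[>] 0, IsBadScale ψ k u) {p : ℝ} (hp : 1 < p) :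
    p ∉ GammaInd ψ := by
  rintro ⟨-, hΓ⟩
  have hp1 : 0 < ψ 1 := ψ.pos one_pos le_rfl
  -- A sum of norm k 2^(-j)/8 exceeds k^(1/p) by the factor k^γ 2^(-j)/8; the numbers k_j are chosen
  -- to make this at least j/8.
  set γ : ℝ := 1 - 1 / p with hγ
  have hγ0 : 0 < γ := by
    rw [hγ, sub_pos, div_lt_one (by linarith)]; exact hp
  -- An upper bound for the mean of g, available before the scales are chosen: the j-th term
  -- contributes at most 2^(-j)/ψ(1).
  set M : ℝ := 2 / ψ 1 with hM
  have hM0 : 0 < M := by positivity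
  -- choice of the numbers of summands
  have hk : ∀ j : ℕ, ∃ k : ℕ, 2 ≤ k ∧ (j : ℝ) * 2 ^ j ≤ (k : ℝ) ^ γ := fun j =>
    ((eventually_ge_atTop 2).and (((tendsto_rpow_atTop hγ0).comp
      tendsto_natCast_atTop_atTop).eventually_ge_atTop _)).exists
  choose k hk2 hkγ using hk
  -- choice of the scales
  have hψ0 : Tendsto ψ.toFun (𝓝[>] 0) (𝓝 0) := by
    have h := (ψ.continuousOn 0 (by simp)).tendsto
    rw [ψ.map_zero] at h
    exact h.mono_left (by
      rw [← nhdsWithin_Ioc_eq_nhdsGT (zero_lt_one' ℝ)]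
      exact nhdsWithin_mono _ Ioc_subset_Icc_self)
  -- The last condition says that the coefficient 2^(-j)/ψ(u_j) is at least 2k_jM, so that centring
  -- k_j copies of g is harmless.
  have hu : ∀ j : ℕ, ∃ u : ℝ, IsBadScale ψ (k j) u ∧ u ≤ 1 ∧
      2 * k j * M * ψ u ≤ (1 / 2) ^ j := by
    intro j
    have hkj : (0 : ℝ) < k j := by have := hk2 j; positivity
    have h1 : ∀ᶠ u : ℝ in 𝓝[>] 0, ψ u < (1 / 2) ^ j / (2 * k j * M) :=
      hψ0.eventually (gt_mem_nhds (by positivity))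
    obtain ⟨u, hu1, hu2, hu3⟩ := ((hbad (k j) (hk2 j)).and_eventually
      (h1.and (Ioc_mem_nhdsGT (zero_lt_one' ℝ)))).exists
    refine ⟨u, hu1, hu3.2, ?_⟩
    rw [lt_div_iff₀ (by positivity)] at hu2
    linarith
  choose u hubad hu1 huψ using hu
  have hu0 : ∀ j, 0 < u j := fun j => (hubad j).1
  have hpu : ∀ j, 0 < ψ (u j) := fun j => ψ.pos (hu0 j) (hu1 j)
  set A : ℕ → Set unitInterval := fun j => {a | (a : ℝ) ≤ u j} with hA
  have hAm : ∀ j, MeasurableSet (A j) := fun j =>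
    measurableSet_le measurable_subtype_coe measurable_const
  have hAu : ∀ j, (volume : Measure unitInterval).real (A j) = u j := by
    intro j
    have : A j = Iic ⟨u j, (hu0 j).le, hu1 j⟩ := by ext a; rfl
    rw [this, measureReal_def, unitInterval.volume_Iic]
    exact ENNReal.toReal_ofReal (hu0 j).le
  set c : ℕ → ℝ := fun j => (1 / 2) ^ j / ψ (u j) with hc
  have hc0 : ∀ j, 0 ≤ c j := fun j => div_nonneg (by positivity) (hpu j).le
  have hcψ : ∀ j, c j * ψ (u j) = (1 / 2) ^ j := fun j => div_mul_cancel₀ _ (hpu j).ne'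
  have hcu : ∀ j, c j * u j ≤ (1 / 2) ^ j / ψ 1 := by
    intro j
    have h := ψ.mul_le ⟨(hu0 j).le, hu1 j⟩
    rw [le_div_iff₀ hp1, ← hcψ j, mul_assoc]
    exact mul_le_mul_of_nonneg_left h (hc0 j)
  set g : unitInterval → ℝ := fun a => (indSeries A c a).toReal with hg
  have hgm : Measurable g := (measurable_indSeries hAm).ennreal_toReal
  have hg0 : ∀ a, 0 ≤ g a := fun a => ENNReal.toReal_nonneg
  have hint : ∫⁻ a, indSeries A c a ≤ ENNReal.ofReal M := by
    rw [lintegral_indSeries hAm hc0]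
    calc ∑' j, ENNReal.ofReal (c j * (volume : Measure unitInterval).real (A j))
        ≤ ∑' j, ENNReal.ofReal ((1 / 2) ^ (j + 0)) * ENNReal.ofReal (1 / ψ 1) := by
          refine ENNReal.tsum_le_tsum fun j => ?_
          rw [hAu, ← ENNReal.ofReal_mul (by positivity), add_zero, mul_one_div]
          exact ENNReal.ofReal_le_ofReal (hcu j)
      _ = ENNReal.ofReal M := by
          rw [ENNReal.tsum_mul_right, tsum_ofReal_half_pow, ← ENNReal.ofReal_mul (by positivity)]
          congr 1
          rw [hM]; ring
  have hfin : ∀ᵐ a, indSeries A c a ≠ ∞ := by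
    filter_upwards [ae_lt_top (measurable_indSeries hAm)
      (ne_top_of_le_ne_top ENNReal.ofReal_ne_top hint)] with a ha using ha.ne
  have hmean : ∫ a, g a ≤ M := by
    rw [hg, integral_toReal (measurable_indSeries hAm).aemeasurable
      (hfin.mono fun a ha => lt_top_iff_ne_top.2 ha)]
    exact ENNReal.toReal_le_of_le_ofReal hM0.le hint
  have hgJ : ∀ J : ℕ, lorentzENorm ψ
      (fun a => g a - ∑ j ∈ Finset.range J, (A j).indicator (fun _ => c j) a) ≤
        ENNReal.ofReal (2 * (1 / 2) ^ J) := by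
    intro J
    refine (lorentzENorm_le_of_le_indSeries ψ (fun j => hAm (j + J)) (fun j => hc0 (j + J))
      (hgm.sub (Finset.measurable_fun_sum _ fun j _ => measurable_const.indicator (hAm j)))
      fun a => ofReal_abs_indSeries_sub_le hc0 J a).trans (le_of_eq ?_)
    rw [← tsum_ofReal_half_pow]
    exact tsum_congr fun j => by rw [hAu, hcψ]
  have hgfin : lorentzENorm ψ g < ∞ := by
    have := hgJ 0
    simp only [Finset.range_zero, Finset.sum_empty, sub_zero] at this
    exact this.trans_lt ENNReal.ofReal_lt_top
  -- the sequence
  obtain ⟨V, hVm, hVi, hVp⟩ := exists_iid_uniform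
  have hxm : ∀ n, Measurable fun a => g (V n a) - ∫ b, g b := fun n =>
    (hgm.comp (hVm n)).sub_const _
  have hxfin : ∀ n, lorentzENorm ψ (fun a => g (V n a) - ∫ b, g b) < ∞ := by
    intro n
    have h := lorentzENorm_add_le ψ (x := fun a => g (V n a)) (y := fun _ => -∫ b, g b)
      (hgm.comp (hVm n)) measurable_const
    rw [lorentzENorm_comp ψ hgm (hVp n)] at h
    exact h.trans_lt (ENNReal.add_lt_top.2
      ⟨hgfin, (lorentzENorm_const_le ψ _).trans_lt ENNReal.ofReal_lt_top⟩)
  set x : ℕ → Lorentz ψ := fun n => mkLorentz ψ _ (hxm n) (hxfin n) with hx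
  have hxae : ∀ n, ((x n : unitInterval →ₘ[volume] ℝ) : unitInterval → ℝ) =ᵐ[volume]
      fun a => g (V n a) - ∫ b, g b := fun n => mkLorentz_ae ψ _ (hxm n) (hxfin n)
  have hweak : WeaklyNull ψ x := by
    refine weaklyNull_of_iid hVi hVp hgm hgfin (fun ε hε => ?_) hxae
    obtain ⟨J, hJ⟩ := exists_pow_lt_of_lt_one (show 0 < ε / 2 by positivity)
      (show (1 / 2 : ℝ) < 1 by norm_num)
    refine ⟨fun a => ∑ j ∈ Finset.range J, (A j).indicator (fun _ => c j) a,
      ∑ j ∈ Finset.range J, c j + 1, Finset.measurable_fun_sum _ fun j _ =>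
        measurable_const.indicator (hAm j), ?_, fun a => ?_,
      (hgJ J).trans (ENNReal.ofReal_le_ofReal (by linarith))⟩
    · have := Finset.sum_nonneg fun j (_ : j ∈ Finset.range J) => hc0 j
      linarith
    · rw [abs_of_nonneg (Finset.sum_nonneg fun j _ => indicator_nonneg (fun _ _ => hc0 j) a)]
      have := Finset.sum_le_sum fun j (_ : j ∈ Finset.range J) =>
        indicator_le_self' (s := A j) (f := fun _ => c j) (fun _ _ => hc0 j) a
      linarith
  have hxind : iIndepFun (fun n => ((x n : unitInterval →ₘ[volume] ℝ) : unitInterval → ℝ))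
      volume := by
    have h1 : iIndepFun (fun n a => g (V n a) - ∫ b, g b) volume :=
      hVi.comp (fun _ a => g a - ∫ b, g b) fun _ => hgm.sub_const _
    exact h1.congr fun n => (hxae n).symm
  obtain ⟨τ, hτ, -, hBS⟩ := hΓ x hweak hxind
  -- No further thinning is needed: any extracted sequence still consists of centred independent
  -- copies of g.
  obtain ⟨C, hC⟩ := hBS id strictMono_id
  obtain ⟨j, hj⟩ := exists_nat_gt (8 * C)
  have hkj0 : (0 : ℝ) < k j := by have := hk2 j; positivity
  have hlow : k j / 8 * (1 / 2) ^ j ≤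
      lorentzNorm ψ (∑ i ∈ Finset.range (k j), (x ∘ τ) (id i)) := by
    rw [← ENNReal.ofReal_le_ofReal_iff (lorentzNorm_nonneg _), ofReal_lorentzNorm,
      lorentzENorm_congr ψ (coe_sum_ae _ _)]
    have hcongr : (fun a => ∑ i ∈ Finset.range (k j),
        (((x ∘ τ) (id i) : unitInterval →ₘ[volume] ℝ) : unitInterval → ℝ) a) =ᵐ[volume]
        fun a => ∑ i ∈ Finset.range (k j), (g (V (τ i) a) - ∫ b, g b) := by
      filter_upwards [ae_all_iff.2 hxae] with a ha
      exact Finset.sum_congr rfl fun i _ => ha (τ i)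
    rw [lorentzENorm_congr ψ hcongr, ← hcψ j]
    refine lorentzENorm_sum_ge ψ (V := fun i => V (τ i)) (hVi.precomp hτ.injective)
      (fun i => hVp _) hgm hg0 (hAm j) (hAu j) (by have := hk2 j; lia) (hubad j) (hc0 j) ?_ ?_
    · filter_upwards [hfin] with a ha haA
      exact le_toReal_indSeries ha haA
    · rw [hc]
      simp only
      rw [le_div_iff₀ (hpu j)]
      refine le_trans ?_ (huψ j)
      have := (hpu j).le
      gcongr
  have hup := hC (k j) (by have := hk2 j; lia)
  have h1 : (k j : ℝ) ^ (-(1 / p)) * (k j / 8 * (1 / 2) ^ j) ≤ C :=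
    (mul_le_mul_of_nonneg_left hlow (by positivity)).trans hup
  have h2 : (k j : ℝ) ^ (-(1 / p)) * (k j / 8 * (1 / 2) ^ j) = (k j : ℝ) ^ γ * (1 / 2) ^ j / 8 := by
    rw [hγ, sub_eq_neg_add, Real.rpow_add hkj0, Real.rpow_one]
    ring
  have h3 : (j : ℝ) ≤ (k j : ℝ) ^ γ * (1 / 2) ^ j := by
    have := mul_le_mul_of_nonneg_right (hkγ j) (show (0 : ℝ) ≤ (1 / 2) ^ j by positivity)
    rwa [mul_assoc, ← mul_pow, mul_one_div_cancel (by norm_num), one_pow, mul_one] at this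
  rw [h2] at h1
  linarith

/-- A condition that fails does so for every integer k ≥ 2. The limsup is then at least k,
respectively 1, so half of that value is exceeded at arbitrarily small u, and these are bad scales.
-/
lemma limsup_lt_of_GammaInd_ne {ψ : Psi} (h : GammaInd ψ ≠ {1}) :
    (∃ k : ℕ, 2 ≤ k ∧ limsup (fun u : ℝ => ψ (k * u) / ψ u) (𝓝[>] 0) < k) ∧
      ∃ l : ℕ, 2 ≤ l ∧ limsup (fun u : ℝ => ψ (u ^ l) / ψ u) (𝓝[>] 0) < 1 := by
  obtain ⟨p, hp, hpΓ⟩ : ∃ p, 1 < p ∧ p ∈ GammaInd ψ := by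
    by_contra! hcon
    refine h (Subset.antisymm (fun p hp => ?_) (singleton_subset_iff.2 (one_mem_GammaInd ψ)))
    exact le_antisymm (not_lt.1 fun hlt => hcon p hlt hp) hp.1
  by_contra hneg
  rw [not_and_or] at hneg
  refine notMem_GammaInd_of_bad (fun k hk => ?_) hp hpΓ
  have hk0 : (0 : ℝ) < k := by positivity
  have hsmall := ψ.div_mul_le (k := k) (by lia)
  have hpow := ψ.div_pow_le (l := k) (by lia)
  rcases hneg with hneg | hneg
  · push Not at hneg
    have h1 : ∃ᶠ u : ℝ in 𝓝[>] 0, (k : ℝ) / 2 < ψ (k * u) / ψ u :=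
      frequently_lt_of_lt_limsup (IsBoundedUnder.isCoboundedUnder_le
        ⟨0, eventually_map.2 (hsmall.mono fun u hu => hu.2.2.1)⟩)
        (lt_of_lt_of_le (by linarith) (hneg k hk))
    refine (h1.and_eventually (hsmall.and hpow)).mono fun u hu => ?_
    obtain ⟨hu1, hu2, hu3⟩ := hu
    exact ⟨hu2.1, hu2.2.1, Or.inl ((lt_div_iff₀ (ψ.pos hu2.1 hu3.2.1)).1 hu1).le⟩
  · push Not at hneg
    have h1 : ∃ᶠ u : ℝ in 𝓝[>] 0, (1 : ℝ) / 2 < ψ (u ^ k) / ψ u :=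
      frequently_lt_of_lt_limsup (IsBoundedUnder.isCoboundedUnder_le
        ⟨0, eventually_map.2 (hpow.mono fun u hu => hu.2.2.1)⟩)
        (lt_of_lt_of_le (by norm_num) (hneg k hk))
    refine (h1.and_eventually (hsmall.and hpow)).mono fun u hu => ?_
    obtain ⟨hu1, hu2, hu3⟩ := hu
    exact ⟨hu2.1, hu2.2.1, Or.inr ((lt_div_iff₀ (ψ.pos hu2.1 hu3.2.1)).1 hu1).le⟩

end LorentzBS

theorem mainTheorem9 (ψ : LorentzBS.Psi) :
    LorentzBS.GammaInd ψ ≠ {1} ↔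
      (∃ k : ℕ, 2 ≤ k ∧
        Filter.limsup (fun u : ℝ => ψ (k * u) / ψ u) (nhdsWithin 0 (Set.Ioi 0)) < k) ∧
      (∃ l : ℕ, 2 ≤ l ∧
        Filter.limsup (fun u : ℝ => ψ (u ^ l) / ψ u) (nhdsWithin 0 (Set.Ioi 0)) < 1) := by
  refine ⟨fun h => LorentzBS.limsup_lt_of_GammaInd_ne h, ?_⟩
  rintro ⟨⟨k, hk, h1⟩, l, hl, h2⟩
  exact LorentzBS.GammaInd_ne_of_limsup ψ hk hl h1 h2
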